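/- **Setting.** Consider the synchronous multiparty session $\pi$-calculus with crash-stop failures. Channels are $c ::= x \mid s[p]$ (a variable, or the endpoint of session $s$ with role $p$), data are $d ::= v \mid c$ with $v$ a basic value, and processes are $$P ::= \mathbf 0 \mid (\nu s{:}\Gamma')P \mid P\,|\,P \mid c[q]\oplus \ell\langle d\rangle.P \mid c[q]\&\{\ell_i(x_i).P_i\}_{i\in I} \mid \mathbf{def}\ X(x_1{:}S_1,\dots,x_n{:}S_n)=P\ \mathbf{in}\ P \mid X\langle d_1,\dots,d_n\rangle \mid \mathsf{err} \mid s[p]{\lightning}$$ ($I$ finite and non-empty; the label $\mathsf{crash}$ is only allowed in $\&$; $s[p]{\lightning}$ is a crashed endpoint). $\equiv$ is the usual structural congruence, extended with $(\nu s)(s[p_1]{\lightning}|\cdots|s[p_n]{\lightning})\equiv\mathbf 0$. Reduction $\to$ consists of communication (or $\mathsf{err}$ on a label mismatch), process calls, the crash of a process at a selection or branching (all endpoints that are free in it become crashed), loss of a message sent to a crashed endpoint (an endpoint sent as payload becomes crashed), and crash detection (a branching from a crashed endpoint takes its $\mathsf{crash}$ branch), closed under reduction contexts and $\equiv$. Session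 types $T$ are closed, guarded recursive internal and external choices (with pairwise distinct labels, $\mathsf{crash}$ only in external choices) and $\mathbf{end}$; payload types $S$ are basic types or session types; endpoints have types $U ::= T\mid\mathsf{stop}$. $\leqslant$ is coinductive session subtyping (a subtype has wider internal and narrower external choices; a supertype of an external choice whose only branch is $\mathsf{crash}$ has no further branches; $\mathsf{stop}\leqslant\mathsf{stop}$). $\Gamma\vdash P$ is the linear typing judgement (without free process variables), where sending or passing data of a type $S\leqslant\mathbf{end}$ is forbidden and each restricted session is typed by a context that is $(s';\mathcal R')$-safe for some $\mathcal R'$. $\mathrm{end}(\Gamma)$ means that each entry of $\Gamma$ is basic or $\leqslant\mathbf{end}$. For a session $s$ and a set $\mathcal R$ of (reliable) roles, $\Gamma\to_{s;\mathcal R}\Gamma'$ means that $\Gamma$ moves to $\Gamma'$ by the transmission in $s$ of a message (possibly to a crashed endpoint), by the detection in $s$ of a crash, or by the crash of an endpoint $s[p]$ with $p\notin\mathcal R$ and type $\not\leqslant\mathbf{end}$, whose type becomes $\mathsf{stop}$. $\Gamma$ is $(s;\mathcal R)$-*safe* if it belongs to a set of contexts that is closed under $\to_{s;\mathcal R}$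 and in each element of which (a) if $s[p]$ can output $\ell$ to $q$ and $s[q]$ can input from $p$, then $\ell$ can be transmitted from $p$ to $q$; (b) if $s[p]$ is crashed and $s[q]$ can input from $p$, then $q$ can detect the crash of $p$. *Assumption-abiding reduction.* Let $\Gamma\vdash P$, with $\Gamma$ $(s';\mathcal R_{s'})$-safe for each session $s'$ of $\Gamma$. Then $P\to_\checkmark P'$ means that $P\to P'$; that for no $s'$ in $\Gamma$ and $p\in\mathcal R_{s'}$ there is $Q$ with $P'\equiv Q\,|\,s'[p]{\lightning}$; and that, whenever $P\equiv(\nu s'{:}\Gamma_{s'})Q$ with the latter typed by $\Gamma$, $P'\equiv(\nu s')Q'$ and $Q\to Q'$, there is $\mathcal R'$ such that $\Gamma_{s'}$ is $(s';\mathcal R')$-safe and there are no $p\in\mathcal R'$, $Q''$ with $Q'\equiv Q''\,|\,s'[p]{\lightning}$. $\to_\checkmark^+$ is its transitive closure, where each process in the chain is typed by a context that is reached from the previous one by (zero or more) transmissions, crash detections or crashes. *Guarded definitions.* $P$ has guarded definitions if, in each declaration $X(x_1{:}S_1,\dots,x_n{:}S_n)=Q$ in $P$, every process call in $Q$ occurs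 under a selection or branching, and, if $S_i$ is a session type, every call in $Q$ that has $x_i$ as an argument occurs under a selection or branching on $x_i$. *Only plays.* $P$ only plays $p$ in $s$, by $\Gamma$, if $\Gamma\vdash P$, $P$ has guarded definitions and no free variables, $\Gamma=\Gamma_0,\,s[p]{:}U$ with $U\not\leqslant\mathbf{end}$ and $\mathrm{end}(\Gamma_0)$, and each subterm $(\nu s'{:}\Gamma')P'$ of $P$ satisfies $\mathrm{end}(\Gamma')$. **Theorem (Session Fidelity).** Assume $\Gamma\vdash P$, where $\Gamma$ is $(s;\mathcal R)$-safe and $\Gamma(s[p])\neq\mathsf{stop}$ for all $p\in\mathcal R$. Assume that $P\equiv\prod_{p\in I}P_p$ and $\Gamma=\bigcup_{p\in I}\Gamma_p$ for a finite set $I$ of roles, such that for each $p\in I$: (1) $\Gamma_p\vdash P_p$, and (2) either $P_p\equiv\mathbf 0$, or $P_p$ only plays $p$ in $s$, by $\Gamma_p$. Let $\mathcal R_s=\mathcal R$ and let $\mathcal R_{s'}$, for the other sessions $s'$, be arbitrary sets of roles. If $\Gamma\to_{s;\mathcal R}\Gamma''$ for some $\Gamma''$, then there are $\Gamma',P'$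 such that $\Gamma\to_{s;\mathcal R}\Gamma'$, $P\to_\checkmark^+P'$ and $\Gamma'\vdash P'$, where $\Gamma'$ is $(s;\mathcal R)$-safe, and $P'\equiv\prod_{p\in I}P'_p$ and $\Gamma'=\bigcup_{p\in I}\Gamma'_p$ such that for each $p\in I$: (1) $\Gamma'_p\vdash P'_p$, and (2) either $P'_p\equiv\mathbf 0$, or $P'_p$ only plays $p$ in $s$, by $\Gamma'_p$. -/

import Mathlib

/-!
Multiparty session calculus with crash-stop failures, and its session type system.

Binders are represented by de Bruijn indices, so that alpha-equivalent terms are equal.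
There are three independent index spaces: variables (bound by branchings and by the parameters
of process declarations), sessions (bound by restrictions), process variables (bound by process
declarations).
-/

namespace MPST

/-- The parameters of the calculus: a set of roles, a set of (sendable) message labels, basic
values and basic types, with a standard subtyping for basic types: a preorder that is sound for
membership of values. -/
structure Signature where
  Role : Type
  Lab : Type
  BTy : Type
  Val : Type
  HasTy : Val → BTy → Prop
  BSub : BTy → BTy → Prop
  bsub_refl : ∀ b, BSub b b
  bsub_trans : ∀ a b c, BSub a b → BSub b c → BSub a c
  hasTy_of_bsub : ∀ v a b, HasTy v a → BSub a b → HasTy v b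
  unitTy : BTy
  unitVal : Val
  unit_hasTy : HasTy unitVal unitTy

/-- Message labels that may occur in external choices: the sendable ones and the distinguished
label `crash`. Internal choices and selections only use sendable labels. -/
inductive Label (K : Signature) where
  | msg (l : K.Lab)
  | crash

/-! ### Types -/

mutual

/-- Session types. Choices have a non-empty, finite index set `Fin (n + 1)`; `tvar i` is bound by
the `i`-th enclosing `mu`; `done` is the terminated type `end`. -/
inductive SType (K : Signature) : Type where
  | ext (q : K.Role) (n : ℕ) (lab : Fin (n + 1) → Label K) (pay : Fin (n + 1) → Payload K)
      (cont : Fin (n + 1) → SType K)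
  | int (q : K.Role) (n : ℕ) (lab : Fin (n + 1) → K.Lab) (pay : Fin (n + 1) → Payload K)
      (cont : Fin (n + 1) → SType K)
  | mu (T : SType K)
  | tvar (i : ℕ)
  | done

/-- Payload types: basic types or session types. -/
inductive Payload (K : Signature) : Type where
  | base (b : K.BTy)
  | sess (T : SType K)

end

/-- Types of session endpoints: session types or the crash type `crashed`. -/
inductive UType (K : Signature) where
  | sess (T : SType K)
  | crashed

variable {K : Signature}

mutual

/-- `T.subst k U` replaces the type variable `k` of `T` by the closed type `U` (which, being
closed, needs no shifting under binders). -/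
def SType.subst : SType K → ℕ → SType K → SType K
  | .ext q n lab pay cont, k, U =>
      .ext q n lab (fun i => (pay i).subst k U) (fun i => (cont i).subst k U)
  | .int q n lab pay cont, k, U =>
      .int q n lab (fun i => (pay i).subst k U) (fun i => (cont i).subst k U)
  | .mu T, k, U => .mu (T.subst (k + 1) U)
  | .tvar i, k, U => if i = k then U else .tvar i
  | .done, _, _ => .done

def Payload.subst : Payload K → ℕ → SType K → Payload K
  | .base b, _, _ => .base b
  | .sess T, k, U => .sess (T.subst k U)

end

/-- The unfolding `T[mu T / t]` of `mu T`. -/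
def SType.unfold (T : SType K) : SType K := T.subst 0 (.mu T)

/-- The type variable `k` occurs in `T` outside every internal or external choice. -/
def SType.Unguarded : SType K → ℕ → Prop
  | .tvar i, k => i = k
  | .mu T, k => T.Unguarded (k + 1)
  | _, _ => False

mutual

/-- `T.WF k`: the free type variables of `T` are below `k`, recursion variables are guarded, and
the labels of each choice are pairwise distinct. -/
def SType.WF : SType K → ℕ → Prop
  | .ext _ _ lab pay cont, k =>
      Function.Injective lab ∧ (∀ i, (pay i).WF k) ∧ (∀ i, (cont i).WF k)
  | .int _ _ lab pay cont, k =>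
      Function.Injective lab ∧ (∀ i, (pay i).WF k) ∧ (∀ i, (cont i).WF k)
  | .mu T, k => ¬ T.Unguarded 0 ∧ T.WF (k + 1)
  | .tvar i, k => i < k
  | .done, _ => True

def Payload.WF : Payload K → ℕ → Prop
  | .base _, _ => True
  | .sess T, k => T.WF k

end

/-- The rules of subtyping, with premises taken in `R`. -/
inductive SubStep (R : Payload K → Payload K → Prop) : Payload K → Payload K → Prop where
  | base {b b'} (h : K.BSub b b') : SubStep R (.base b) (.base b')
  | done : SubStep R (.sess .done) (.sess .done)
  | int {q n m lab pay cont lab' pay' cont'}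
      (h : ∀ j : Fin (m + 1), ∃ i : Fin (n + 1),
        lab i = lab' j ∧ R (pay' j) (pay i) ∧ R (.sess (cont i)) (.sess (cont' j))) :
      SubStep R (.sess (.int q n lab pay cont)) (.sess (.int q m lab' pay' cont'))
  | ext {q n m lab pay cont lab' pay' cont'}
      (h : ∀ i : Fin (n + 1), ∃ j : Fin (m + 1),
        lab i = lab' j ∧ R (pay i) (pay' j) ∧ R (.sess (cont i)) (.sess (cont' j)))
      (hpure : n = 0 → lab 0 = .crash → m = 0) :
      SubStep R (.sess (.ext q n lab pay cont)) (.sess (.ext q m lab' pay' cont'))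
  | muL {T T'} (h : R (.sess T.unfold) (.sess T')) : SubStep R (.sess (.mu T)) (.sess T')
  | muR {T T'} (h : R (.sess T) (.sess T'.unfold)) : SubStep R (.sess T) (.sess (.mu T'))

/-- Coinductive subtyping: the largest relation that is closed backwards under the rules. Types
are closed and guarded by convention, so that subtyping only relates such types. -/
def Payload.Sub (S S' : Payload K) : Prop :=
  S.WF 0 ∧ S'.WF 0 ∧
    ∃ R : Payload K → Payload K → Prop, (∀ a b, R a b → SubStep R a b) ∧ R S S'

/-- Subtyping on types of endpoints: `crashed` is only related to itself. -/
def UType.Sub : UType K → UType K → Prop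
  | .sess T, .sess T' => (Payload.sess T).Sub (.sess T')
  | .crashed, .crashed => True
  | _, _ => False

/-! ### Processes -/

/-- Channels: a variable, or the endpoint of session `s` with role `p`. -/
inductive Chan (K : Signature) where
  | var (x : ℕ)
  | ep (s : ℕ) (p : K.Role)

/-- Data: a basic value, or a channel. -/
inductive Datum (K : Signature) where
  | val (v : K.Val)
  | chan (c : Chan K)

/-- Run-time data: a basic value, or an endpoint. -/
inductive Value (K : Signature) where
  | val (v : K.Val)
  | ep (s : ℕ) (p : K.Role)

def Value.toDatum : Value K → Datum K
  | .val v => .val v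
  | .ep s p => .chan (.ep s p)

/-- Processes.
* `res A P`: restriction of session `0` of `P`, annotated with the types `A` of its endpoints;
* `sel c q l d P`: selection towards `q` of label `l` with payload `d`;
* `branch c q n lab P`: branching from `q`; each `P i` binds the payload variable `0`;
* `defn Ss D P`: declaration of process variable `0` with body `D`, in scope in `D` and `P`; `D`
  binds in addition the parameters `0, …, Ss.length - 1`, annotated with the types `Ss`;
* `crashed s p`: crashed endpoint. -/
inductive Proc (K : Signature) : Type where
  | nil
  | par (P Q : Proc K)
  | res (A : K.Role → Option (UType K)) (P : Proc K)
  | sel (c : Chan K) (q : K.Role) (l : K.Lab) (d : Datum K) (P : Proc K)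
  | branch (c : Chan K) (q : K.Role) (n : ℕ) (lab : Fin (n + 1) → Label K)
      (P : Fin (n + 1) → Proc K)
  | defn (Ss : List (Payload K)) (D P : Proc K)
  | call (X : ℕ) (ds : List (Datum K))
  | err
  | crashed (s : ℕ) (p : K.Role)

/-- Parallel composition of a list of processes. -/
def bigPar (Ps : List (Proc K)) : Proc K := Ps.foldr .par .nil

/-- Extension of an index renaming under one binder. -/
def liftRen (ρ : ℕ → ℕ) : ℕ → ℕ
  | 0 => 0
  | n + 1 => ρ n + 1

/-- Exchange of the indices `0` and `1`. -/
def swapRen : ℕ → ℕ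
  | 0 => 1
  | 1 => 0
  | n + 2 => n + 2

def Chan.renS (ρ : ℕ → ℕ) : Chan K → Chan K
  | .var x => .var x
  | .ep s p => .ep (ρ s) p

def Datum.renS (ρ : ℕ → ℕ) : Datum K → Datum K
  | .val v => .val v
  | .chan c => .chan (c.renS ρ)

/-- Renaming of sessions. -/
def Proc.renS : Proc K → (ℕ → ℕ) → Proc K
  | .nil, _ => .nil
  | .par P Q, ρ => .par (P.renS ρ) (Q.renS ρ)
  | .res A P, ρ => .res A (P.renS (liftRen ρ))
  | .sel c q l d P, ρ => .sel (c.renS ρ) q l (d.renS ρ) (P.renS ρ)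
  | .branch c q n lab P, ρ => .branch (c.renS ρ) q n lab (fun i => (P i).renS ρ)
  | .defn Ss D P, ρ => .defn Ss (D.renS ρ) (P.renS ρ)
  | .call X ds, ρ => .call X (ds.map (Datum.renS ρ))
  | .err, _ => .err
  | .crashed s p, ρ => .crashed (ρ s) p

/-- Renaming of process variables. -/
def Proc.renX : Proc K → (ℕ → ℕ) → Proc K
  | .nil, _ => .nil
  | .par P Q, ρ => .par (P.renX ρ) (Q.renX ρ)
  | .res A P, ρ => .res A (P.renX ρ)
  | .sel c q l d P, ρ => .sel c q l d (P.renX ρ)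
  | .branch c q n lab P, ρ => .branch c q n lab (fun i => (P i).renX ρ)
  | .defn Ss D P, ρ => .defn Ss (D.renX (liftRen ρ)) (P.renX (liftRen ρ))
  | .call X ds, ρ => .call (ρ X) ds
  | .err, _ => .err
  | .crashed s p, _ => .crashed s p

/-- Shift of the variables of a datum by `n`. -/
def Datum.shiftV (n : ℕ) : Datum K → Datum K
  | .val v => .val v
  | .chan (.var x) => .chan (.var (x + n))
  | .chan (.ep s p) => .chan (.ep s p)

/-- Extension of a substitution under the binders of `n` variables. -/
def liftSub (n : ℕ) (σ : ℕ → Datum K) : ℕ → Datum K :=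
  fun i => if i < n then .chan (.var i) else (σ (i - n)).shiftV n

def Chan.subst (σ : ℕ → Datum K) : Chan K → Datum K
  | .var x => σ x
  | .ep s p => .chan (.ep s p)

def Datum.subst (σ : ℕ → Datum K) : Datum K → Datum K
  | .val v => .val v
  | .chan c => c.subst σ

/-- Substitution of data for variables. Replacing the subject of a selection or branching by a
basic value does not give a process of the calculus; the result is then the error process (this
never happens to a well-typed process). -/
def Proc.subst : Proc K → (ℕ → Datum K) → Proc K
  | .nil, _ => .nil
  | .par P Q, σ => .par (P.subst σ) (Q.subst σ)
  | .res A P, σ => .res A (P.subst (fun i => (σ i).renS Nat.succ))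
  | .sel c q l d P, σ =>
      match c.subst σ with
      | .chan c' => .sel c' q l (d.subst σ) (P.subst σ)
      | .val _ => .err
  | .branch c q n lab P, σ =>
      match c.subst σ with
      | .chan c' => .branch c' q n lab (fun i => (P i).subst (liftSub 1 σ))
      | .val _ => .err
  | .defn Ss D P, σ => .defn Ss (D.subst (liftSub Ss.length σ)) (P.subst σ)
  | .call X ds, σ => .call X (ds.map (Datum.subst σ))
  | .err, _ => .err
  | .crashed s p, _ => .crashed s p

/-- The substitution of `ws` for the variables `0, …, ws.length - 1`. -/
def inst (ws : List (Value K)) : ℕ → Datum K :=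
  fun i => match ws[i]? with
    | some w => w.toDatum
    | none => .chan (.var (i - ws.length))

def Chan.fc : Chan K → Set (ℕ × K.Role)
  | .var _ => ∅
  | .ep s p => {(s, p)}

def Datum.fc : Datum K → Set (ℕ × K.Role)
  | .val _ => ∅
  | .chan c => c.fc

/-- Free channels with roles of a process. -/
def Proc.fc : Proc K → Set (ℕ × K.Role)
  | .nil => ∅
  | .par P Q => P.fc ∪ Q.fc
  | .res _ P => {x | (x.1 + 1, x.2) ∈ P.fc}
  | .sel c _ _ d P => c.fc ∪ d.fc ∪ P.fc
  | .branch c _ _ _ P => c.fc ∪ ⋃ i, (P i).fc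
  | .defn _ D P => D.fc ∪ P.fc
  | .call _ ds => {x | ∃ d ∈ ds, x ∈ d.fc}
  | .err => ∅
  | .crashed s p => {(s, p)}

def Chan.fv : Chan K → Set ℕ
  | .var x => {x}
  | .ep _ _ => ∅

def Datum.fv : Datum K → Set ℕ
  | .val _ => ∅
  | .chan c => c.fv

/-- Free variables of a process. -/
def Proc.fv : Proc K → Set ℕ
  | .nil => ∅
  | .par P Q => P.fv ∪ Q.fv
  | .res _ P => P.fv
  | .sel c _ _ d P => c.fv ∪ d.fv ∪ P.fv
  | .branch c _ _ _ P => c.fv ∪ ⋃ i, {x | x + 1 ∈ (P i).fv}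
  | .defn Ss D P => {x | x + Ss.length ∈ D.fv} ∪ P.fv
  | .call _ ds => {x | ∃ d ∈ ds, x ∈ d.fv}
  | .err => ∅
  | .crashed _ _ => ∅

/-- Structural congruence. A side condition of the form "this name does not occur free in `P`" is
expressed by writing `P` as a shifted process. Annotations of restrictions play no role. -/
inductive Cong : Proc K → Proc K → Prop where
  | refl (P) : Cong P P
  | symm {P Q} : Cong P Q → Cong Q P
  | trans {P Q R} : Cong P Q → Cong Q R → Cong P R
  | par {P P' Q Q'} : Cong P P' → Cong Q Q' → Cong (.par P Q) (.par P' Q')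
  | res {A P P'} : Cong P P' → Cong (.res A P) (.res A P')
  | sel {c q l d P P'} : Cong P P' → Cong (.sel c q l d P) (.sel c q l d P')
  | branch {c q n lab} {P P' : Fin (n + 1) → Proc K} :
      (∀ i, Cong (P i) (P' i)) → Cong (.branch c q n lab P) (.branch c q n lab P')
  | defn {Ss D D' P P'} : Cong D D' → Cong P P' → Cong (.defn Ss D P) (.defn Ss D' P')
  | parComm (P Q) : Cong (.par P Q) (.par Q P)
  | parAssoc (P Q R) : Cong (.par (.par P Q) R) (.par P (.par Q R))
  | parNil (P) : Cong (.par P .nil) P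
  | resElim (A) : Cong (.res A .nil) .nil
  | resSwap (A A' P) : Cong (.res A (.res A' P)) (.res A' (.res A (P.renS swapRen)))
  | resLift (A P Q) : Cong (.res A (.par (P.renS Nat.succ) Q)) (.par P (.res A Q))
  | crashElim (A) (ps : List K.Role) :
      Cong (.res A (bigPar (ps.map (Proc.crashed 0)))) .nil
  | defElim (Ss D) : Cong (.defn Ss D .nil) .nil
  | defLift (Ss D A P) :
      Cong (.defn Ss D (.res A P)) (.res A (.defn Ss (D.renS Nat.succ) P))
  | defParLift (Ss D P Q) :
      Cong (.defn Ss D (.par P (Q.renX Nat.succ))) (.par (.defn Ss D P) Q)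
  | defOrd (Ss D Ss' D' P) :
      Cong (.defn Ss D (.defn Ss' (D'.renX (liftRen Nat.succ)) P))
        (.defn Ss' D' (.defn Ss (D.renX (liftRen Nat.succ)) (P.renX swapRen)))

/-- Reduction, including the reductions that crash a process. Since annotations of restrictions
are not part of the unannotated calculus, a reduction under a restriction may change them. -/
inductive Red : Proc K → Proc K → Prop where
  | comm {s p q n lab P l w Q} (k : Fin (n + 1)) (hk : lab k = .msg l) :
      Red (.par (.branch (.ep s p) q n lab P) (.sel (.ep s q) p l (Value.toDatum w) Q))
        (.par ((P k).subst (inst [w])) Q)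
  | errLabel {s p q n lab P l w Q} (h : ∀ i : Fin (n + 1), lab i ≠ .msg l) :
      Red (.par (.branch (.ep s p) q n lab P) (.sel (.ep s q) p l (Value.toDatum w) Q)) .err
  | call {Ss D Q} (ws : List (Value K)) (h : ws.length = Ss.length) :
      Red (.defn Ss D (.par (.call 0 (ws.map Value.toDatum)) Q))
        (.defn Ss D (.par (D.subst (inst ws)) Q))
  | ctxPar {P P' Q} : Red P P' → Red (.par P Q) (.par P' Q)
  | ctxRes {A A' P P'} : Red P P' → Red (.res A P) (.res A' P')
  | ctxDef {Ss D P P'} : Red P P' → Red (.defn Ss D P) (.defn Ss D P')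
  | cong {P P' Q Q'} : Cong P' P → Red P Q → Cong Q Q' → Red P' Q'
  | crashSel {s p q l w P'} (js : List (ℕ × K.Role)) (hnd : js.Nodup)
      (hjs : ∀ j, j ∈ js ↔ j ∈ (Proc.sel (.ep s p) q l (Value.toDatum w) P').fc) :
      Red (.sel (.ep s p) q l (Value.toDatum w) P')
        (bigPar (js.map fun j => .crashed j.1 j.2))
  | crashBranch {s p q n lab P} (js : List (ℕ × K.Role)) (hnd : js.Nodup)
      (hjs : ∀ j, j ∈ js ↔ j ∈ (Proc.branch (.ep s p) q n lab P).fc) :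
      Red (.branch (.ep s p) q n lab P) (bigPar (js.map fun j => .crashed j.1 j.2))
  | lostVal {s p q l v Q} :
      Red (.par (.crashed s p) (.sel (.ep s q) p l (.val v) Q)) (.par (.crashed s p) Q)
  | lostChan {s p q l s' r Q} :
      Red (.par (.crashed s p) (.sel (.ep s q) p l (.chan (.ep s' r)) Q))
        (.par (.crashed s p) (.par (.crashed s' r) Q))
  /-- Crash detection. The payload of the label `crash` is the omitted unit: the (normally
  unused) payload variable of the crash handling branch is replaced by the unit value. -/
  | detect {s p q n lab P} (k : Fin (n + 1)) (hk : lab k = .crash) :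
      Red (.par (.branch (.ep s p) q n lab P) (.crashed s q))
        (.par ((P k).subst (inst [.val K.unitVal])) (.crashed s q))

/-! ### Typing contexts -/

/-- Typing contexts: partial maps from variables to payload types, and from endpoints to session
types or `crashed`. -/
@[ext]
structure Ctx (K : Signature) where
  var : ℕ → Option (Payload K)
  ep : ℕ → K.Role → Option (UType K)

namespace Ctx

def empty : Ctx K := ⟨fun _ => none, fun _ _ => none⟩

open Classical in
/-- The context `x : S`. -/
noncomputable def singleVar (x : ℕ) (S : Payload K) : Ctx K :=
  ⟨fun y => if y = x then some S else none, fun _ _ => none⟩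

open Classical in
/-- The context `s[p] : U`. -/
noncomputable def singleEp (s : ℕ) (p : K.Role) (U : UType K) : Ctx K :=
  ⟨fun _ => none, fun s' p' => if s' = s ∧ p' = p then some U else none⟩

/-- The context `c : T`, for a session type `T`. -/
noncomputable def singleChan (T : SType K) : Chan K → Ctx K
  | .var x => singleVar x (.sess T)
  | .ep s p => singleEp s p (.sess T)

def union (Γ₁ Γ₂ : Ctx K) : Ctx K :=
  ⟨fun x => (Γ₁.var x).or (Γ₂.var x), fun s p => (Γ₁.ep s p).or (Γ₂.ep s p)⟩

/-- The domains are disjoint. -/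
def Disj (Γ₁ Γ₂ : Ctx K) : Prop :=
  (∀ x, Γ₁.var x = none ∨ Γ₂.var x = none) ∧ (∀ s p, Γ₁.ep s p = none ∨ Γ₂.ep s p = none)

/-- `Γ` is the composition `Γ₁, Γ₂`, which is defined iff the domains are disjoint. -/
def Split (Γ Γ₁ Γ₂ : Ctx K) : Prop := Disj Γ₁ Γ₂ ∧ Γ = union Γ₁ Γ₂

/-- Extension with the variable `0 : S`, below a binder of one variable. -/
def consVar (S : Payload K) (Γ : Ctx K) : Ctx K :=
  ⟨fun | 0 => some S | x + 1 => Γ.var x, Γ.ep⟩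

/-- Extension with the endpoints of session `0`, below a restriction. -/
def consSess (A : K.Role → Option (UType K)) (Γ : Ctx K) : Ctx K :=
  ⟨Γ.var, fun | 0 => A | s + 1 => Γ.ep s⟩

/-- The context `0 : S₀, …, n : Sₙ` of the parameters of a process declaration. -/
def ofList (Ss : List (Payload K)) : Ctx K := ⟨fun x => Ss[x]?, fun _ _ => none⟩

/-- Session `s` occurs in `Γ`. -/
def HasSession (Γ : Ctx K) (s : ℕ) : Prop := ∃ p U, Γ.ep s p = some U

/-- All entries are basic or terminated. -/
def Ended (Γ : Ctx K) : Prop :=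
  (∀ x S, Γ.var x = some S → (∃ b, S = .base b) ∨ S.Sub (.sess .done)) ∧
  (∀ s p U, Γ.ep s p = some U → U.Sub (.sess .done))

/-- `Γ` is the union of the contexts `Γs p`, for `p ∈ I`. -/
def IsUnion (Γ : Ctx K) (I : Finset K.Role) (Γs : K.Role → Ctx K) : Prop :=
  (∀ x S, Γ.var x = some S ↔ ∃ p ∈ I, (Γs p).var x = some S) ∧
  (∀ s r U, Γ.ep s r = some U ↔ ∃ p ∈ I, (Γs p).ep s r = some U)

end Ctx

/-- Transition labels of typing contexts. -/
inductive Act (K : Signature) where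
  /-- in session `s`, `p` receives `l(S)` from `q` -/
  | inp (s : ℕ) (p q : K.Role) (l : Label K) (S : Payload K)
  /-- in session `s`, `p` sends `l(S)` to `q` -/
  | out (s : ℕ) (p q : K.Role) (l : K.Lab) (S : Payload K)
  /-- in session `s`, `l` is transmitted from `p` to `q` -/
  | comm (s : ℕ) (p q : K.Role) (l : K.Lab)
  /-- in session `s`, `p` crashes -/
  | crash (s : ℕ) (p : K.Role)
  /-- in session `s`, `p` has detected that `q` has crashed -/
  | detect (s : ℕ) (p q : K.Role)
  /-- in session `s`, `p` has stopped due to a crash -/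
  | stopped (s : ℕ) (p : K.Role)

/-- Labelled transitions of typing contexts. -/
inductive Trans : Ctx K → Act K → Ctx K → Prop where
  | out {s p q n lab pay cont} (k : Fin (n + 1)) :
      Trans (.singleEp s p (.sess (.int q n lab pay cont))) (.out s p q (lab k) (pay k))
        (.singleEp s p (.sess (cont k)))
  | inp {s p q n lab pay cont} (k : Fin (n + 1)) :
      Trans (.singleEp s p (.sess (.ext q n lab pay cont))) (.inp s p q (lab k) (pay k))
        (.singleEp s p (.sess (cont k)))
  | com {Γ₁ Γ₂ Γ₁' Γ₂' Γ Γ' s p q l S S'} :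
      Trans Γ₁ (.out s p q l S) Γ₁' → Trans Γ₂ (.inp s q p (.msg l) S') Γ₂' →
      Payload.Sub S S' → Ctx.Split Γ Γ₁ Γ₂ → Ctx.Split Γ' Γ₁' Γ₂' → Trans Γ (.comm s p q l) Γ'
  | unfold {s p T a Γ'} :
      Trans (.singleEp s p (.sess T.unfold)) a Γ' → Trans (.singleEp s p (.sess (.mu T))) a Γ'
  | frame {Γ₁ Γ₁' Γ₀ Γ Γ' a} :
      Trans Γ₁ a Γ₁' → Ctx.Split Γ Γ₁ Γ₀ → Ctx.Split Γ' Γ₁' Γ₀ → Trans Γ a Γ'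
  | crash {s p T} :
      ¬ (Payload.sess T).Sub (.sess .done) →
      Trans (.singleEp s p (.sess T)) (.crash s p) (.singleEp s p .crashed)
  | stopped {s p} : Trans (.singleEp s p .crashed) (.stopped s p) (.singleEp s p .crashed)
  | detect {Γ₁ Γ₂ Γ₁' Γ₂' Γ Γ' s p q} :
      Trans Γ₁ (.inp s q p .crash (.base K.unitTy)) Γ₁' → Trans Γ₂ (.stopped s p) Γ₂' →
      Ctx.Split Γ Γ₁ Γ₂ → Ctx.Split Γ' Γ₁' Γ₂' → Trans Γ (.detect s q p) Γ'
  | lost {Γ₁ Γ₂ Γ₁' Γ₂' Γ Γ' s p q l S} :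
      Trans Γ₁ (.out s p q l S) Γ₁' → Trans Γ₂ (.stopped s q) Γ₂' →
      Ctx.Split Γ Γ₁ Γ₂ → Ctx.Split Γ' Γ₁' Γ₂' → Trans Γ (.comm s p q l) Γ'

/-- `Γ` moves to `Γ'` in session `s`, by a transmission, by a crash detection, or by the crash of
a role that is not in the set `R` of reliable roles. -/
def Move (s : ℕ) (R : Set K.Role) (Γ Γ' : Ctx K) : Prop :=
  (∃ q r l, Trans Γ (.comm s q r l) Γ') ∨ (∃ q r, Trans Γ (.detect s q r) Γ') ∨
    (∃ p, p ∉ R ∧ Trans Γ (.crash s p) Γ')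

/-- `Γ` moves to `Γ'` in some session, where any role may crash. -/
def MoveAny (Γ Γ' : Ctx K) : Prop := ∃ s, Move s ∅ Γ Γ'

/-- `φ` is an `(s; R)`-safety property. -/
structure IsSafety (s : ℕ) (R : Set K.Role) (φ : Ctx K → Prop) : Prop where
  comm : ∀ Γ p q l S l' S', φ Γ → (∃ Γ', Trans Γ (.out s p q l S) Γ') →
    (∃ Γ', Trans Γ (.inp s q p l' S') Γ') → ∃ Γ', Trans Γ (.comm s p q l) Γ'
  crash : ∀ Γ p q l S, φ Γ → (∃ Γ', Trans Γ (.stopped s p) Γ') →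
    (∃ Γ', Trans Γ (.inp s q p l S) Γ') → ∃ Γ', Trans Γ (.detect s q p) Γ'
  move : ∀ Γ Γ', φ Γ → Move s R Γ Γ' → φ Γ'

/-- `Γ` is `(s; R)`-safe. -/
def Safe (s : ℕ) (R : Set K.Role) (Γ : Ctx K) : Prop := ∃ φ, IsSafety s R φ ∧ φ Γ

/-! ### Typing rules -/

/-- `Γ ⊢ d : S`. -/
inductive DTyped : Ctx K → Datum K → Payload K → Prop where
  | val {v b} : K.HasTy v b → DTyped .empty (.val v) (.base b)
  | var {x S S'} : Payload.Sub S S' → DTyped (.singleVar x S) (.chan (.var x)) S'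
  | ep {s p T S'} :
      Payload.Sub (.sess T) S' → DTyped (.singleEp s p (.sess T)) (.chan (.ep s p)) S'

/-- `Γ = Γ₀, Γ₁, …, Γₙ` where `Γ₀` is ended and `Γᵢ ⊢ dᵢ : Sᵢ` with `Sᵢ` not below `end`. -/
inductive ArgsTyped : Ctx K → List (Datum K) → List (Payload K) → Prop where
  | nil {Γ} : Γ.Ended → ArgsTyped Γ [] []
  | cons {Γ Γ₁ Γ₂ d S ds Ss} :
      Ctx.Split Γ Γ₁ Γ₂ → DTyped Γ₁ d S → ¬ S.Sub (.sess .done) → ArgsTyped Γ₂ ds Ss →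
      ArgsTyped Γ (d :: ds) (S :: Ss)

/-- Environments for process variables. -/
abbrev DefEnv (K : Signature) := ℕ → Option (List (Payload K))

def DefEnv.empty : DefEnv K := fun _ => none

def DefEnv.cons (Ss : List (Payload K)) (Θ : DefEnv K) : DefEnv K
  | 0 => some Ss
  | X + 1 => Θ X

/-- The typing judgement `Θ · Γ ⊢ P`. -/
inductive Typed : DefEnv K → Ctx K → Proc K → Prop where
  | nil {Θ Γ} : Γ.Ended → Typed Θ Γ .nil
  | par {Θ Γ Γ₁ Γ₂ P Q} :
      Ctx.Split Γ Γ₁ Γ₂ → Typed Θ Γ₁ P → Typed Θ Γ₂ Q → Typed Θ Γ (.par P Q)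
  | call {Θ Γ X ds Ss} : Θ X = some Ss → ArgsTyped Γ ds Ss → Typed Θ Γ (.call X ds)
  | defn {Θ Γ Ss D P} :
      Typed (Θ.cons Ss) (.ofList Ss) D → Typed (Θ.cons Ss) Γ P → Typed Θ Γ (.defn Ss D P)
  | branch {Θ Γ Γ₀ Γ₁ c q n lab pay cont} {P : Fin (n + 1) → Proc K}
      (Γc : Fin (n + 1) → Ctx K) :
      Ctx.Split Γ Γ₀ Γ₁ → DTyped Γ₁ (.chan c) (.sess (.ext q n lab pay cont)) →
      (∀ i, Ctx.Split (Γc i) Γ₀ (.singleChan (cont i) c)) →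
      (∀ i, Typed Θ (.consVar (pay i) (Γc i)) (P i)) →
      Typed Θ Γ (.branch c q n lab P)
  | sel {Θ Γ Γ' Γ₀ Γ₁ Γ₂ Γc c q l d S T P} :
      Ctx.Split Γ Γ' Γ₂ → Ctx.Split Γ' Γ₀ Γ₁ →
      DTyped Γ₁ (.chan c) (.sess (.int q 0 (fun _ => l) (fun _ => S) (fun _ => T))) →
      DTyped Γ₂ d S → ¬ S.Sub (.sess .done) →
      Ctx.Split Γc Γ₀ (.singleChan T c) → Typed Θ Γc P →
      Typed Θ Γ (.sel c q l d P)
  | crashed {Θ Γ Γ₀ s p} :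
      Ctx.Split Γ Γ₀ (.singleEp s p .crashed) → Γ₀.Ended → Typed Θ Γ (.crashed s p)
  | res {Θ Γ A P} (R : Set K.Role) :
      Safe 0 R (Ctx.consSess A .empty) → Typed Θ (.consSess A Γ) P → Typed Θ Γ (.res A P)

/-! ### Reliable and assumption-abiding reductions -/

/-- Reliable process reduction: no endpoint of session `s` with a role in `R` is crashed in the
reduct. -/
def RelRed (s : ℕ) (R : Set K.Role) (P P' : Proc K) : Prop :=
  Red P P' ∧ ∀ p ∈ R, ¬ ∃ Q, Cong P' (.par Q (.crashed s p))

/-- Assumption-abiding reduction of a process `P` that is typed by `Γ`, for reliable roles `R s`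
in each session `s` of `Γ`. For the restricted sessions, `P` is considered in all its congruent
forms `res A Q`, with the annotations `A` that type them. -/
structure AbidingRed (R : ℕ → Set K.Role) (Θ : DefEnv K) (Γ : Ctx K) (P P' : Proc K) :
    Prop where
  typed : Typed Θ Γ P
  safe : ∀ s, Γ.HasSession s → Safe s (R s) Γ
  red : Red P P'
  free : ∀ s, Γ.HasSession s → RelRed s (R s) P P'
  restricted : ∀ A Q A' Q', Cong P (.res A Q) → Typed Θ Γ (.res A Q) →
    Cong P' (.res A' Q') → Red Q Q' →
    ∃ R', Safe 0 R' (Ctx.consSess A .empty) ∧ RelRed 0 R' Q Q'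

/-- One or more assumption-abiding reductions from `P`, typed by `Γ`, to `P'`, typed by `Γ'`.
The typing context of each intermediate process is reached by moves of the previous one. -/
def AbidingPlus (R : ℕ → Set K.Role) (Θ : DefEnv K) (Γ : Ctx K) (P : Proc K) (Γ' : Ctx K)
    (P' : Proc K) : Prop :=
  Relation.TransGen
    (fun c c' : Ctx K × Proc K =>
      AbidingRed R Θ c.1 c.2 c'.2 ∧ Relation.ReflTransGen MoveAny c.1 c'.1 ∧
        Typed Θ c'.1 c'.2)
    (Γ, P) (Γ', P')

/-! ### Processes that only play one role -/

/-- Every process call in the process occurs under a selection or branching. -/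
def Proc.CallsGuarded : Proc K → Prop
  | .par P Q => P.CallsGuarded ∧ Q.CallsGuarded
  | .res _ P => P.CallsGuarded
  | .defn _ D P => D.CallsGuarded ∧ P.CallsGuarded
  | .call _ _ => False
  | _ => True

/-- Every process call that has the variable `x` as an argument occurs under a selection or
branching on `x`. -/
def Proc.VarGuarded : Proc K → ℕ → Prop
  | .par P Q, x => P.VarGuarded x ∧ Q.VarGuarded x
  | .res _ P, x => P.VarGuarded x
  | .sel c _ _ _ P, x => c = .var x ∨ P.VarGuarded x
  | .branch c _ _ _ P, x => c = .var x ∨ ∀ i, (P i).VarGuarded (x + 1)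
  | .defn Ss D P, x => D.VarGuarded (x + Ss.length) ∧ P.VarGuarded x
  | .call _ ds, x => .chan (.var x) ∉ ds
  | _, _ => True

/-- The process has guarded definitions. -/
def Proc.GuardedDefs : Proc K → Prop
  | .par P Q => P.GuardedDefs ∧ Q.GuardedDefs
  | .res _ P => P.GuardedDefs
  | .sel _ _ _ _ P => P.GuardedDefs
  | .branch _ _ _ _ P => ∀ i, (P i).GuardedDefs
  | .defn Ss D P =>
      D.CallsGuarded ∧ (∀ (i : ℕ) (T : SType K), Ss[i]? = some (.sess T) → D.VarGuarded i) ∧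
        D.GuardedDefs ∧ P.GuardedDefs
  | _ => True

/-- Every restriction in the process is annotated with an ended context. -/
def Proc.ResEnded : Proc K → Prop
  | .par P Q => P.ResEnded ∧ Q.ResEnded
  | .res A P => (Ctx.consSess A .empty).Ended ∧ P.ResEnded
  | .sel _ _ _ _ P => P.ResEnded
  | .branch _ _ _ _ P => ∀ i, (P i).ResEnded
  | .defn _ D P => D.ResEnded ∧ P.ResEnded
  | _ => True

/-- `P` only plays role `p` in session `s`, by `Γ`. -/
structure OnlyPlays (s : ℕ) (p : K.Role) (Γ : Ctx K) (P : Proc K) : Prop where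
  typed : Typed .empty Γ P
  guarded : P.GuardedDefs
  closed : P.fv = ∅
  ctx : ∃ Γ₀ U, Ctx.Split Γ Γ₀ (.singleEp s p U) ∧ ¬ UType.Sub U (.sess .done) ∧ Γ₀.Ended
  restricted : P.ResEnded

/-- `P` is congruent to a parallel composition of processes, one for each role in `I`, typed by
contexts whose union is `Γ`, each of which is inactive or only plays its role in `s`. -/
def RolePerProcess (s : ℕ) (I : Finset K.Role) (Γ : Ctx K) (P : Proc K) : Prop :=
  ∃ (Ps : K.Role → Proc K) (Γs : K.Role → Ctx K),
    Cong P (bigPar (I.toList.map Ps)) ∧ Γ.IsUnion I Γs ∧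
      ∀ p ∈ I, Typed .empty (Γs p) (Ps p) ∧ (Cong (Ps p) .nil ∨ OnlyPlays s p (Γs p) (Ps p))

end MPST

-- A component that only plays `p` is closed, and all entries of its context other than `s[p]` are
-- basic or terminated; so it can be retyped by the entry of `s[p]` alone (`Comp`, `State`).
-- Resolving an unguarded process call keeps this typing. It lowers the number of unguarded calls,
-- because the calls in declared bodies are guarded (`Typed.exists_call_step`). Hence all such calls
-- can be resolved without a move of the context (`Config.normalise`).
--
-- Without unguarded calls, a component is congruent to the inactive process or has a prefix or a
-- crashed endpoint in an evaluation context. Such a leaf needs an entry that is neither basic nor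
-- terminated, and `s[p]` is the only candidate (`Comp.cong_nil_or_focus`). By linearity its
-- payload, if any, is a basic value, and the unfolded type of `s[p]` decides whether it is a
-- selection, a branching or a crashed endpoint. So the processes can follow the context
-- (`State.progress`); prefixes in two separate evaluation contexts meet by scope extrusion
-- (`RedPair.plug`). In a transmission the sending process picks the label. Subtyping makes it one
-- of the labels of the internal choice, and safety says that the context can transmit it; for this
-- reason the move that is followed may differ from the given one.
--
-- Two invariants of structural congruence show that the reductions abide by the assumptions. A
-- crashed endpoint outside prefixes has a crashed entry in the context (`Cong.has`,
-- `Typed.ent_of_has`), and entries of reliable roles never become crashed. Endpoints of restricted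
-- sessions occur outside prefixes at most as crashed endpoints (`Cong.resCrashed`). So in every
-- typed congruent form `res A Q` the types in `A` are terminated or crashed, and such a session
-- cannot move and is safe (`safe_of_resCrashed`).
--
-- After the move the calls are resolved once more. A component whose entry has terminated is then
-- congruent to the inactive process (`Comp.cong_nil`), which restores the decomposition into roles.

namespace MPST

variable {K : Signature}

/-! ### Unfolding of session types -/

mutual

theorem SType.WF.mono : ∀ (T : SType K) {k m : ℕ}, T.WF k → k ≤ m → T.WF m
  | .ext _ _ _ pay cont, _, _, h, hkm => by
      simp only [SType.WF] at h ⊢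
      exact ⟨h.1, fun i => Payload.WF.mono (pay i) (h.2.1 i) hkm,
        fun i => SType.WF.mono (cont i) (h.2.2 i) hkm⟩
  | .int _ _ _ pay cont, _, _, h, hkm => by
      simp only [SType.WF] at h ⊢
      exact ⟨h.1, fun i => Payload.WF.mono (pay i) (h.2.1 i) hkm,
        fun i => SType.WF.mono (cont i) (h.2.2 i) hkm⟩
  | .mu T, _, _, h, hkm => by
      simp only [SType.WF] at h ⊢
      exact ⟨h.1, SType.WF.mono T h.2 (by omega)⟩
  | .tvar _, _, _, h, hkm => by
      simp only [SType.WF] at h ⊢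
      omega
  | .done, _, _, _, _ => by simp [SType.WF]

theorem Payload.WF.mono : ∀ (S : Payload K) {k m : ℕ}, S.WF k → k ≤ m → S.WF m
  | .base _, _, _, _, _ => by simp [Payload.WF]
  | .sess T, _, _, h, hkm => by
      simp only [Payload.WF] at h ⊢
      exact SType.WF.mono T h hkm

end

theorem SType.WF.lt_of_unguarded : ∀ (T : SType K) {k m : ℕ}, T.WF m → T.Unguarded k → k < m
  | .ext .., _, _, _, h => by simp [SType.Unguarded] at h
  | .int .., _, _, _, h => by simp [SType.Unguarded] at h
  | .mu T, _, _, hw, h => by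
      simp only [SType.WF, SType.Unguarded] at hw h
      have := SType.WF.lt_of_unguarded T hw.2 h
      omega
  | .tvar _, _, _, hw, h => by
      simp only [SType.WF, SType.Unguarded] at hw h
      omega
  | .done, _, _, _, h => by simp [SType.Unguarded] at h

theorem SType.Unguarded.of_subst : ∀ (T : SType K) {k j : ℕ} {U : SType K}, U.WF 0 →
    (T.subst k U).Unguarded j → T.Unguarded j
  | .ext .., _, _, _, _, h => by simp [SType.subst, SType.Unguarded] at h
  | .int .., _, _, _, _, h => by simp [SType.subst, SType.Unguarded] at h
  | .mu T, _, _, _, hU, h => by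
      simp only [SType.subst, SType.Unguarded] at h ⊢
      exact SType.Unguarded.of_subst T hU h
  | .tvar i, k, j, U, hU, h => by
      simp only [SType.subst] at h
      split_ifs at h
      · have := SType.WF.lt_of_unguarded U hU h
        omega
      · exact h
  | .done, _, _, _, _, h => by simp [SType.subst, SType.Unguarded] at h

mutual

theorem SType.WF.subst : ∀ (T : SType K) {k : ℕ} {U : SType K}, U.WF 0 → T.WF (k + 1) →
    (T.subst k U).WF k
  | .ext _ _ _ pay cont, _, _, hU, h => by
      simp only [SType.WF, SType.subst] at h ⊢
      exact ⟨h.1, fun i => Payload.WF.subst (pay i) hU (h.2.1 i),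
        fun i => SType.WF.subst (cont i) hU (h.2.2 i)⟩
  | .int _ _ _ pay cont, _, _, hU, h => by
      simp only [SType.WF, SType.subst] at h ⊢
      exact ⟨h.1, fun i => Payload.WF.subst (pay i) hU (h.2.1 i),
        fun i => SType.WF.subst (cont i) hU (h.2.2 i)⟩
  | .mu T, _, _, hU, h => by
      simp only [SType.WF, SType.subst] at h ⊢
      exact ⟨fun h' => h.1 (SType.Unguarded.of_subst T hU h'), SType.WF.subst T hU h.2⟩
  | .tvar i, k, U, hU, h => by
      simp only [SType.WF, SType.subst] at h ⊢
      split_ifs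
      · exact SType.WF.mono U hU (by omega)
      · simp only [SType.WF]; omega
  | .done, _, _, _, _ => by simp [SType.WF, SType.subst]

theorem Payload.WF.subst : ∀ (S : Payload K) {k : ℕ} {U : SType K}, U.WF 0 → S.WF (k + 1) →
    (S.subst k U).WF k
  | .base _, _, _, _, _ => by simp [Payload.WF, Payload.subst]
  | .sess T, _, _, hU, h => by
      simp only [Payload.WF, Payload.subst] at h ⊢
      exact SType.WF.subst T hU h

end

theorem SType.WF.unfold {T : SType K} (h : (SType.mu T).WF 0) : T.unfold.WF 0 := by
  have h' := h
  simp only [SType.WF] at h'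
  exact SType.WF.subst T h h'.2

/-- The number of leading `mu` binders. -/
def SType.mus : SType K → ℕ
  | .mu T => T.mus + 1
  | _ => 0

theorem SType.mus_subst : ∀ (T : SType K) {k : ℕ} {U : SType K}, ¬ T.Unguarded k →
    (T.subst k U).mus = T.mus
  | .ext .., _, _, _ => by simp [SType.subst, SType.mus]
  | .int .., _, _, _ => by simp [SType.subst, SType.mus]
  | .mu T, _, _, h => by
      simp only [SType.subst, SType.mus, SType.Unguarded] at h ⊢
      rw [SType.mus_subst T h]
  | .tvar i, k, U, h => by
      simp only [SType.subst, SType.mus, SType.Unguarded] at h ⊢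
      rw [if_neg h]; simp [SType.mus]
  | .done, _, _, _ => by simp [SType.subst, SType.mus]

/-- By guardedness, unfolding `mu T` removes exactly one leading recursion; `mus` is therefore the
measure of the inductions over unfoldings. -/
theorem SType.mus_unfold {T : SType K} (h : (SType.mu T).WF 0) : T.unfold.mus = T.mus := by
  simp only [SType.WF] at h
  exact SType.mus_subst T h.1

/-- `T.Head H`: the type `H`, which does not start with a recursion, is an unfolding of `T`. -/
inductive SType.Head : SType K → SType K → Prop
  | ext {q n lab pay cont} : Head (.ext q n lab pay cont) (.ext q n lab pay cont)
  | int {q n lab pay cont} : Head (.int q n lab pay cont) (.int q n lab pay cont)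
  | done : Head .done .done
  | mu {T H} : Head T.unfold H → Head (.mu T) H

theorem SType.exists_head {T : SType K} (h : T.WF 0) : ∃ H, T.Head H := by
  induction hn : T.mus generalizing T with
  | zero =>
    cases T with
    | ext => exact ⟨_, .ext⟩
    | int => exact ⟨_, .int⟩
    | mu T => simp [SType.mus] at hn
    | tvar i => simp [SType.WF] at h
    | done => exact ⟨_, .done⟩
  | succ n ih =>
    cases T with
    | mu T =>
      obtain ⟨H, hH⟩ := ih h.unfold (by rw [SType.mus_unfold h]; simpa [SType.mus] using hn)
      exact ⟨H, .mu hH⟩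
    | _ => simp [SType.mus] at hn

theorem SType.Head.unique {T H H' : SType K} (h : T.Head H) (h' : T.Head H') : H = H' := by
  induction h with
  | ext => cases h'; rfl
  | int => cases h'; rfl
  | done => cases h'; rfl
  | mu _ ih => cases h' with | mu h' => exact ih h'

theorem SType.Head.not_mu {T T' : SType K} : ¬ T.Head (.mu T') := by
  intro h
  generalize hH : SType.mu T' = H at h
  induction h with
  | mu _ ih => exact ih hH
  | _ => cases hH

theorem SType.Head.wf {T H : SType K} (h : T.Head H) (hT : T.WF 0) : H.WF 0 := by
  induction h with
  | ext => exact hT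
  | int => exact hT
  | done => exact hT
  | mu _ ih => exact ih hT.unfold

/-! ### Subtyping -/

namespace Payload

theorem _root_.MPST.SubStep.mono {R R' : Payload K → Payload K → Prop}
    (hR : ∀ a b, R a b → R' a b) {a b : Payload K} (h : SubStep R a b) : SubStep R' a b := by
  cases h with
  | base h => exact .base h
  | done => exact .done
  | int h =>
    exact .int fun j => let ⟨i, h1, h2, h3⟩ := h j; ⟨i, h1, hR _ _ h2, hR _ _ h3⟩
  | ext h hp =>
    exact .ext (fun j => let ⟨i, h1, h2, h3⟩ := h j; ⟨i, h1, hR _ _ h2, hR _ _ h3⟩) hp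
  | muL h => exact .muL (hR _ _ h)
  | muR h => exact .muR (hR _ _ h)

/-- Coinduction up to subtyping: the union of `S` and `Sub` is closed backwards under the rules.
Since `Sub` includes well-formedness, this has to be passed on to the premises of each rule. -/
theorem Sub.coind {S : Payload K → Payload K → Prop}
    (hwf : ∀ a b, S a b → a.WF 0 ∧ b.WF 0)
    (h : ∀ a b, S a b → SubStep (fun a b => S a b ∨ a.Sub b) a b) {a b : Payload K}
    (hab : S a b) : a.Sub b := by
  refine ⟨(hwf a b hab).1, (hwf a b hab).2, fun a b => S a b ∨ a.Sub b, ?_, .inl hab⟩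
  rintro a b (h' | ⟨h1, h2, R, hR, hab⟩)
  · exact h a b h'
  · have wfs : ∀ x y : Payload K, SubStep R x y → x.WF 0 → y.WF 0 →
        SubStep (fun a b => S a b ∨ a.Sub b) x y := by
      intro x y hxy hx hy
      cases hxy with
      | base h => exact .base h
      | done => exact .done
      | int h =>
        simp only [Payload.WF, SType.WF] at hx hy
        refine .int fun j => ?_
        obtain ⟨i, h1, h2, h3⟩ := h j
        exact ⟨i, h1, .inr ⟨hy.2.1 j, hx.2.1 i, R, hR, h2⟩,
          .inr ⟨by simpa [Payload.WF] using hx.2.2 i, by simpa [Payload.WF] using hy.2.2 j,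
            R, hR, h3⟩⟩
      | ext h hp =>
        simp only [Payload.WF, SType.WF] at hx hy
        refine .ext (fun i => ?_) hp
        obtain ⟨j, h1, h2, h3⟩ := h i
        exact ⟨j, h1, .inr ⟨hx.2.1 i, hy.2.1 j, R, hR, h2⟩,
          .inr ⟨by simpa [Payload.WF] using hx.2.2 i, by simpa [Payload.WF] using hy.2.2 j,
            R, hR, h3⟩⟩
      | muL h =>
        simp only [Payload.WF] at hx hy
        exact .muL (.inr ⟨by simpa [Payload.WF] using hx.unfold, hy, R, hR, h⟩)
      | muR h =>
        simp only [Payload.WF] at hx hy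
        exact .muR (.inr ⟨hx, by simpa [Payload.WF] using hy.unfold, R, hR, h⟩)
    exact wfs a b (hR a b hab) h1 h2

theorem Sub.step {a b : Payload K} (h : a.Sub b) : SubStep Payload.Sub a b := by
  obtain ⟨h1, h2, R, hR, hab⟩ := h
  have := hR a b hab
  cases this with
  | base h => exact .base h
  | done => exact .done
  | int h =>
    simp only [Payload.WF, SType.WF] at h1 h2
    refine .int fun j => ?_
    obtain ⟨i, e, h3, h4⟩ := h j
    exact ⟨i, e, ⟨h2.2.1 j, h1.2.1 i, R, hR, h3⟩,
      ⟨by simpa [Payload.WF] using h1.2.2 i, by simpa [Payload.WF] using h2.2.2 j, R, hR, h4⟩⟩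
  | ext h hp =>
    simp only [Payload.WF, SType.WF] at h1 h2
    refine .ext (fun i => ?_) hp
    obtain ⟨j, e, h3, h4⟩ := h i
    exact ⟨j, e, ⟨h1.2.1 i, h2.2.1 j, R, hR, h3⟩,
      ⟨by simpa [Payload.WF] using h1.2.2 i, by simpa [Payload.WF] using h2.2.2 j, R, hR, h4⟩⟩
  | muL h =>
    simp only [Payload.WF] at h1 h2
    exact .muL ⟨by simpa [Payload.WF] using h1.unfold, h2, R, hR, h⟩
  | muR h =>
    simp only [Payload.WF] at h1 h2
    exact .muR ⟨h1, by simpa [Payload.WF] using h2.unfold, R, hR, h⟩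

theorem Sub.of_step {a b : Payload K} (ha : a.WF 0) (hb : b.WF 0) (h : SubStep Payload.Sub a b) :
    a.Sub b :=
  Sub.coind (S := fun x y => x = a ∧ y = b) (by rintro _ _ ⟨rfl, rfl⟩; exact ⟨ha, hb⟩)
    (by rintro _ _ ⟨rfl, rfl⟩; exact h.mono fun _ _ => .inr) ⟨rfl, rfl⟩

/-- The rules `muL` and `muR` overlap, so a derivation may start by unfolding the other side.
Induction on the leading recursions of that side permutes the left unfolding to the front. -/
theorem Sub.unfold_left {T T' : SType K} (h : (sess (.mu T)).Sub (sess T')) :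
    (sess T.unfold).Sub (sess T') := by
  have hT : (SType.mu T).WF 0 := by simpa [Payload.WF] using h.1
  induction hn : T'.mus generalizing T' with
  | zero =>
    cases h.step with
    | muL h => exact h
    | muR h => simp [SType.mus] at hn
  | succ n ih =>
    have hstep := h.step
    cases hstep with
    | muL h => exact h
    | muR h' =>
      rename_i T''
      have hw : (SType.mu T'').WF 0 := by simpa [Payload.WF] using h.2.1
      refine .of_step (by simpa [Payload.WF] using hT.unfold) h.2.1 (.muR (ih h' ?_))
      rw [SType.mus_unfold hw]; simpa [SType.mus] using hn

theorem Sub.unfold_right {T T' : SType K} (h : (sess T).Sub (sess (.mu T'))) :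
    (sess T).Sub (sess T'.unfold) := by
  have hT : (SType.mu T').WF 0 := by simpa [Payload.WF] using h.2.1
  induction hn : T.mus generalizing T with
  | zero =>
    cases h.step with
    | muL h => simp [SType.mus] at hn
    | muR h => exact h
  | succ n ih =>
    have hstep := h.step
    cases hstep with
    | muR h => exact h
    | muL h' =>
      rename_i T''
      have hw : (SType.mu T'').WF 0 := by simpa [Payload.WF] using h.1
      refine .of_step h.1 (by simpa [Payload.WF] using hT.unfold) (.muL (ih h' ?_))
      rw [SType.mus_unfold hw]; simpa [SType.mus] using hn

theorem Sub.head_left {T H T' : SType K} (hH : T.Head H) (h : (sess T).Sub (sess T')) :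
    (sess H).Sub (sess T') := by
  induction hH with
  | mu _ ih => exact ih h.unfold_left
  | _ => exact h

theorem Sub.head_right {T H T' : SType K} (hH : T'.Head H) (h : (sess T).Sub (sess T')) :
    (sess T).Sub (sess H) := by
  induction hH with
  | mu _ ih => exact ih h.unfold_right
  | _ => exact h

/-- The candidate relation for the coinduction is the composition of subtyping with itself. -/
theorem Sub.trans {a b c : Payload K} (hab : a.Sub b) (hbc : b.Sub c) : a.Sub c := by
  refine Sub.coind (S := fun a c => ∃ b : Payload K, a.Sub b ∧ b.Sub c) ?_ ?_ ⟨b, hab, hbc⟩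
  · rintro a c ⟨b, h1, h2⟩; exact ⟨h1.1, h2.2.1⟩
  · rintro a c ⟨b, h1, h2⟩
    cases a with
    | base a =>
      cases h1.step with | base e1 => cases h2.step with | base e2 =>
      exact .base (K.bsub_trans _ _ _ e1 e2)
    | sess a =>
      cases b with
      | base b => cases h1.step
      | sess b =>
        cases c with
        | base c => cases h2.step
        | sess c =>
          -- With the middle type unfolded to its head, neither derivation can start by unfolding
          -- it, so the two match at its outermost choice.
          obtain ⟨H, hH⟩ := SType.exists_head (by simpa [Payload.WF] using h1.2.1 : b.WF 0)
          replace h1 := h1.head_right hH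
          replace h2 := h2.head_left hH
          have s1 := h1.step
          have s2 := h2.step
          cases s1 with
          | muL s1 => exact .muL (.inl ⟨_, s1, h2⟩)
          | muR s1 => exact absurd hH SType.Head.not_mu
          | done =>
            cases s2 with
            | done => exact .done
            | muR s2 => exact .muR (.inl ⟨_, h1, s2⟩)
          | int s1 =>
            cases s2 with
            | muR s2 => exact .muR (.inl ⟨_, h1, s2⟩)
            | int s2 =>
              refine .int fun j => ?_
              obtain ⟨i, e, p, q⟩ := s2 j
              obtain ⟨i', e', p', q'⟩ := s1 i
              exact ⟨i', e'.trans e, .inl ⟨_, p, p'⟩, .inl ⟨_, q', q⟩⟩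
          | ext s1 hp1 =>
            cases s2 with
            | muR s2 => exact .muR (.inl ⟨_, h1, s2⟩)
            | ext s2 hp2 =>
              refine .ext (fun j => ?_) ?_
              · obtain ⟨i, e, p, q⟩ := s1 j
                obtain ⟨i', e', p', q'⟩ := s2 i
                exact ⟨i', e.trans e', .inl ⟨_, p, p'⟩, .inl ⟨_, q, q'⟩⟩
              -- A pure crash choice on the left forces a single branch in the middle, whose label
              -- is again `crash`; so the condition applies a second time.
              · intro hn hc
                have hm := hp1 hn hc
                subst hm
                obtain ⟨i, e, -⟩ := s1 0
                have : i = 0 := Subsingleton.elim (α := Fin 1) _ _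
                subst this
                exact hp2 rfl (e.symm.trans hc)

theorem Sub.not_sess_base {T : SType K} {b : K.BTy} : ¬ (sess T).Sub (base b) :=
  fun h => by cases h.step

theorem Sub.of_head_left {T H : SType K} {b : Payload K} (hH : T.Head H) (hT : T.WF 0)
    (h : (sess H).Sub b) : (sess T).Sub b := by
  induction hH with
  | mu _ ih =>
    have := ih hT.unfold h
    cases b with
    | base b => exact absurd this Sub.not_sess_base
    | sess T' => exact .of_step (by simpa [Payload.WF] using hT) h.2.1 (.muL this)
  | _ => exact h

theorem sub_done : (sess .done : Payload K).Sub (sess .done) :=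
  .of_step (by simp [Payload.WF, SType.WF]) (by simp [Payload.WF, SType.WF]) .done

theorem Sub.head_done {T : SType K} (h : (sess T).Sub (sess .done)) : T.Head .done := by
  obtain ⟨H, hH⟩ := SType.exists_head (by simpa [Payload.WF] using h.1 : T.WF 0)
  have := (h.head_left hH).step
  cases this with
  | done => exact hH
  | muL => exact absurd hH SType.Head.not_mu

/-- Supertypes of terminated types are terminated. -/
theorem Sub.done_of_done {a b : Payload K} (h : a.Sub b) (ha : a.Sub (sess .done)) :
    b.Sub (sess .done) := by
  cases a with
  | base a => cases ha.step
  | sess T =>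
    cases b with
    | base b => cases h.step
    | sess T' =>
      have hw : T'.WF 0 := by simpa [Payload.WF] using h.2.1
      obtain ⟨H, hH⟩ := SType.exists_head hw
      have := ((h.head_left ha.head_done).head_right hH).step
      cases this with
      | done => exact Sub.of_head_left hH hw sub_done
      | muR => exact absurd hH SType.Head.not_mu

theorem Sub.base_inv {b : K.BTy} {S : Payload K} (h : (base b).Sub S) :
    ∃ b', S = base b' ∧ K.BSub b b' := by
  cases h.step with | base h' => exact ⟨_, rfl, h'⟩

theorem Sub.base_inv_right {b : K.BTy} {S : Payload K} (h : S.Sub (base b)) :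
    ∃ b', S = base b' ∧ K.BSub b' b := by
  cases h.step with | base h' => exact ⟨_, rfl, h'⟩

theorem Sub.int_inv {T : SType K} {q m lab' pay' cont'}
    (h : (sess T).Sub (sess (.int q m lab' pay' cont'))) :
    ∃ n lab pay cont, T.Head (.int q n lab pay cont) ∧ ∀ j : Fin (m + 1), ∃ i : Fin (n + 1),
      lab i = lab' j ∧ (pay' j).Sub (pay i) ∧ (sess (cont i)).Sub (sess (cont' j)) := by
  obtain ⟨H, hH⟩ := SType.exists_head (by simpa [Payload.WF] using h.1 : T.WF 0)
  have := (h.head_left hH).step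
  cases this with
  | int h => exact ⟨_, _, _, _, hH, h⟩
  | muL => exact absurd hH SType.Head.not_mu

theorem Sub.ext_inv {T : SType K} {q m lab' pay' cont'}
    (h : (sess T).Sub (sess (.ext q m lab' pay' cont'))) :
    ∃ n lab pay cont, T.Head (.ext q n lab pay cont) ∧ ∀ i : Fin (n + 1), ∃ j : Fin (m + 1),
      lab i = lab' j ∧ (pay i).Sub (pay' j) ∧ (sess (cont i)).Sub (sess (cont' j)) := by
  obtain ⟨H, hH⟩ := SType.exists_head (by simpa [Payload.WF] using h.1 : T.WF 0)
  have := (h.head_left hH).step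
  cases this with
  | ext h => exact ⟨_, _, _, _, hH, h⟩
  | muL => exact absurd hH SType.Head.not_mu

theorem int_not_done {q n lab pay cont} :
    ¬ (sess (.int q n lab pay cont) : Payload K).Sub (sess .done) := fun h => by cases h.step

theorem ext_not_done {q n lab pay cont} :
    ¬ (sess (.ext q n lab pay cont) : Payload K).Sub (sess .done) := fun h => by cases h.step

/-- Basic types and terminated types: the types of entries that need not be used. -/
def Ended (S : Payload K) : Prop := (∃ b, S = base b) ∨ S.Sub (sess .done)

/-- The reflexive closure of subtyping (subtyping itself is only reflexive on closed guarded
types). -/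
def Le (S S' : Payload K) : Prop := S = S' ∨ S.Sub S'

theorem Le.trans_sub {a b c : Payload K} (h : a.Le b) (h' : b.Sub c) : a.Sub c := by
  rcases h with rfl | h
  exacts [h', h.trans h']

theorem Le.ended {a b : Payload K} (h : a.Le b) (ha : a.Ended) : b.Ended := by
  rcases h with rfl | h
  · exact ha
  · rcases ha with ⟨b, rfl⟩ | ha
    · obtain ⟨b', rfl, -⟩ := h.base_inv
      exact .inl ⟨_, rfl⟩
    · exact .inr (h.done_of_done ha)

theorem Le.ended_left {a b : Payload K} (h : a.Le b) (hb : b.Ended) : a.Ended := by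
  rcases h with rfl | h
  · exact hb
  · rcases hb with ⟨b, rfl⟩ | hb
    · obtain ⟨b', rfl, -⟩ := h.base_inv_right
      exact .inl ⟨_, rfl⟩
    · exact .inr (h.trans hb)

theorem ended_sess {T : SType K} : (sess T).Ended ↔ (sess T).Sub (sess .done) := by
  simp [Ended]

end Payload

namespace UType

/-- Terminated types of endpoints. -/
def Ended (U : UType K) : Prop := U.Sub (sess .done)

theorem not_ended_crashed : ¬ (crashed : UType K).Ended := by simp [Ended, UType.Sub]

theorem ended_sess {T : SType K} :
    (sess T).Ended ↔ (Payload.sess T).Sub (.sess .done) := by simp [Ended, UType.Sub]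

end UType

/-! ### Entries of typing contexts -/

/-- The entry of a context at a channel: a payload type, or `none` for a crashed endpoint. -/
abbrev Ent (K : Signature) := Option (Payload K)

namespace Ent

/-- Unlike `Ended`, this excludes basic types. A variable of basic type may be used or ignored, so a
substitution must still give it a value, whereas well-typed processes never mention a terminated
channel. -/
def Dead : Ent K → Prop
  | some S => S.Sub (.sess .done)
  | none => False

def Ended : Ent K → Prop
  | some S => S.Ended
  | none => False

def Le : Ent K → Ent K → Prop
  | some S, some S' => S.Le S'
  | none, none => True
  | _, _ => False

theorem Le.refl (e : Ent K) : e.Le e := by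
  cases e
  · trivial
  · exact .inl rfl

theorem Le.ended_left {e e' : Ent K} (h : e.Le e') (he : e'.Ended) : e.Ended := by
  cases e <;> cases e' <;> simp only [Le, Ended] at *
  exact h.ended_left he

theorem Dead.ended {e : Ent K} (h : e.Dead) : e.Ended := by
  cases e
  · exact h
  · exact .inr h

end Ent

def UType.toEnt : UType K → Ent K
  | .sess T => some (.sess T)
  | .crashed => none

theorem UType.toEnt_inj {U U' : UType K} (h : U.toEnt = U'.toEnt) : U = U' := by
  cases U <;> cases U' <;> simp_all [UType.toEnt]

theorem UType.ended_toEnt {U : UType K} : U.toEnt.Ended ↔ U.Ended := by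
  cases U
  · simp [UType.toEnt, Ent.Ended, UType.ended_sess, Payload.ended_sess]
  · simp [UType.toEnt, Ent.Ended, UType.not_ended_crashed]

theorem UType.dead_toEnt {U : UType K} : U.toEnt.Dead ↔ U.Ended := by
  cases U
  · simp [UType.toEnt, Ent.Dead, UType.ended_sess]
  · simp [UType.toEnt, Ent.Dead, UType.not_ended_crashed]

namespace Ctx

/-- A single lookup function for variables and endpoints, so that statements about contexts can be
checked pointwise on channels. -/
def ent (Γ : Ctx K) : Chan K → Option (Ent K)
  | .var x => (Γ.var x).map some
  | .ep s p => (Γ.ep s p).map UType.toEnt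

theorem ent_injective {Γ Δ : Ctx K} (h : ∀ c, Γ.ent c = Δ.ent c) : Γ = Δ := by
  ext1
  · funext x
    exact Option.map_injective (Option.some_injective _) (h (.var x))
  · funext s p
    exact Option.map_injective (fun _ _ => UType.toEnt_inj) (h (.ep s p))

theorem ent_ep {Γ : Ctx K} {s p U} : Γ.ent (.ep s p) = some (UType.toEnt U) ↔
    Γ.ep s p = some U := by
  simp only [ent, Option.map_eq_some_iff]
  constructor
  · rintro ⟨U', h, e⟩; rw [h, UType.toEnt_inj e]
  · intro h; exact ⟨U, h, rfl⟩

theorem ent_ep' {Γ : Ctx K} {s p e} : Γ.ent (.ep s p) = some e ↔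
    ∃ U, Γ.ep s p = some U ∧ U.toEnt = e := by
  simp only [ent, Option.map_eq_some_iff]

theorem ent_var {Γ : Ctx K} {x e} : Γ.ent (.var x) = some e ↔
    ∃ S, Γ.var x = some S ∧ some S = e := by
  simp only [ent, Option.map_eq_some_iff]

@[simp] theorem ent_empty (c : Chan K) : (empty : Ctx K).ent c = none := by cases c <;> rfl

theorem ended_iff {Γ : Ctx K} : Γ.Ended ↔ ∀ c e, Γ.ent c = some e → e.Ended := by
  constructor
  · rintro ⟨h1, h2⟩ c e h
    cases c with
    | var x =>
      obtain ⟨S, h', rfl⟩ := ent_var.1 h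
      exact h1 x S h'
    | ep s p =>
      obtain ⟨U, h', rfl⟩ := ent_ep'.1 h
      exact UType.ended_toEnt.2 (h2 s p U h')
  · intro h
    refine ⟨fun x S hx => ?_, fun s p U hU => ?_⟩
    · exact h (.var x) (some S) (ent_var.2 ⟨S, hx, rfl⟩)
    · exact UType.ended_toEnt.1 (h (.ep s p) _ (ent_ep.2 hU))

/-- Pointwise form of composition, which turns arguments about splits into case distinctions at one
channel. -/
theorem split_iff {Γ Γ₁ Γ₂ : Ctx K} : Split Γ Γ₁ Γ₂ ↔
    ∀ c, (Γ₁.ent c = none ∧ Γ.ent c = Γ₂.ent c) ∨ (Γ₂.ent c = none ∧ Γ.ent c = Γ₁.ent c) := by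
  constructor
  · rintro ⟨⟨h1, h2⟩, rfl⟩ c
    cases c with
    | var x => rcases h1 x with h | h <;> simp [ent, union, h]
    | ep s p => rcases h2 s p with h | h <;> simp [ent, union, h]
  · intro h
    refine ⟨⟨fun x => ?_, fun s p => ?_⟩, ent_injective fun c => ?_⟩
    · have := h (.var x)
      simp only [ent, Option.map_eq_none_iff] at this
      tauto
    · have := h (.ep s p)
      simp only [ent, Option.map_eq_none_iff] at this
      tauto
    · have hc := h c
      cases c with
      | var x =>
        simp only [ent, union, Option.map_eq_none_iff] at hc ⊢
        rcases hc with ⟨h1, h2⟩ | ⟨h1, h2⟩ <;> rw [h2] <;> simp [h1]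
      | ep s p =>
        simp only [ent, union, Option.map_eq_none_iff] at hc ⊢
        rcases hc with ⟨h1, h2⟩ | ⟨h1, h2⟩ <;> rw [h2] <;> simp [h1]

theorem Split.left {Γ Γ₁ Γ₂ : Ctx K} (h : Split Γ Γ₁ Γ₂) {c e} (hc : Γ₁.ent c = some e) :
    Γ.ent c = some e ∧ Γ₂.ent c = none := by
  rcases split_iff.1 h c with ⟨h1, h2⟩ | ⟨h1, h2⟩ <;> simp_all

theorem Split.right {Γ Γ₁ Γ₂ : Ctx K} (h : Split Γ Γ₁ Γ₂) {c e} (hc : Γ₂.ent c = some e) :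
    Γ.ent c = some e ∧ Γ₁.ent c = none := by
  rcases split_iff.1 h c with ⟨h1, h2⟩ | ⟨h1, h2⟩ <;> simp_all

theorem Split.cases {Γ Γ₁ Γ₂ : Ctx K} (h : Split Γ Γ₁ Γ₂) {c e} (hc : Γ.ent c = some e) :
    Γ₁.ent c = some e ∨ Γ₂.ent c = some e := by
  rcases split_iff.1 h c with ⟨h1, h2⟩ | ⟨h1, h2⟩ <;> simp_all

theorem Split.symm {Γ Γ₁ Γ₂ : Ctx K} (h : Split Γ Γ₁ Γ₂) : Split Γ Γ₂ Γ₁ :=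
  split_iff.2 fun c => (split_iff.1 h c).symm

theorem Split.empty_right (Γ : Ctx K) : Split Γ Γ empty :=
  split_iff.2 fun c => by simp

theorem Split.assoc {Γ Γ₁ Γ₂ Γ₃ Γ₄ : Ctx K} (h : Split Γ Γ₁ Γ₂) (h' : Split Γ₁ Γ₃ Γ₄) :
    ∃ Γ₅, Split Γ Γ₃ Γ₅ ∧ Split Γ₅ Γ₄ Γ₂ := by
  have hd : Disj Γ₄ Γ₂ := by
    constructor
    · intro x
      have h1 := split_iff.1 h (.var x)
      have h2 := split_iff.1 h' (.var x)
      simp only [ent, Option.map_eq_none_iff] at h1 h2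
      rcases h1 with ⟨a, -⟩ | ⟨a, -⟩
      · rcases h2 with ⟨b, c⟩ | ⟨b, c⟩
        · left; simpa [a] using c.symm
        · exact .inl b
      · exact .inr a
    · intro s p
      have h1 := split_iff.1 h (.ep s p)
      have h2 := split_iff.1 h' (.ep s p)
      simp only [ent, Option.map_eq_none_iff] at h1 h2
      rcases h1 with ⟨a, -⟩ | ⟨a, -⟩
      · rcases h2 with ⟨b, c⟩ | ⟨b, c⟩
        · left; simpa [a] using c.symm
        · exact .inl b
      · exact .inr a
  have hs : Split (union Γ₄ Γ₂) Γ₄ Γ₂ := ⟨hd, rfl⟩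
  refine ⟨union Γ₄ Γ₂, split_iff.2 fun c => ?_, hs⟩
  have h1 := split_iff.1 h c
  have h2 := split_iff.1 h' c
  have h3 := split_iff.1 hs c
  rcases h1 with ⟨a1, b1⟩ | ⟨a1, b1⟩ <;> rcases h2 with ⟨a2, b2⟩ | ⟨a2, b2⟩ <;>
    rcases h3 with ⟨a3, b3⟩ | ⟨a3, b3⟩ <;> simp_all

/-- The entries of `Γ` at the channels in `C`. -/
noncomputable def filter (C : Set (Chan K)) (Γ : Ctx K) : Ctx K :=
  open Classical in
  ⟨fun x => if .var x ∈ C then Γ.var x else none,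
    fun s p => if .ep s p ∈ C then Γ.ep s p else none⟩

open Classical in
theorem ent_filter (C : Set (Chan K)) (Γ : Ctx K) (c : Chan K) :
    (Γ.filter C).ent c = if c ∈ C then Γ.ent c else none := by
  cases c <;> simp only [ent, filter] <;> split_ifs <;> simp

theorem split_filter (C : Set (Chan K)) (Γ : Ctx K) : Split Γ (Γ.filter C) (Γ.filter Cᶜ) := by
  refine split_iff.2 fun c => ?_
  by_cases h : c ∈ C <;> simp [ent_filter, h]

/-- `Γ` consists of one entry. -/
def IsOne (Γ : Ctx K) (c : Chan K) (e : Ent K) : Prop :=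
  Γ.ent c = some e ∧ ∀ c', c' ≠ c → Γ.ent c' = none

theorem isOne_singleVar (x : ℕ) (S : Payload K) : IsOne (singleVar x S) (.var x) (some S) := by
  refine ⟨by simp [ent, singleVar], fun c h => ?_⟩
  cases c with
  | var y =>
    have : y ≠ x := fun e => h (by rw [e])
    simp [ent, singleVar, this]
  | ep => rfl

theorem isOne_singleEp (s : ℕ) (p : K.Role) (U : UType K) :
    IsOne (singleEp s p U) (.ep s p) U.toEnt := by
  refine ⟨by simp [ent, singleEp], fun c h => ?_⟩
  cases c with
  | var y => rfl
  | ep s' p' =>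
    have : ¬ (s' = s ∧ p' = p) := fun e => h (by rw [e.1, e.2])
    simp [ent, singleEp, this]

theorem isOne_singleChan (T : SType K) (c : Chan K) :
    IsOne (singleChan T c) c (some (.sess T)) := by
  cases c
  · exact isOne_singleVar _ _
  · exact isOne_singleEp _ _ _

theorem IsOne.unique {Γ Δ : Ctx K} {c e} (h : IsOne Γ c e) (h' : IsOne Δ c e) : Γ = Δ :=
  ent_injective fun c' => by
    by_cases hc : c' = c
    · rw [hc, h.1, h'.1]
    · rw [h.2 _ hc, h'.2 _ hc]

theorem IsOne.split {Γ Γ₀ Γ₁ : Ctx K} {c e} (h : IsOne Γ₁ c e) (hs : Split Γ Γ₀ Γ₁) :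
    Γ.ent c = some e ∧ Γ₀.ent c = none ∧ ∀ c', c' ≠ c → Γ.ent c' = Γ₀.ent c' := by
  refine ⟨(hs.right h.1).1, (hs.right h.1).2, fun c' hc => ?_⟩
  rcases split_iff.1 hs c' with ⟨h1, h2⟩ | ⟨h1, h2⟩
  · rw [h2, h1, h.2 _ hc]
  · exact h2

theorem IsOne.split_of {Γ Γ₀ Γ₁ : Ctx K} {c e} (h : IsOne Γ₁ c e) (h1 : Γ.ent c = some e)
    (h0 : Γ₀.ent c = none) (h2 : ∀ c', c' ≠ c → Γ.ent c' = Γ₀.ent c') : Split Γ Γ₀ Γ₁ := by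
  refine split_iff.2 fun c' => ?_
  by_cases hc : c' = c
  · subst hc; exact .inl ⟨h0, h1.trans h.1.symm⟩
  · exact .inr ⟨h.2 _ hc, h2 _ hc⟩

end Ctx

theorem DTyped.isOne {Γ : Ctx K} {c S} (h : DTyped Γ (.chan c) S) :
    ∃ S', Γ.IsOne c (some S') ∧ S'.Sub S := by
  cases h with
  | var h => exact ⟨_, Ctx.isOne_singleVar _ _, h⟩
  | ep h => exact ⟨_, Ctx.isOne_singleEp _ _ (.sess _), h⟩

theorem DTyped.of_isOne {Γ : Ctx K} {c S S'} (h : Γ.IsOne c (some S')) (hS : S'.Sub S) :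
    DTyped Γ (.chan c) S := by
  cases c with
  | var x =>
    rw [h.unique (Ctx.isOne_singleVar x S')]
    exact .var hS
  | ep s p =>
    obtain ⟨U, -, hU⟩ := Ctx.ent_ep'.1 h.1
    cases U with
    | crashed => simp [UType.toEnt] at hU
    | sess T =>
      rw [← hU] at h
      rw [h.unique (Ctx.isOne_singleEp s p (.sess T))]
      simp only [UType.toEnt, Option.some.injEq] at hU
      exact .ep (hU ▸ hS)

/-! ### Free names of typed processes -/

theorem DTyped.fv {Γ : Ctx K} {d S x} (h : DTyped Γ d S) (hx : x ∈ d.fv) :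
    Γ.ent (.var x) ≠ none := by
  cases d with
  | val => simp [Datum.fv] at hx
  | chan c =>
    obtain ⟨S', h1, -⟩ := h.isOne
    cases c with
    | ep => simp [Datum.fv, Chan.fv] at hx
    | var y =>
      simp only [Datum.fv, Chan.fv, Set.mem_singleton_iff] at hx
      subst hx
      simp [h1.1]

theorem DTyped.fc {Γ : Ctx K} {d S s p} (h : DTyped Γ d S) (hS : ¬ S.Sub (.sess .done))
    (hx : (s, p) ∈ d.fc) : ∃ e, Γ.ent (.ep s p) = some e ∧ ¬ e.Ended := by
  cases d with
  | val => simp [Datum.fc] at hx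
  | chan c =>
    obtain ⟨S', h1, h2⟩ := h.isOne
    cases c with
    | var => simp [Datum.fc, Chan.fc] at hx
    | ep s' p' =>
      simp only [Datum.fc, Chan.fc, Set.mem_singleton_iff, Prod.mk.injEq] at hx
      obtain ⟨rfl, rfl⟩ := hx
      refine ⟨_, h1.1, ?_⟩
      rintro (⟨b, rfl⟩ | hd)
      · have := Ctx.ent_ep'.1 h1.1
        obtain ⟨U, -, hU⟩ := this
        cases U <;> simp [UType.toEnt] at hU
      · exact hS (h2.done_of_done hd)

theorem ArgsTyped.fv {Γ : Ctx K} {ds Ss x} (h : ArgsTyped Γ ds Ss) {d} (hd : d ∈ ds)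
    (hx : x ∈ d.fv) : Γ.ent (.var x) ≠ none := by
  induction h with
  | nil => simp at hd
  | cons hs h1 _ _ ih =>
    rcases List.mem_cons.1 hd with rfl | hd
    · obtain ⟨e, he⟩ := Option.ne_none_iff_exists'.1 (h1.fv hx)
      simp [(hs.left he).1]
    · obtain ⟨e, he⟩ := Option.ne_none_iff_exists'.1 (ih hd)
      simp [(hs.right he).1]

theorem ArgsTyped.fc {Γ : Ctx K} {ds Ss s p} (h : ArgsTyped Γ ds Ss) {d} (hd : d ∈ ds)
    (hx : (s, p) ∈ d.fc) : ∃ e, Γ.ent (.ep s p) = some e ∧ ¬ e.Ended := by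
  induction h with
  | nil => simp at hd
  | cons hs h1 h2 _ ih =>
    rcases List.mem_cons.1 hd with rfl | hd
    · obtain ⟨e, he, hn⟩ := h1.fc h2 hx
      exact ⟨e, (hs.left he).1, hn⟩
    · obtain ⟨e, he, hn⟩ := ih hd
      exact ⟨e, (hs.right he).1, hn⟩

theorem Typed.fv {Θ : DefEnv K} {Γ : Ctx K} {P : Proc K} (h : Typed Θ Γ P) :
    ∀ x ∈ P.fv, Γ.ent (.var x) ≠ none := by
  induction h with
  | nil => simp [Proc.fv]
  | par hs _ _ ih1 ih2 =>
    rintro x (hx | hx)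
    · obtain ⟨e, he⟩ := Option.ne_none_iff_exists'.1 (ih1 x hx)
      simp [(hs.left he).1]
    · obtain ⟨e, he⟩ := Option.ne_none_iff_exists'.1 (ih2 x hx)
      simp [(hs.right he).1]
  | call _ h =>
    rintro x ⟨d, hd, hx⟩
    exact h.fv hd hx
  | @defn Θ Γ Ss D P _ _ ih1 ih2 =>
    rintro x (hx | hx)
    · have := ih1 _ hx
      simp [Ctx.ent, Ctx.ofList] at this
    · exact ih2 x hx
  | @branch Θ Γ Γ₀ Γ₁ c q n lab pay cont P Γc hs hc hΓc _ ih =>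
    rintro x (hx | hx)
    · obtain ⟨e, he⟩ := Option.ne_none_iff_exists'.1 (hc.fv (d := .chan c) hx)
      simp [(hs.right he).1]
    · obtain ⟨i, hi⟩ := Set.mem_iUnion.1 hx
      have h1 : (Γc i).ent (.var x) ≠ none := ih i _ hi
      obtain ⟨e, he⟩ := Option.ne_none_iff_exists'.1 h1
      rcases (hΓc i).cases he with he | he
      · simp [(hs.left he).1]
      · by_cases hcx : c = .var x
        · subst hcx
          obtain ⟨e, he⟩ := Option.ne_none_iff_exists'.1
            (hc.fv (x := x) (by simp [Datum.fv, Chan.fv]))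
          simp [(hs.right he).1]
        · rw [(Ctx.isOne_singleChan _ c).2 _ (Ne.symm hcx)] at he
          cases he
  | @sel Θ Γ Γ' Γ₀ Γ₁ Γ₂ Γc c q l d S T P hs hs' hc hd _ hΓc _ ih =>
    rintro x ((hx | hx) | hx)
    · obtain ⟨e, he⟩ := Option.ne_none_iff_exists'.1 (hc.fv (d := .chan c) hx)
      simp [(hs.left (hs'.right he).1).1]
    · obtain ⟨e, he⟩ := Option.ne_none_iff_exists'.1 (hd.fv hx)
      simp [(hs.right he).1]
    · obtain ⟨e, he⟩ := Option.ne_none_iff_exists'.1 (ih _ hx)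
      rcases hΓc.cases he with he | he
      · simp [(hs.left (hs'.left he).1).1]
      · by_cases hcx : c = .var x
        · subst hcx
          obtain ⟨e, he⟩ := Option.ne_none_iff_exists'.1
            (hc.fv (x := x) (by simp [Datum.fv, Chan.fv]))
          simp [(hs.left (hs'.right he).1).1]
        · rw [(Ctx.isOne_singleChan _ c).2 _ (Ne.symm hcx)] at he
          cases he
  | crashed => simp [Proc.fv]
  | res R hs _ ih => exact ih

/-- Subjects of prefixes have choice types, data below `end` can be neither sent nor passed, and
bodies of declarations contain no endpoints. So only live or crashed endpoints can occur. -/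
theorem Typed.fc {Θ : DefEnv K} {Γ : Ctx K} {P : Proc K} (h : Typed Θ Γ P) :
    ∀ s p, (s, p) ∈ P.fc → ∃ e, Γ.ent (.ep s p) = some e ∧ ¬ e.Ended := by
  induction h with
  | nil => simp [Proc.fc]
  | par hs _ _ ih1 ih2 =>
    rintro s p (hx | hx)
    · obtain ⟨e, he, hn⟩ := ih1 s p hx
      exact ⟨e, (hs.left he).1, hn⟩
    · obtain ⟨e, he, hn⟩ := ih2 s p hx
      exact ⟨e, (hs.right he).1, hn⟩
  | call _ h =>
    rintro s p ⟨d, hd, hx⟩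
    exact h.fc hd hx
  | @defn Θ Γ Ss D P _ _ ih1 ih2 =>
    rintro s p (hx | hx)
    · have := ih1 _ _ hx
      simp [Ctx.ent, Ctx.ofList] at this
    · exact ih2 s p hx
  | @branch Θ Γ Γ₀ Γ₁ c q n lab pay cont P Γc hs hc hΓc _ ih =>
    rintro s p (hx | hx)
    · obtain ⟨e, he, hn⟩ := hc.fc (d := .chan c) Payload.ext_not_done hx
      exact ⟨e, (hs.right he).1, hn⟩
    · obtain ⟨i, hi⟩ := Set.mem_iUnion.1 hx
      have h1 : ∃ e, (Γc i).ent (.ep s p) = some e ∧ ¬ e.Ended := ih i _ _ hi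
      obtain ⟨e, he, hn⟩ := h1
      rcases (hΓc i).cases he with he | he
      · exact ⟨e, (hs.left he).1, hn⟩
      · by_cases hcx : c = .ep s p
        · subst hcx
          obtain ⟨e, he, hn⟩ := hc.fc (s := s) (p := p) Payload.ext_not_done
            (by simp [Datum.fc, Chan.fc])
          exact ⟨e, (hs.right he).1, hn⟩
        · rw [(Ctx.isOne_singleChan _ c).2 _ (Ne.symm hcx)] at he
          cases he
  | @sel Θ Γ Γ' Γ₀ Γ₁ Γ₂ Γc c q l d S T P hs hs' hc hd hS hΓc _ ih =>
    rintro s p ((hx | hx) | hx)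
    · obtain ⟨e, he, hn⟩ := hc.fc (d := .chan c) Payload.int_not_done hx
      exact ⟨e, (hs.left (hs'.right he).1).1, hn⟩
    · obtain ⟨e, he, hn⟩ := hd.fc hS hx
      exact ⟨e, (hs.right he).1, hn⟩
    · obtain ⟨e, he, hn⟩ := ih _ _ hx
      rcases hΓc.cases he with he | he
      · exact ⟨e, (hs.left (hs'.left he).1).1, hn⟩
      · by_cases hcx : c = .ep s p
        · subst hcx
          obtain ⟨e, he, hn⟩ := hc.fc (s := s) (p := p) Payload.int_not_done
            (by simp [Datum.fc, Chan.fc])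
          exact ⟨e, (hs.left (hs'.right he).1).1, hn⟩
        · rw [(Ctx.isOne_singleChan _ c).2 _ (Ne.symm hcx)] at he
          cases he
  | @crashed Θ Γ Γ₀ s p hs _ =>
    intro s' p' hx
    simp only [Proc.fc, Set.mem_singleton_iff, Prod.mk.injEq] at hx
    obtain ⟨rfl, rfl⟩ := hx
    exact ⟨_, ((Ctx.isOne_singleEp s' p' .crashed).split hs).1, by simp [UType.toEnt, Ent.Ended]⟩
  | res R hs _ ih => exact fun s p hx => ih (s + 1) p hx

/-! ### Substitution -/

theorem liftSub_var (n i : ℕ) (σ : ℕ → Datum K) (h : n ≤ i → σ (i - n) = .chan (.var (i - n))) :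
    liftSub n σ i = .chan (.var i) := by
  unfold liftSub
  split_ifs with hi
  · rfl
  · rw [h (by omega)]
    simp only [Datum.shiftV]
    congr 2; omega

theorem Chan.subst_eq_self {c : Chan K} {σ : ℕ → Datum K} (h : ∀ x ∈ c.fv, σ x = .chan (.var x)) :
    c.subst σ = .chan c := by
  cases c with
  | var x => exact h x rfl
  | ep => rfl

theorem Datum.subst_eq_self {d : Datum K} {σ : ℕ → Datum K}
    (h : ∀ x ∈ d.fv, σ x = .chan (.var x)) : d.subst σ = d := by
  cases d with
  | val => rfl
  | chan c => exact Chan.subst_eq_self h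

theorem Proc.subst_eq_self : ∀ {P : Proc K} {σ : ℕ → Datum K},
    (∀ x ∈ P.fv, σ x = .chan (.var x)) → P.subst σ = P
  | .nil, _, _ => rfl
  | .par P Q, σ, h => by
      simp only [Proc.subst]
      rw [subst_eq_self (P := P) fun x hx => h x (.inl hx),
        subst_eq_self (P := Q) fun x hx => h x (.inr hx)]
  | .res A P, σ, h => by
      simp only [Proc.subst]
      rw [subst_eq_self (P := P) fun x hx => by rw [h x hx]; rfl]
  | .sel c q l d P, σ, h => by
      simp only [Proc.subst]
      rw [Chan.subst_eq_self fun x hx => h x (.inl (.inl hx))]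
      simp only
      rw [Datum.subst_eq_self fun x hx => h x (.inl (.inr hx)),
        subst_eq_self (P := P) fun x hx => h x (.inr hx)]
  | .branch c q n lab P, σ, h => by
      simp only [Proc.subst]
      rw [Chan.subst_eq_self fun x hx => h x (.inl hx)]
      simp only
      congr 1
      funext i
      refine subst_eq_self (P := P i) fun x hx => liftSub_var _ _ _ fun h1 => ?_
      refine h _ (.inr (Set.mem_iUnion.2 ⟨i, ?_⟩))
      have : x - 1 + 1 = x := by omega
      simpa [this] using hx
  | .defn Ss D P, σ, h => by
      simp only [Proc.subst]
      rw [subst_eq_self (P := P) fun x hx => h x (.inr hx),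
        subst_eq_self (P := D) fun x hx => liftSub_var _ _ _ fun h1 => h _ (.inl ?_)]
      have : x - Ss.length + Ss.length = x := by omega
      simpa [this] using hx
  | .call X ds, σ, h => by
      simp only [Proc.subst]
      congr 1
      exact (List.map_congr_left (g := id) fun d hd => Datum.subst_eq_self fun x hx =>
        h x ⟨d, hd, hx⟩).trans (List.map_id _)
  | .err, _, _ => rfl
  | .crashed .., _, _ => rfl

/-- Shift of a channel under the binder of one variable. -/
def Chan.up : Chan K → Chan K
  | .var x => .var (x + 1)
  | .ep s p => .ep s p

theorem Chan.up_injective : Function.Injective (Chan.up : Chan K → Chan K) := by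
  intro c c' h
  cases c <;> cases c' <;> simp_all [Chan.up]

theorem Chan.renS_injective {ρ : ℕ → ℕ} (hρ : Function.Injective ρ) :
    Function.Injective (Chan.renS ρ : Chan K → Chan K) := by
  intro c c' h
  cases c <;> cases c' <;> simp_all [Chan.renS, hρ.eq_iff]

theorem Ctx.ent_consVar_up (S : Payload K) (Γ : Ctx K) (c : Chan K) :
    (consVar S Γ).ent c.up = Γ.ent c := by cases c <;> rfl

theorem Ctx.ent_consSess_succ (A : K.Role → Option (UType K)) (Γ : Ctx K) (c : Chan K) :
    (consSess A Γ).ent (c.renS Nat.succ) = Γ.ent c := by cases c <;> rfl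

theorem Chan.up_cases (c : Chan K) : c = .var 0 ∨ ∃ c', c = Chan.up c' := by
  cases c with
  | var x =>
    cases x with
    | zero => exact .inl rfl
    | succ x => exact .inr ⟨.var x, rfl⟩
  | ep s p => exact .inr ⟨.ep s p, rfl⟩

theorem Chan.succ_cases (c : Chan K) :
    (∃ p, c = .ep 0 p) ∨ ∃ c', c = Chan.renS Nat.succ c' := by
  cases c with
  | var x => exact .inr ⟨.var x, rfl⟩
  | ep s p =>
    cases s with
    | zero => exact .inl ⟨p, rfl⟩
    | succ s => exact .inr ⟨.ep s p, rfl⟩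

/-- The substitution `σ` turns processes with free variables in `V` that are typed by `Γ` into
processes typed by `Δ`: entries of `Γ` that are in use are replaced by values of their type, or by
entries of `Δ` of smaller type, which are pairwise distinct and exhaust the entries of `Δ` that
have to be used. -/
structure Compat (σ : ℕ → Datum K) (V : Set ℕ) (Γ Δ : Ctx K) : Prop where
  unused : ∀ c e, Γ.ent c = some e → ¬ c.fv ⊆ V → e.Ended
  image : ∀ c e, Γ.ent c = some e → ¬ e.Dead → c.fv ⊆ V →
    (∃ v b, c.subst σ = .val v ∧ e = some (.base b) ∧ K.HasTy v b) ∨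
      ∃ c' e', c.subst σ = .chan c' ∧ Δ.ent c' = some e' ∧ e'.Le e
  inj : ∀ c₁ e₁ c₂ e₂ c', Γ.ent c₁ = some e₁ → ¬ e₁.Dead → c₁.fv ⊆ V → Γ.ent c₂ = some e₂ →
    ¬ e₂.Dead → c₂.fv ⊆ V → c₁.subst σ = .chan c' → c₂.subst σ = .chan c' → c₁ = c₂
  cover : ∀ c' e', Δ.ent c' = some e' → ¬ e'.Ended →
    ∃ c e, Γ.ent c = some e ∧ ¬ e.Ended ∧ c.fv ⊆ V ∧ c.subst σ = .chan c'

namespace Compat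

variable {σ : ℕ → Datum K} {V : Set ℕ} {Γ Δ : Ctx K}

theorem not_dead {e : Ent K} (h : ¬ e.Ended) : ¬ e.Dead := fun h' => h h'.ended

theorem ended (h : Compat σ V Γ Δ) (hΓ : Γ.Ended) : Δ.Ended := by
  rw [Ctx.ended_iff] at *
  intro c' e' hc'
  by_contra hn
  obtain ⟨c, e, h1, h2, -⟩ := h.cover c' e' hc' hn
  exact h2 (hΓ c e h1)

/-- A substitution that is compatible with the whole is compatible with the parts. -/
theorem split {Γ₁ Γ₂ : Ctx K} (h : Compat σ V Γ Δ) (hs : Ctx.Split Γ Γ₁ Γ₂) :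
    ∃ Δ₁ Δ₂, Ctx.Split Δ Δ₁ Δ₂ ∧ Compat σ V Γ₁ Δ₁ ∧ Compat σ V Γ₂ Δ₂ := by
  classical
  -- `Δ` is divided according to the images of the live entries of `Γ₁`; by injectivity, no live
  -- entry of `Γ₂` has its image there.
  let C : Set (Chan K) := {c' | ∃ c e, Γ₁.ent c = some e ∧ ¬ e.Dead ∧ c.fv ⊆ V ∧
    c.subst σ = .chan c'}
  refine ⟨Δ.filter C, Δ.filter Cᶜ, Ctx.split_filter _ _, ⟨?_, ?_, ?_, ?_⟩, ⟨?_, ?_, ?_, ?_⟩⟩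
  · exact fun c e h1 h2 => h.unused c e (hs.left h1).1 h2
  · intro c e h1 h2 h3
    rcases h.image c e (hs.left h1).1 h2 h3 with h4 | ⟨c', e', h4, h5, h6⟩
    · exact .inl h4
    · refine .inr ⟨c', e', h4, ?_, h6⟩
      rw [Ctx.ent_filter, if_pos ⟨c, e, h1, h2, h3, h4⟩, h5]
  · exact fun c₁ e₁ c₂ e₂ c' h1 h2 h3 h4 => h.inj c₁ e₁ c₂ e₂ c' (hs.left h1).1 h2 h3
      (hs.left h4).1
  · intro c' e' h1 h2
    rw [Ctx.ent_filter] at h1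
    split_ifs at h1 with hC
    obtain ⟨c, e, h3, h4, h5, h6⟩ := hC
    refine ⟨c, e, h3, fun he => ?_, h5, h6⟩
    rcases h.image c e (hs.left h3).1 h4 h5 with ⟨v, b, h7, -⟩ | ⟨c'', e'', h7, h8, h9⟩
    · rw [h6] at h7; cases h7
    · rw [h6] at h7; cases h7
      rw [h1] at h8; cases h8
      exact h2 (h9.ended_left he)
  · exact fun c e h1 h2 => h.unused c e (hs.right h1).1 h2
  · intro c e h1 h2 h3
    rcases h.image c e (hs.right h1).1 h2 h3 with h4 | ⟨c', e', h4, h5, h6⟩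
    · exact .inl h4
    · refine .inr ⟨c', e', h4, ?_, h6⟩
      rw [Ctx.ent_filter, if_pos, h5]
      rintro ⟨c₀, e₀, g1, g2, g3, g4⟩
      have := h.inj _ _ _ _ _ (hs.left g1).1 g2 g3 (hs.right h1).1 h2 h3 g4 h4
      subst this
      rw [(hs.left g1).2] at h1
      cases h1
  · exact fun c₁ e₁ c₂ e₂ c' h1 h2 h3 h4 => h.inj c₁ e₁ c₂ e₂ c' (hs.right h1).1 h2 h3
      (hs.right h4).1
  · intro c' e' h1 h2
    rw [Ctx.ent_filter] at h1
    split_ifs at h1 with hC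
    obtain ⟨c, e, h3, h4, h5, h6⟩ := h.cover c' e' h1 h2
    rcases hs.cases h3 with h3 | h3
    · exact absurd ⟨c, e, h3, not_dead h4, h5, h6⟩ hC
    · exact ⟨c, e, h3, h4, h5, h6⟩

/-- Substitution into data, which use up one entry. -/
theorem split_data {Γ₀ Γ₁ : Ctx K} {d : Datum K} {S : Payload K} (h : Compat σ V Γ Δ)
    (hs : Ctx.Split Γ Γ₀ Γ₁) (hd : DTyped Γ₁ d S) (hS : ¬ S.Sub (.sess .done)) (hV : d.fv ⊆ V) :
    ∃ Δ₀ Δ₁, Ctx.Split Δ Δ₀ Δ₁ ∧ DTyped Δ₁ (d.subst σ) S ∧ Compat σ V Γ₀ Δ₀ := by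
  classical
  cases d with
  | val v =>
    cases hd with
    | val hv =>
      refine ⟨Δ, .empty, .empty_right _, .val hv, ?_⟩
      have : Γ = Γ₀ := Ctx.ent_injective fun c => by
        rcases Ctx.split_iff.1 hs c with ⟨h1, h2⟩ | ⟨h1, h2⟩
        · rw [h1, h2]; simp
        · exact h2
      exact this ▸ h
  | chan c =>
    obtain ⟨S₀, h1, h2⟩ := hd.isOne
    obtain ⟨g1, g2, g3⟩ := h1.split hs
    have hdead : ¬ Ent.Dead (some S₀) := fun h => hS (h2.done_of_done h)
    have back : ∀ c' e', Γ₀.ent c' = some e' → Γ.ent c' = some e' ∧ c' ≠ c := by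
      intro c' e' h'
      have hc : c' ≠ c := by rintro rfl; rw [g2] at h'; cases h'
      exact ⟨(g3 c' hc).trans h', hc⟩
    rcases h.image c _ g1 hdead hV with ⟨v, b, h3, h4, h5⟩ | ⟨c', e', h3, h4, h5⟩
    · cases h4
      obtain ⟨b', rfl, hb⟩ := h2.base_inv
      refine ⟨Δ, .empty, .empty_right _, ?_, ⟨?_, ?_, ?_, ?_⟩⟩
      · simp only [Datum.subst, h3]
        exact .val (K.hasTy_of_bsub _ _ _ h5 hb)
      · exact fun c e h1 h2 => h.unused c e (back _ _ h1).1 h2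
      · exact fun c e h1 => h.image c e (back _ _ h1).1
      · exact fun c₁ e₁ c₂ e₂ c' h1 h2 h3 h4 => h.inj c₁ e₁ c₂ e₂ c' (back _ _ h1).1 h2 h3
          (back _ _ h4).1
      · intro c' e' h1 h2
        obtain ⟨c₀, e₀, h6, h7, h8⟩ := h.cover c' e' h1 h2
        refine ⟨c₀, e₀, ?_, h7, h8⟩
        rw [← g3 c₀, h6]
        rintro rfl
        rw [g1] at h6; cases h6
        exact h7 (.inl ⟨_, rfl⟩)
    · cases e' with
      | none => exact absurd h5 (by simp [Ent.Le])
      | some S' =>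
        -- The data use up exactly the image `c'`. Injectivity keeps the images of the remaining
        -- entries away from it.
        refine ⟨Δ.filter {c'}ᶜ, Δ.filter {c'}, (Ctx.split_filter _ _).symm, ?_, ⟨?_, ?_, ?_, ?_⟩⟩
        · simp only [Datum.subst, h3]
          refine .of_isOne (S' := S') ⟨by simp [Ctx.ent_filter, h4], fun c'' hc => ?_⟩
            (Payload.Le.trans_sub h5 h2)
          simp [Ctx.ent_filter, hc]
        · exact fun c e h1 h2 => h.unused c e (back _ _ h1).1 h2
        · intro c₀ e₀ k1 k2 k3
          rcases h.image c₀ e₀ (back _ _ k1).1 k2 k3 with k4 | ⟨c'', e'', k4, k5, k6⟩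
          · exact .inl k4
          · refine .inr ⟨c'', e'', k4, ?_, k6⟩
            have : c'' ≠ c' := by
              rintro rfl
              exact (back _ _ k1).2 (h.inj _ _ _ _ _ (back _ _ k1).1 k2 k3 g1 hdead hV k4 h3)
            simp [Ctx.ent_filter, this, k5]
        · exact fun c₁ e₁ c₂ e₂ c' h1 h2 h3 h4 => h.inj c₁ e₁ c₂ e₂ c' (back _ _ h1).1 h2 h3
            (back _ _ h4).1
        · intro c'' e'' k1 k2
          rw [Ctx.ent_filter] at k1
          split_ifs at k1 with hC
          obtain ⟨c₀, e₀, k3, k4, k5, k6⟩ := h.cover c'' e'' k1 k2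
          refine ⟨c₀, e₀, ?_, k4, k5, k6⟩
          rw [← g3 c₀, k3]
          rintro rfl
          rw [h3] at k6; cases k6
          exact hC rfl

/-- Substitution in contexts that are extended with a channel. -/
theorem add_chan {Γ' Δ' Γ₁ Δ₁ : Ctx K} {c c' : Chan K} {e : Ent K} (h : Compat σ V Γ Δ)
    (hσ : c.subst σ = .chan c') (hV : c.fv ⊆ V) (h1 : Γ₁.IsOne c e) (h2 : Δ₁.IsOne c' e)
    (hΓ : Ctx.Split Γ' Γ Γ₁) (hΔ : Ctx.Split Δ' Δ Δ₁) : Compat σ V Γ' Δ' := by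
  obtain ⟨a1, a2, a3⟩ := h1.split hΓ
  obtain ⟨b1, b2, b3⟩ := h2.split hΔ
  -- `c'` is absent from `Δ`, so it is not the image of a live entry of `Γ`, and the extension stays
  -- injective.
  have ne : ∀ c₀ e₀, Γ.ent c₀ = some e₀ → ¬ e₀.Dead → c₀.fv ⊆ V → c₀.subst σ ≠ .chan c' := by
    intro c₀ e₀ g1 g2 g3 g4
    rcases h.image c₀ e₀ g1 g2 g3 with ⟨v, b, g5, -⟩ | ⟨c'', e'', g5, g6, -⟩
    · rw [g4] at g5; cases g5
    · rw [g4] at g5; cases g5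
      rw [b2] at g6; cases g6
  refine ⟨?_, ?_, ?_, ?_⟩
  · intro c₀ e₀ g1 g2
    by_cases hc : c₀ = c
    · subst hc; exact absurd hV g2
    · exact h.unused c₀ e₀ (by rw [← a3 _ hc, g1]) g2
  · intro c₀ e₀ g1 g2 g3
    by_cases hc : c₀ = c
    · subst hc
      rw [a1] at g1; cases g1
      exact .inr ⟨c', e, hσ, b1, .refl _⟩
    · rcases h.image c₀ e₀ (by rw [← a3 _ hc, g1]) g2 g3 with g4 | ⟨c'', e'', g5, g6, g7⟩
      · exact .inl g4
      · exact .inr ⟨c'', e'', g5, (hΔ.left g6).1, g7⟩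
  · intro c₁ e₁ c₂ e₂ c'' g1 g2 g3 g4 g5 g6 g7 g8
    by_cases hc1 : c₁ = c
    · by_cases hc2 : c₂ = c
      · rw [hc1, hc2]
      · subst hc1
        rw [hσ] at g7; cases g7
        exact absurd g8 (ne c₂ e₂ (by rw [← a3 _ hc2, g4]) g5 g6)
    · by_cases hc2 : c₂ = c
      · subst hc2
        rw [hσ] at g8; cases g8
        exact absurd g7 (ne c₁ e₁ (by rw [← a3 _ hc1, g1]) g2 g3)
      · exact h.inj c₁ e₁ c₂ e₂ c'' (by rw [← a3 _ hc1, g1]) g2 g3 (by rw [← a3 _ hc2, g4])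
          g5 g6 g7 g8
  · intro c'' e'' g1 g2
    by_cases hc : c'' = c'
    · subst hc
      rw [b1] at g1; cases g1
      exact ⟨c, e, a1, g2, hV, hσ⟩
    · obtain ⟨c₀, e₀, g3, g4⟩ := h.cover c'' e'' (by rw [← b3 _ hc, g1]) g2
      exact ⟨c₀, e₀, (hΓ.left g3).1, g4⟩

/-- Substitution below a binder of channels. -/
theorem lift {σ' : ℕ → Datum K} {V' : Set ℕ} {Γ' Δ' : Ctx K} (h : Compat σ V Γ Δ)
    (up : Chan K → Chan K) (upD : Datum K → Datum K) (hup : Function.Injective up)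
    (hval : ∀ v, upD (.val v) = .val v) (hchan : ∀ c, upD (.chan c) = .chan (up c))
    (hΓ : ∀ c, Γ'.ent (up c) = Γ.ent c) (hΔ : ∀ c, Δ'.ent (up c) = Δ.ent c)
    (hσ : ∀ c, (up c).subst σ' = upD (c.subst σ)) (hV : ∀ c, (up c).fv ⊆ V' ↔ c.fv ⊆ V)
    (hnew : ∀ c, (∃ c', c = up c') ∨
      (c.subst σ' = .chan c ∧ Γ'.ent c = Δ'.ent c ∧ c.fv ⊆ V' ∧ ∀ c', c ≠ up c')) :
    Compat σ' V' Γ' Δ' := by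
  have up_chan : ∀ {c c'}, (up c).subst σ' = .chan c' → ∃ c'', c' = up c'' ∧
      c.subst σ = .chan c'' := by
    intro c c' h'
    rw [hσ] at h'
    cases hc : c.subst σ with
    | val v => rw [hc, hval] at h'; cases h'
    | chan c'' => rw [hc, hchan] at h'; cases h'; exact ⟨c'', rfl, rfl⟩
  refine ⟨?_, ?_, ?_, ?_⟩
  · intro c e h1 h2
    rcases hnew c with ⟨c, rfl⟩ | ⟨-, -, h3, -⟩
    · rw [hΓ] at h1; rw [hV] at h2
      exact h.unused c e h1 h2
    · exact absurd h3 h2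
  · intro c e h1 h2 h3
    rcases hnew c with ⟨c, rfl⟩ | ⟨h4, h5, -, -⟩
    · rw [hΓ] at h1; rw [hV] at h3
      rcases h.image c e h1 h2 h3 with ⟨v, b, g1, g2⟩ | ⟨c', e', g1, g2, g3⟩
      · exact .inl ⟨v, b, by rw [hσ, g1, hval], g2⟩
      · exact .inr ⟨up c', e', by rw [hσ, g1, hchan], by rw [hΔ, g2], g3⟩
    · exact .inr ⟨c, e, h4, by rw [← h5, h1], .refl _⟩
  · intro c₁ e₁ c₂ e₂ c' h1 h2 h3 h4 h5 h6 h7 h8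
    rcases hnew c₁ with ⟨c₁, rfl⟩ | ⟨a1, a2, a3, a4⟩
    · obtain ⟨c'', rfl, g1⟩ := up_chan h7
      rcases hnew c₂ with ⟨c₂, rfl⟩ | ⟨b1, b2, b3, b4⟩
      · obtain ⟨c₃, g2, g3⟩ := up_chan h8
        obtain rfl := hup g2
        rw [hΓ] at h1 h4; rw [hV] at h3 h6
        rw [h.inj c₁ e₁ c₂ e₂ _ h1 h2 h3 h4 h5 h6 g1 g3]
      · rw [b1] at h8; cases h8
        exact absurd rfl (b4 c'')
    · rw [a1] at h7; cases h7
      rcases hnew c₂ with ⟨c₂, rfl⟩ | ⟨b1, b2, b3, b4⟩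
      · obtain ⟨c₃, g2, g3⟩ := up_chan h8
        exact absurd g2 (a4 c₃)
      · rw [b1] at h8; cases h8; rfl
  · intro c' e' h1 h2
    rcases hnew c' with ⟨c', rfl⟩ | ⟨a1, a2, a3, a4⟩
    · rw [hΔ] at h1
      obtain ⟨c, e, g1, g2, g3, g4⟩ := h.cover c' e' h1 h2
      exact ⟨up c, e, by rw [hΓ, g1], g2, (hV c).2 g3, by rw [hσ, g4, hchan]⟩
    · exact ⟨c', e', by rw [a2, h1], h2, a3, a1⟩

theorem consVar (h : Compat σ V Γ Δ) (S : Payload K) :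
    Compat (liftSub 1 σ) {x | x = 0 ∨ x - 1 ∈ V} (.consVar S Γ) (.consVar S Δ) := by
  refine h.lift Chan.up (Datum.shiftV 1) Chan.up_injective (fun _ => rfl) ?_
    (Ctx.ent_consVar_up S Γ) (Ctx.ent_consVar_up S Δ) ?_ ?_ ?_
  · intro c; cases c <;> rfl
  · intro c
    cases c with
    | var x => simp [Chan.up, Chan.subst, liftSub]
    | ep s p => rfl
  · intro c
    cases c <;> simp [Chan.up, Chan.fv]
  · intro c
    rcases c.up_cases with rfl | h'
    · refine .inr ⟨rfl, rfl, by simp [Chan.fv], ?_⟩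
      rintro (x | ⟨s, p⟩) h <;> simp [Chan.up] at h
    · exact .inl h'

theorem consSess (h : Compat σ V Γ Δ) (A : K.Role → Option (UType K)) :
    Compat (fun i => (σ i).renS Nat.succ) V (.consSess A Γ) (.consSess A Δ) := by
  refine h.lift (Chan.renS Nat.succ) (Datum.renS Nat.succ)
    (Chan.renS_injective Nat.succ_injective) (fun _ => rfl) (fun _ => rfl)
    (Ctx.ent_consSess_succ A Γ) (Ctx.ent_consSess_succ A Δ) ?_ ?_ ?_
  · intro c; cases c <;> rfl
  · intro c; cases c <;> rfl
  · intro c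
    rcases c.succ_cases with ⟨p, rfl⟩ | h'
    · refine .inr ⟨rfl, rfl, by simp [Chan.fv], ?_⟩
      rintro (x | ⟨s, p⟩) h <;> simp [Chan.renS] at h
    · exact .inl h'

theorem args {Γ : Ctx K} {ds Ss} (hd : ArgsTyped Γ ds Ss) : ∀ {Δ : Ctx K}, Compat σ V Γ Δ →
    (∀ d ∈ ds, d.fv ⊆ V) → ArgsTyped Δ (ds.map (Datum.subst σ)) Ss := by
  induction hd with
  | nil h' => exact fun h _ => .nil (h.ended h')
  | cons hs h1 h2 _ ih =>
    intro Δ h hV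
    obtain ⟨Δ₀, Δ₁, k1, k2, k3⟩ := h.split_data hs.symm h1 h2 (hV _ (by simp))
    exact .cons k1.symm k2 h2 (ih k3 fun d hd => hV d (by simp [hd]))

end Compat

/-- Substitution lemma. `Compat` passes to the parts of every split that a typing rule makes and
lifts below every binder, so each rule is reproduced with the context `Δ`. -/
theorem Typed.subst {Θ : DefEnv K} {Γ : Ctx K} {P : Proc K} (h : Typed Θ Γ P) :
    ∀ {σ : ℕ → Datum K} {V : Set ℕ} {Δ : Ctx K}, Compat σ V Γ Δ → P.fv ⊆ V →
      Typed Θ Δ (P.subst σ) := by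
  induction h with
  | nil h => exact fun hC _ => .nil (hC.ended h)
  | par hs _ _ ih1 ih2 =>
    intro σ V Δ hC hV
    obtain ⟨Δ₁, Δ₂, h1, h2, h3⟩ := hC.split hs
    exact .par h1 (ih1 h2 fun x hx => hV (.inl hx)) (ih2 h3 fun x hx => hV (.inr hx))
  | call hX h =>
    intro σ V Δ hC hV
    exact .call hX (Compat.args h hC fun d hd x hx => hV ⟨d, hd, hx⟩)
  | @defn Θ Γ Ss D P hD hP _ ih =>
    intro σ V Δ hC hV
    refine .defn ?_ (ih hC fun x hx => hV (.inr hx))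
    -- A declared body has no free variables except its parameters, so the substitution leaves it
    -- unchanged.
    rw [Proc.subst_eq_self]
    · exact hD
    · intro x hx
      refine liftSub_var _ _ _ fun h => ?_
      have := hD.fv x hx
      simp [Ctx.ent, Ctx.ofList, h] at this
  | @branch Θ Γ Γ₀ Γ₁ c q n lab pay cont P Γc hs hc hΓc _ ih =>
    intro σ V Δ hC hV
    have hcV : c.fv ⊆ V := fun x hx => hV (.inl hx)
    obtain ⟨Δ₀, Δ₁, k1, k2, k3⟩ := hC.split_data hs hc Payload.ext_not_done hcV
    simp only [Datum.subst] at k2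
    simp only [Proc.subst]
    cases hσ : c.subst σ with
    | val v => rw [hσ] at k2; cases k2
    | chan c' =>
      rw [hσ] at k2
      obtain ⟨S', k4, -⟩ := k2.isOne
      obtain ⟨-, k5, -⟩ := k4.split k1
      -- The subject has been split off, so `c'` is free in `Δ₀` and may be added again with the
      -- type of the continuation.
      have hd : ∀ i, Ctx.Split (Ctx.union Δ₀ (.singleChan (cont i) c')) Δ₀
          (.singleChan (cont i) c') := by
        intro i
        refine ⟨?_, rfl⟩
        have hone := Ctx.isOne_singleChan (cont i) c'
        refine ⟨fun x => ?_, fun s p => ?_⟩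
        · by_cases hx : (.var x : Chan K) = c'
          · subst hx; left; simpa [Ctx.ent] using k5
          · right; simpa [Ctx.ent] using hone.2 _ hx
        · by_cases hx : (.ep s p : Chan K) = c'
          · subst hx; left; simpa [Ctx.ent] using k5
          · right; simpa [Ctx.ent] using hone.2 _ hx
      refine .branch _ k1 k2 hd fun i => ih i ((k3.add_chan hσ hcV (Ctx.isOne_singleChan _ c)
        (Ctx.isOne_singleChan _ c') (hΓc i) (hd i)).consVar _) fun x hx => ?_
      by_cases h0 : x = 0
      · exact .inl h0
      · refine .inr (hV (.inr (Set.mem_iUnion.2 ⟨i, ?_⟩)))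
        have : x - 1 + 1 = x := by omega
        simpa [this] using hx
  | @sel Θ Γ Γ' Γ₀ Γ₁ Γ₂ Γc c q l d S T P hs hs' hc hd hS hΓc _ ih =>
    intro σ V Δ hC hV
    have hcV : c.fv ⊆ V := fun x hx => hV (.inl (.inl hx))
    obtain ⟨Δ', Δ₂, k1, k2, k3⟩ := hC.split_data hs hd hS fun x hx => hV (.inl (.inr hx))
    obtain ⟨Δ₀, Δ₁, m1, m2, m3⟩ := k3.split_data hs' hc Payload.int_not_done hcV
    simp only [Datum.subst] at m2
    simp only [Proc.subst]
    cases hσ : c.subst σ with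
    | val v => rw [hσ] at m2; cases m2
    | chan c' =>
      rw [hσ] at m2
      obtain ⟨S', k4, -⟩ := m2.isOne
      obtain ⟨-, k5, -⟩ := k4.split m1
      have hd : Ctx.Split (Ctx.union Δ₀ (.singleChan T c')) Δ₀ (.singleChan T c') := by
        refine ⟨?_, rfl⟩
        have hone := Ctx.isOne_singleChan T c'
        refine ⟨fun x => ?_, fun s p => ?_⟩
        · by_cases hx : (.var x : Chan K) = c'
          · subst hx; left; simpa [Ctx.ent] using k5
          · right; simpa [Ctx.ent] using hone.2 _ hx
        · by_cases hx : (.ep s p : Chan K) = c'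
          · subst hx; left; simpa [Ctx.ent] using k5
          · right; simpa [Ctx.ent] using hone.2 _ hx
      exact .sel k1 m1 m2 k2 hS hd (ih (m3.add_chan hσ hcV (Ctx.isOne_singleChan _ c)
        (Ctx.isOne_singleChan _ c') hΓc hd) fun x hx => hV (.inr hx))
  | @crashed Θ Γ Γ₀ s p hs h0 =>
    intro σ V Δ hC _
    obtain ⟨a1, a2, a3⟩ := (Ctx.isOne_singleEp s p (.crashed : UType K)).split hs
    rcases hC.image _ _ a1 (by simp [UType.toEnt, Ent.Dead]) (by simp [Chan.fv]) with
      ⟨v, b, h1, -⟩ | ⟨c', e', h1, h2, h3⟩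
    · cases h1
    · cases h1
      cases e' with
      | some => simp [UType.toEnt, Ent.Le] at h3
      | none =>
        refine .crashed (Γ₀ := Δ.filter {.ep s p}ᶜ) ((Ctx.isOne_singleEp s p
          (.crashed : UType K)).split_of h2 ?_ ?_) (Ctx.ended_iff.2 ?_)
        · simp [Ctx.ent_filter]
        · intro c' hc'; simp [Ctx.ent_filter, hc']
        · intro c e h4
          rw [Ctx.ent_filter] at h4
          split_ifs at h4 with hC'
          by_contra hn
          obtain ⟨c₀, e₀, g1, g2, g3, g4⟩ := hC.cover c e h4 hn
          by_cases hc : c₀ = .ep s p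
          · subst hc; cases g4; exact hC' rfl
          · rw [a3 _ hc] at g1
            exact g2 (Ctx.ended_iff.1 h0 _ _ g1)
  | res R hs _ ih =>
    intro σ V Δ hC hV
    exact .res R hs (ih (hC.consSess _) hV)

/-- Typing only depends on the entries that have to be used, and is closed under smaller types of
these entries; unused entries may be dropped. -/
theorem Typed.congr {Θ : DefEnv K} {Γ Δ : Ctx K} {P : Proc K} (h : Typed Θ Γ P) {V : Set ℕ}
    (hP : P.fv ⊆ V) (hV : ∀ x S, Γ.var x = some S → x ∉ V → S.Ended)
    (h1 : ∀ c e, Γ.ent c = some e → ¬ e.Dead → c.fv ⊆ V → ∃ e', Δ.ent c = some e' ∧ e'.Le e)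
    (h2 : ∀ c e, Δ.ent c = some e → ¬ e.Ended → c.fv ⊆ V ∧ ∃ e', Γ.ent c = some e' ∧ e.Le e') :
    Typed Θ Δ P := by
  have hself : ∀ c : Chan K, c.subst (fun x => .chan (.var x)) = .chan c := by
    intro c; cases c <;> rfl
  have := h.subst (σ := fun x => .chan (.var x)) (V := V) (Δ := Δ) ⟨?_, ?_, ?_, ?_⟩ hP
  · rwa [Proc.subst_eq_self fun _ _ => rfl] at this
  · intro c e he hc
    cases c with
    | ep => simp [Chan.fv] at hc
    | var x =>
      obtain ⟨S, hS, rfl⟩ := Ctx.ent_var.1 he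
      exact hV x S hS (by simpa [Chan.fv] using hc)
  · intro c e he hd hc
    obtain ⟨e', h3, h4⟩ := h1 c e he hd hc
    exact .inr ⟨c, e', hself c, h3, h4⟩
  · intro c₁ e₁ c₂ e₂ c' _ _ _ _ _ _ e1 e2
    rw [hself] at e1 e2
    cases e1; cases e2; rfl
  · intro c e hc he
    obtain ⟨h3, e', h4, h5⟩ := h2 c e hc he
    exact ⟨c, e', h4, fun he' => he (h5.ended_left he'), h3, hself c⟩

/-- `Γ` and `Δ` have the same entries, except for terminated ones. -/
def Ctx.Agree (Γ Δ : Ctx K) : Prop :=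
  ∀ c e, ¬ e.Dead → (Γ.ent c = some e ↔ Δ.ent c = some e)

theorem Typed.agree {Θ : DefEnv K} {Γ Δ : Ctx K} {P : Proc K} (h : Typed Θ Γ P)
    (hA : Γ.Agree Δ) : Typed Θ Δ P :=
  h.congr (Set.subset_univ _) (fun _ _ _ h => absurd trivial h)
    (fun c e he hd _ => ⟨e, (hA c e hd).1 he, .refl e⟩)
    (fun c e he hd => ⟨Set.subset_univ _, e, (hA c e fun h => hd h.ended).2 he, .refl e⟩)

/-! ### Renaming -/

theorem liftRen_comp (ρ ρ' : ℕ → ℕ) : liftRen ρ' ∘ liftRen ρ = liftRen (ρ' ∘ ρ) := by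
  funext i; cases i <;> rfl

theorem liftRen_id : liftRen id = id := by
  funext i; cases i <;> rfl

theorem Chan.renS_renS (ρ ρ' : ℕ → ℕ) (c : Chan K) : (c.renS ρ).renS ρ' = c.renS (ρ' ∘ ρ) := by
  cases c <;> rfl

theorem Datum.renS_renS (ρ ρ' : ℕ → ℕ) (d : Datum K) :
    (d.renS ρ).renS ρ' = d.renS (ρ' ∘ ρ) := by
  cases d <;> simp [Datum.renS, Chan.renS_renS]

theorem Chan.renS_id (c : Chan K) : c.renS id = c := by cases c <;> rfl

theorem Datum.renS_id (d : Datum K) : d.renS id = d := by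
  cases d <;> simp [Datum.renS, Chan.renS_id]

namespace Proc

theorem renS_renS : ∀ (P : Proc K) (ρ ρ' : ℕ → ℕ), (P.renS ρ).renS ρ' = P.renS (ρ' ∘ ρ)
  | .nil, _, _ => rfl
  | .par P Q, _, _ => by simp only [renS, renS_renS P, renS_renS Q]
  | .res A P, _, _ => by simp only [renS, renS_renS P, liftRen_comp]
  | .sel c q l d P, _, _ => by
      simp only [renS, renS_renS P, Chan.renS_renS, Datum.renS_renS]
  | .branch c q n lab P, _, _ => by
      simp only [renS, Chan.renS_renS, fun i => renS_renS (P i)]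
  | .defn Ss D P, _, _ => by simp only [renS, renS_renS P, renS_renS D]
  | .call X ds, ρ, ρ' => by
      simp only [renS, List.map_map]
      congr 1
      exact List.map_congr_left fun d _ => Datum.renS_renS ρ ρ' d
  | .err, _, _ => rfl
  | .crashed .., _, _ => rfl

theorem renX_renX : ∀ (P : Proc K) (ρ ρ' : ℕ → ℕ), (P.renX ρ).renX ρ' = P.renX (ρ' ∘ ρ)
  | .nil, _, _ => rfl
  | .par P Q, _, _ => by simp only [renX, renX_renX P, renX_renX Q]
  | .res A P, _, _ => by simp only [renX, renX_renX P]
  | .sel c q l d P, _, _ => by simp only [renX, renX_renX P]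
  | .branch c q n lab P, _, _ => by simp only [renX, fun i => renX_renX (P i)]
  | .defn Ss D P, _, _ => by simp only [renX, renX_renX P, renX_renX D, liftRen_comp]
  | .call X ds, ρ, ρ' => rfl
  | .err, _, _ => rfl
  | .crashed .., _, _ => rfl

theorem renS_id : ∀ (P : Proc K), P.renS id = P
  | .nil => rfl
  | .par P Q => by simp only [renS, renS_id P, renS_id Q]
  | .res A P => by simp only [renS, liftRen_id, renS_id P]
  | .sel c q l d P => by simp only [renS, renS_id P, Chan.renS_id, Datum.renS_id]
  | .branch c q n lab P => by simp only [renS, Chan.renS_id, fun i => renS_id (P i)]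
  | .defn Ss D P => by simp only [renS, renS_id P, renS_id D]
  | .call X ds => by
      simp only [renS]
      congr 1
      exact (List.map_congr_left fun d _ => Datum.renS_id d).trans (List.map_id ds)
  | .err => rfl
  | .crashed .. => rfl

theorem renX_id : ∀ (P : Proc K), P.renX id = P
  | .nil => rfl
  | .par P Q => by simp only [renX, renX_id P, renX_id Q]
  | .res A P => by simp only [renX, renX_id P]
  | .sel c q l d P => by simp only [renX, renX_id P]
  | .branch c q n lab P => by simp only [renX, fun i => renX_id (P i)]
  | .defn Ss D P => by simp only [renX, liftRen_id, renX_id P, renX_id D]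
  | .call X ds => rfl
  | .err => rfl
  | .crashed .. => rfl

theorem renX_renS : ∀ (P : Proc K) (χ ρ : ℕ → ℕ), (P.renX χ).renS ρ = (P.renS ρ).renX χ
  | .nil, _, _ => rfl
  | .par P Q, _, _ => by simp only [renX, renS, renX_renS P, renX_renS Q]
  | .res A P, _, _ => by simp only [renX, renS, renX_renS P]
  | .sel c q l d P, _, _ => by simp only [renX, renS, renX_renS P]
  | .branch c q n lab P, _, _ => by simp only [renX, renS, fun i => renX_renS (P i)]
  | .defn Ss D P, _, _ => by simp only [renX, renS, renX_renS P, renX_renS D]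
  | .call X ds, _, _ => rfl
  | .err, _, _ => rfl
  | .crashed .., _, _ => rfl

/-- Renaming of sessions and of process variables. -/
def ren (ρ χ : ℕ → ℕ) (P : Proc K) : Proc K := (P.renS ρ).renX χ

theorem ren_ren (P : Proc K) (ρ χ ρ' χ' : ℕ → ℕ) :
    (P.ren ρ χ).ren ρ' χ' = P.ren (ρ' ∘ ρ) (χ' ∘ χ) := by
  simp only [ren, renX_renS, renS_renS, renX_renX]

theorem ren_id (P : Proc K) : P.ren id id = P := by simp only [ren, renS_id, renX_id]

theorem renS_eq_ren (P : Proc K) (ρ : ℕ → ℕ) : P.renS ρ = P.ren ρ id := by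
  simp only [ren, renX_id]

theorem renX_eq_ren (P : Proc K) (χ : ℕ → ℕ) : P.renX χ = P.ren id χ := by
  simp only [ren, renS_id]

end Proc

theorem Chan.subst_renS (c : Chan K) (σ : ℕ → Datum K) (ρ : ℕ → ℕ) :
    (c.renS ρ).subst (fun i => (σ i).renS ρ) = (c.subst σ).renS ρ := by
  cases c <;> rfl

theorem Datum.subst_renS (d : Datum K) (σ : ℕ → Datum K) (ρ : ℕ → ℕ) :
    (d.renS ρ).subst (fun i => (σ i).renS ρ) = (d.subst σ).renS ρ := by
  cases d
  · rfl
  · exact Chan.subst_renS _ _ _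

theorem Datum.renS_chan (c : Chan K) (ρ : ℕ → ℕ) :
    (Datum.chan c).renS ρ = .chan (c.renS ρ) := rfl

theorem liftSub_renS (n : ℕ) (σ : ℕ → Datum K) (ρ : ℕ → ℕ) :
    liftSub n (fun i => (σ i).renS ρ) = fun i => (liftSub n σ i).renS ρ := by
  funext i
  unfold liftSub
  split_ifs
  · rfl
  · beta_reduce
    generalize σ (i - n) = d
    rcases d with v | ⟨x | ⟨s, p⟩⟩ <;> rfl

namespace Proc

theorem subst_renS : ∀ (P : Proc K) (σ : ℕ → Datum K) (ρ : ℕ → ℕ),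
    (P.renS ρ).subst (fun i => (σ i).renS ρ) = (P.subst σ).renS ρ
  | .nil, _, _ => rfl
  | .par P Q, _, _ => by simp only [renS, subst, subst_renS P, subst_renS Q]
  | .res A P, σ, ρ => by
      simp only [renS, subst]
      rw [← subst_renS P]
      congr 2
      funext i
      simp only [Datum.renS_renS]
      rfl
  | .sel c q l d P, σ, ρ => by
      simp only [renS, subst]
      rw [Chan.subst_renS]
      cases c.subst σ with
      | val v => rfl
      | chan c' =>
        simp only [Datum.renS_chan, renS, ← Datum.subst_renS d, ← subst_renS P]
  | .branch c q n lab P, σ, ρ => by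
      simp only [renS, subst]
      rw [Chan.subst_renS]
      cases c.subst σ with
      | val v => rfl
      | chan c' =>
        simp only [Datum.renS_chan, renS, liftSub_renS, fun i => subst_renS (P i)]
  | .defn Ss D P, _, _ => by simp only [renS, subst, liftSub_renS, subst_renS P, subst_renS D]
  | .call X ds, σ, ρ => by
      simp only [renS, subst, List.map_map]
      congr 1
      exact List.map_congr_left fun d _ => Datum.subst_renS d σ ρ
  | .err, _, _ => rfl
  | .crashed .., _, _ => rfl

theorem subst_renX : ∀ (P : Proc K) (σ : ℕ → Datum K) (χ : ℕ → ℕ),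
    (P.renX χ).subst σ = (P.subst σ).renX χ
  | .nil, _, _ => rfl
  | .par P Q, _, _ => by simp only [renX, subst, subst_renX P, subst_renX Q]
  | .res A P, _, _ => by simp only [renX, subst, subst_renX P]
  | .sel c q l d P, σ, _ => by
      simp only [renX, subst]
      cases c.subst σ with
      | val v => rfl
      | chan c' => simp only [renX, subst_renX P]
  | .branch c q n lab P, σ, _ => by
      simp only [renX, subst]
      cases c.subst σ with
      | val v => rfl
      | chan c' => simp only [renX, fun i => subst_renX (P i)]
  | .defn Ss D P, _, _ => by simp only [renX, subst, subst_renX P, subst_renX D]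
  | .call X ds, _, _ => rfl
  | .err, _, _ => rfl
  | .crashed .., _, _ => rfl

/-- Basic values contain no sessions, so `inst` is fixed by renaming. This makes the exchange of
basic values stable under renaming of both processes. -/
theorem subst_val_ren (P : Proc K) (v : K.Val) (ρ χ : ℕ → ℕ) :
    (P.subst (inst [.val v])).ren ρ χ = (P.ren ρ χ).subst (inst [.val v]) := by
  have : inst [Value.val v] = fun i => (inst [Value.val v] i : Datum K).renS ρ := by
    funext i
    cases i with
    | zero => rfl
    | succ i => rfl
  rw [ren, ren, subst_renX, ← subst_renS, ← this]

end Proc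

/-! ### Evaluation contexts -/

/-- `F` is an evaluation context, whose hole is below `k` restrictions and `d` declarations. -/
inductive Hole : ℕ → ℕ → (Proc K → Proc K) → Prop
  | top : Hole 0 0 fun L => L
  | parL {k d F} (Q) : Hole k d F → Hole k d fun L => .par (F L) Q
  | parR {k d F} (Q) : Hole k d F → Hole k d fun L => .par Q (F L)
  | res {k d F} (A) : Hole k d F → Hole (k + 1) d fun L => .res A (F L)
  | defn {k d F} (Ss D) : Hole k d F → Hole k (d + 1) fun L => .defn Ss D (F L)

namespace Hole

variable {k d : ℕ} {F : Proc K → Proc K}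

theorem red (h : Hole k d F) {L L' : Proc K} (hL : Red L L') : Red (F L) (F L') := by
  induction h with
  | top => exact hL
  | parL Q _ ih => exact .ctxPar ih
  | parR Q _ ih => exact .cong (.parComm _ _) (.ctxPar ih) (.parComm _ _)
  | res A _ ih => exact .ctxRes ih
  | defn Ss D _ ih => exact .ctxDef ih

/-- A process that does not use the names bound by an evaluation context can be moved out. -/
theorem extrude (h : Hole k d F) : ∀ L : Proc K,
    Cong (F (L.ren (· + k) (· + d))) (.par L (F .nil)) := by
  induction h with
  | top =>
    intro L
    have : L.ren (· + 0) (· + 0) = L := Proc.ren_id L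
    rw [this]
    exact (Cong.parNil _).symm
  | parL Q _ ih => exact fun L => (Cong.par (ih L) (.refl _)).trans (.parAssoc _ _ _)
  | @parR k d F Q _ ih =>
    exact fun L => (Cong.parComm _ _).trans <| (Cong.par (ih L) (.refl _)).trans <|
      (Cong.parAssoc _ _ _).trans <| .par (.refl _) (.parComm _ _)
  | @res k d F A _ ih =>
    intro L
    have := ih (L.ren (· + 1) id)
    rw [Proc.ren_ren] at this
    have e : ((fun x => x + k) ∘ fun x => x + 1) = fun x => x + (k + 1) := by
      funext x; simp only [Function.comp]; omega
    rw [e, ← Proc.renS_eq_ren] at this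
    exact (Cong.res this).trans (.resLift _ _ _)
  | @defn k d F Ss D _ ih =>
    intro L
    have := ih (L.ren id (· + 1))
    rw [Proc.ren_ren] at this
    have e : ((fun x => x + d) ∘ fun x => x + 1) = fun x => x + (d + 1) := by
      funext x; simp only [Function.comp]; omega
    rw [e, ← Proc.renX_eq_ren] at this
    exact (Cong.defn (.refl _) (this.trans (.parComm _ _))).trans <|
      (Cong.defParLift _ _ _ _).trans (.parComm _ _)

/-- Used to move a whole evaluation context below the binders of another one; the hole sees the
renaming lifted under its own binders. -/
theorem ren (h : Hole k d F) : ∀ ρ χ : ℕ → ℕ, ∃ F', Hole k d F' ∧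
    ∀ L, (F L).ren ρ χ = F' (L.ren (liftRen^[k] ρ) (liftRen^[d] χ)) := by
  induction h with
  | top => exact fun ρ χ => ⟨_, .top, fun L => rfl⟩
  | parL Q _ ih =>
    intro ρ χ
    obtain ⟨F', h1, h2⟩ := ih ρ χ
    refine ⟨_, .parL (Q.ren ρ χ) h1, fun L => ?_⟩
    rw [← h2]; rfl
  | parR Q _ ih =>
    intro ρ χ
    obtain ⟨F', h1, h2⟩ := ih ρ χ
    refine ⟨_, .parR (Q.ren ρ χ) h1, fun L => ?_⟩
    rw [← h2]; rfl
  | res A _ ih =>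
    intro ρ χ
    obtain ⟨F', h1, h2⟩ := ih (liftRen ρ) χ
    refine ⟨_, .res A h1, fun L => ?_⟩
    rw [Function.iterate_succ_apply, ← h2]; rfl
  | defn Ss D _ ih =>
    intro ρ χ
    obtain ⟨F', h1, h2⟩ := ih ρ (liftRen χ)
    refine ⟨_, .defn Ss (D.ren ρ (liftRen χ)) h1, fun L => ?_⟩
    rw [Function.iterate_succ_apply, ← h2]; rfl

end Hole

theorem iterate_liftRen_add (ρ : ℕ → ℕ) (k s : ℕ) : (liftRen^[k] ρ) (s + k) = ρ s + k := by
  induction k generalizing ρ with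
  | zero => rfl
  | succ k ih =>
    rw [Function.iterate_succ_apply', ← Nat.add_assoc]
    simp only [liftRen, ih]
    omega

/-- The processes `L₁` and `L₂`, with the session `s₁` of `L₁` identified with the session `s₂` of
`L₂`, reduce to `L₁'` and `L₂'`. -/
def RedPair (s₁ s₂ : ℕ) (L₁ L₁' L₂ L₂' : Proc K) : Prop :=
  ∀ ρ₁ χ₁ ρ₂ χ₂ : ℕ → ℕ, ρ₁ s₁ = ρ₂ s₂ →
    Red (.par (L₁.ren ρ₁ χ₁) (L₂.ren ρ₂ χ₂)) (.par (L₁'.ren ρ₁ χ₁) (L₂'.ren ρ₂ χ₂))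

theorem RedPair.ren {s₁ s₂ t₁ t₂ : ℕ} {L₁ L₁' L₂ L₂' : Proc K} (h : RedPair s₁ s₂ L₁ L₁' L₂ L₂')
    (ρ₁ χ₁ ρ₂ χ₂ : ℕ → ℕ) (hs : ∀ ρ₁' ρ₂' : ℕ → ℕ, ρ₁' t₁ = ρ₂' t₂ → ρ₁' (ρ₁ s₁) = ρ₂' (ρ₂ s₂)) :
    RedPair t₁ t₂ (L₁.ren ρ₁ χ₁) (L₁'.ren ρ₁ χ₁) (L₂.ren ρ₂ χ₂) (L₂'.ren ρ₂ χ₂) := by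
  intro ρ₁' χ₁' ρ₂' χ₂' h'
  simp only [Proc.ren_ren]
  exact h _ _ _ _ (hs _ _ h')

/-- The outer process enters the binders of `F` one at a time by scope extrusion. `RedPair`
quantifies over all renamings, so it survives the shifts that this causes. -/
theorem RedPair.plug_right {k d : ℕ} {F : Proc K → Proc K} (hF : Hole k d F) :
    ∀ {s : ℕ} {L₁ L₁' L₂ L₂' : Proc K}, RedPair s (s + k) L₁ L₁' L₂ L₂' →
      Red (.par L₁ (F L₂)) (.par L₁' (F L₂')) := by
  induction hF with
  | top =>
    intro s L₁ L₁' L₂ L₂' h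
    have := h id id id id rfl
    simpa only [Proc.ren_id] using this
  | parL Q _ ih =>
    intro s L₁ L₁' L₂ L₂' h
    exact .cong (Cong.parAssoc _ _ _).symm (.ctxPar (ih h)) (.parAssoc _ _ _)
  | parR Q _ ih =>
    intro s L₁ L₁' L₂ L₂' h
    refine .cong ?_ (.ctxPar (Q := Q) (ih h)) ?_
    · exact (Cong.par (.refl _) (.parComm _ _)).trans (Cong.parAssoc _ _ _).symm
    · exact (Cong.parAssoc _ _ _).trans (Cong.par (.refl _) (.parComm _ _))
  | @res k d F A _ ih =>
    intro s L₁ L₁' L₂ L₂' h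
    refine .cong (Cong.resLift A L₁ _).symm (.ctxRes (A' := A) ?_) (Cong.resLift A L₁' _)
    rw [Proc.renS_eq_ren, Proc.renS_eq_ren]
    -- Below the restriction the outer process knows the session as `s + 1`; its index in the hole
    -- is unchanged, as `s + (k + 1) = s + 1 + k`.
    have := h.ren Nat.succ id id id (t₁ := s + 1) (t₂ := s + 1 + k) (by
      intro ρ₁' ρ₂' h'
      simp only [id, Nat.succ_eq_add_one, h']
      congr 1; omega)
    rw [Proc.ren_id, Proc.ren_id] at this
    exact ih this
  | @defn k d F Ss D _ ih =>
    intro s L₁ L₁' L₂ L₂' h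
    have e : ∀ L M : Proc K, Cong (.par L (.defn Ss D M))
        (.defn Ss D (.par (L.renX Nat.succ) M)) := fun L M =>
      (Cong.parComm _ _).trans <| (Cong.defParLift _ _ _ _).symm.trans <|
        .defn (.refl _) (.parComm _ _)
    refine .cong (e _ _) (.ctxDef ?_) (e _ _).symm
    rw [Proc.renX_eq_ren, Proc.renX_eq_ren]
    have := h.ren id Nat.succ id id (t₁ := s) (t₂ := s + k) (fun _ _ h => h)
    rw [Proc.ren_id, Proc.ren_id] at this
    exact ih this

/-- Reduction of two processes in evaluation contexts. -/
theorem RedPair.plug {k₁ d₁ : ℕ} {F₁ : Proc K → Proc K} (hF₁ : Hole k₁ d₁ F₁) :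
    ∀ {s k₂ d₂ : ℕ} {F₂ : Proc K → Proc K} {L₁ L₁' L₂ L₂' : Proc K}, Hole k₂ d₂ F₂ →
      RedPair (s + k₁) (s + k₂) L₁ L₁' L₂ L₂' →
      Red (.par (F₁ L₁) (F₂ L₂)) (.par (F₁ L₁') (F₂ L₂')) := by
  induction hF₁ with
  | top => exact fun hF₂ h => h.plug_right hF₂
  | parL Q _ ih =>
    intro s k₂ d₂ F₂ L₁ L₁' L₂ L₂' hF₂ h
    have e : ∀ M N : Proc K, Cong (.par (.par M Q) N) (.par (.par M N) Q) := fun M N =>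
      (Cong.parAssoc _ _ _).trans <| (Cong.par (.refl _) (.parComm _ _)).trans
        (Cong.parAssoc _ _ _).symm
    exact .cong (e _ _) (.ctxPar (ih hF₂ h)) (e _ _).symm
  | parR Q _ ih =>
    intro s k₂ d₂ F₂ L₁ L₁' L₂ L₂' hF₂ h
    have e : ∀ M N : Proc K, Cong (.par (.par Q M) N) (.par (.par M N) Q) := fun M N =>
      (Cong.parAssoc _ _ _).trans (.parComm _ _)
    exact .cong (e _ _) (.ctxPar (ih hF₂ h)) (e _ _).symm
  | @res k d F A _ ih =>
    intro s k₂ d₂ F₂ L₁ L₁' L₂ L₂' hF₂ h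
    have e : ∀ M N : Proc K, Cong (.par (.res A M) N) (.res A (.par M (N.renS Nat.succ))) :=
      fun M N => (Cong.parComm _ _).trans <| (Cong.resLift _ _ _).symm.trans <|
        .res (.parComm _ _)
    refine .cong (e _ _) (.ctxRes (A' := A) ?_) (e _ _).symm
    -- The second process crosses the binder of the first context and is renamed: `F₂` becomes
    -- another evaluation context, with a renamed process in its hole.
    obtain ⟨F', h1, h2⟩ := hF₂.ren Nat.succ id
    rw [Proc.renS_eq_ren, Proc.renS_eq_ren, h2, h2]
    have := h.ren id id (liftRen^[k₂] Nat.succ) (liftRen^[d₂] id) (t₁ := s + 1 + k)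
      (t₂ := s + 1 + k₂) (by
        intro ρ₁' ρ₂' h'
        rw [iterate_liftRen_add, Nat.succ_eq_add_one, ← h', id]
        congr 1; omega)
    rw [Proc.ren_id, Proc.ren_id] at this
    exact ih h1 this
  | @defn k d F Ss D _ ih =>
    intro s k₂ d₂ F₂ L₁ L₁' L₂ L₂' hF₂ h
    refine .cong (Cong.defParLift _ _ _ _).symm (.ctxDef ?_) (Cong.defParLift _ _ _ _)
    obtain ⟨F', h1, h2⟩ := hF₂.ren id Nat.succ
    rw [Proc.renX_eq_ren, Proc.renX_eq_ren, h2, h2]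
    have := h.ren id id (liftRen^[k₂] id) (liftRen^[d₂] Nat.succ) (t₁ := s + k)
      (t₂ := s + k₂) (by
        intro ρ₁' ρ₂' h'
        rw [iterate_liftRen_add, id, h', id])
    rw [Proc.ren_id, Proc.ren_id] at this
    exact ih h1 this

theorem RedPair.comm {s₁ s₂ : ℕ} {p q : K.Role} {n lab} {P : Fin (n + 1) → Proc K} {l v Q}
    (k : Fin (n + 1)) (hk : lab k = .msg l) :
    RedPair s₁ s₂ (.branch (.ep s₁ p) q n lab P) ((P k).subst (inst [.val v]))
      (.sel (.ep s₂ q) p l (.val v) Q) Q := by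
  intro ρ₁ χ₁ ρ₂ χ₂ h
  rw [Proc.subst_val_ren]
  simp only [Proc.ren, Proc.renS, Proc.renX, Chan.renS, Datum.renS, h]
  exact Red.comm (w := .val v) (P := fun i => ((P i).renS ρ₁).renX χ₁) k hk

theorem RedPair.lost {s₁ s₂ : ℕ} {p q : K.Role} {l v} {Q : Proc K} :
    RedPair s₁ s₂ (.crashed s₁ p) (.crashed s₁ p) (.sel (.ep s₂ q) p l (.val v) Q) Q := by
  intro ρ₁ χ₁ ρ₂ χ₂ h
  simp only [Proc.ren, Proc.renS, Proc.renX, Chan.renS, Datum.renS, h]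
  exact .lostVal

theorem RedPair.detect {s₁ s₂ : ℕ} {p q : K.Role} {n lab} {P : Fin (n + 1) → Proc K}
    (k : Fin (n + 1)) (hk : lab k = .crash) :
    RedPair s₁ s₂ (.branch (.ep s₁ p) q n lab P) ((P k).subst (inst [.val K.unitVal]))
      (.crashed s₂ q) (.crashed s₂ q) := by
  intro ρ₁ χ₁ ρ₂ χ₂ h
  rw [Proc.subst_val_ren]
  simp only [Proc.ren, Proc.renS, Proc.renX, Chan.renS, h]
  exact Red.detect (P := fun i => ((P i).renS ρ₁).renX χ₁) k hk

/-! ### Typing of processes in evaluation contexts -/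

namespace Ctx

/-- Shift of the sessions by `k`. -/
def shift (k : ℕ) (Γ : Ctx K) : Ctx K := ⟨Γ.var, fun s p => if k ≤ s then Γ.ep (s - k) p else none⟩

/-- The inverse of a shift of the sessions by `k`. -/
def unshift (k : ℕ) (Γ : Ctx K) : Ctx K := ⟨Γ.var, fun s p => Γ.ep (s + k) p⟩

theorem unshift_shift (k : ℕ) (Γ : Ctx K) : (Γ.shift k).unshift k = Γ := by
  ext1
  · rfl
  · funext s p; simp [unshift, shift]

theorem shift_zero (Γ : Ctx K) : Γ.shift 0 = Γ := by
  ext1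
  · rfl
  · funext s p; simp [shift]

theorem shift_consSess (k : ℕ) (Γ : Ctx K) :
    (consSess (fun _ => none) Γ).shift k = Γ.shift (k + 1) := by
  ext1
  · rfl
  · funext s p
    simp only [shift]
    by_cases h : k ≤ s
    · by_cases h' : k + 1 ≤ s
      · have : s - k = s - (k + 1) + 1 := by omega
        rw [if_pos h, if_pos h', this]; rfl
      · have : s - k = 0 := by omega
        rw [if_pos h, if_neg h', this]; rfl
    · rw [if_neg h, if_neg (by omega)]

theorem ent_unshift (k : ℕ) (Γ : Ctx K) (c : Chan K) :
    (Γ.unshift k).ent c = Γ.ent (c.renS (· + k)) := by cases c <;> rfl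

theorem ent_shift_ep {k : ℕ} {Γ : Ctx K} {s p e} (h : (Γ.shift k).ent (.ep s p) = some e) :
    k ≤ s ∧ Γ.ent (.ep (s - k) p) = some e := by
  simp only [ent, shift] at h
  split_ifs at h with hk
  · exact ⟨hk, h⟩
  · cases h

theorem ent_shift_var (k : ℕ) (Γ : Ctx K) (x : ℕ) :
    (Γ.shift k).ent (.var x) = Γ.ent (.var x) := rfl

theorem Split.unshift {Γ Γ₁ Γ₂ : Ctx K} (h : Split Γ Γ₁ Γ₂) (k : ℕ) :
    Split (Γ.unshift k) (Γ₁.unshift k) (Γ₂.unshift k) :=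
  split_iff.2 fun c => by simpa only [ent_unshift] using split_iff.1 h _

theorem Ended.unshift {Γ : Ctx K} (h : Γ.Ended) (k : ℕ) : (Γ.unshift k).Ended :=
  ended_iff.2 fun c _ he => ended_iff.1 h _ _ ((ent_unshift k Γ c).symm.trans he)

theorem Agree.shift {Γ Δ : Ctx K} (h : Γ.Agree Δ) (k : ℕ) : (Γ.shift k).Agree (Δ.shift k) := by
  intro c e he
  cases c with
  | var x => exact h (.var x) e he
  | ep s p =>
    simp only [ent, Ctx.shift]
    split_ifs
    · exact h (.ep (s - k) p) e he
    · simp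

theorem agree_consSess {A A' : K.Role → Option (UType K)} {Γ : Ctx K}
    (hA : ∀ p U, A p = some U → U.Ended) (hA' : ∀ p U, A' p = some U → U.Ended) :
    (consSess A Γ).Agree (consSess A' Γ) := by
  intro c e he
  rcases c.succ_cases with ⟨p, rfl⟩ | ⟨c, rfl⟩
  · constructor
    · intro h
      obtain ⟨U, hU, rfl⟩ := ent_ep'.1 h
      exact absurd (UType.dead_toEnt.2 (hA p U hU)) he
    · intro h
      obtain ⟨U, hU, rfl⟩ := ent_ep'.1 h
      exact absurd (UType.dead_toEnt.2 (hA' p U hU)) he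
  · rw [ent_consSess_succ, ent_consSess_succ]

end Ctx

/-- Decomposition of the typing of a process in an evaluation context: the process and the context
are typed by two parts of the typing context, and the process may be exchanged. -/
theorem Hole.typed {k d : ℕ} {F : Proc K → Proc K} (hF : Hole k d F) :
    ∀ {Θ : DefEnv K} {Γ : Ctx K} {L : Proc K}, Typed Θ Γ (F L) → (F L).ResEnded →
      ∃ (Θ' : DefEnv K) (Γ₁ Γ₂ : Ctx K), Ctx.Split Γ Γ₁ Γ₂ ∧ (∀ X, Θ' (X + d) = Θ X) ∧
        Typed Θ' (Γ₁.shift k) L ∧ ∀ Γ' Γ₁' L', Ctx.Split Γ' Γ₁' Γ₂ → Typed Θ' (Γ₁'.shift k) L' →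
          Typed Θ Γ' (F L') := by
  induction hF with
  | top =>
    intro Θ Γ L h _
    refine ⟨Θ, Γ, .empty, Ctx.Split.empty_right Γ, fun _ => rfl, by rwa [Ctx.shift_zero], ?_⟩
    intro Γ' Γ₁' L' hs hL
    have : Γ' = Γ₁' := Ctx.ent_injective fun c => by
      rcases Ctx.split_iff.1 hs c with ⟨h1, h2⟩ | ⟨h1, h2⟩
      · rw [h1, h2]; simp
      · exact h2
    rw [Ctx.shift_zero] at hL
    exact this ▸ hL
  | @parL k d F Q _ ih =>
    intro Θ Γ L h hR
    cases h with
    | par hs h1 h2 =>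
      obtain ⟨Θ', Γ₁, Γ₂, k1, k2, k3, k4⟩ := ih h1 hR.1
      obtain ⟨Γ₅, k5, k6⟩ := hs.assoc k1
      refine ⟨Θ', Γ₁, Γ₅, k5, k2, k3, fun Γ' Γ₁' L' hs' hL => ?_⟩
      obtain ⟨Γ₆, m1, m2⟩ := hs'.symm.assoc k6.symm
      exact .par m1.symm (k4 _ _ _ m2.symm hL) h2
  | @parR k d F Q _ ih =>
    intro Θ Γ L h hR
    cases h with
    | par hs h1 h2 =>
      obtain ⟨Θ', Γ₁, Γ₂, k1, k2, k3, k4⟩ := ih h2 hR.2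
      obtain ⟨Γ₅, k5, k6⟩ := hs.symm.assoc k1
      refine ⟨Θ', Γ₁, Γ₅, k5, k2, k3, fun Γ' Γ₁' L' hs' hL => ?_⟩
      obtain ⟨Γ₆, m1, m2⟩ := hs'.symm.assoc k6.symm
      exact .par m1 h1 (k4 _ _ _ m2.symm hL)
  | @res k d F A _ ih =>
    intro Θ Γ L h hR
    cases h with
    | res R hsafe h1 =>
      have hA : ∀ p U, A p = some U → U.Ended := fun p U hU => hR.1.2 0 p U hU
      obtain ⟨Θ', G₁, G₂, k1, k2, k3, k4⟩ := ih h1 hR.2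
      have hG₁ : ∀ p U, G₁.ep 0 p = some U → U.Ended := fun p U hU =>
        hA p U (Ctx.ent_ep.1 (k1.left (Ctx.ent_ep.2 hU)).1)
      have hG₂ : ∀ p U, G₂.ep 0 p = some U → U.Ended := fun p U hU =>
        hA p U (Ctx.ent_ep.1 (k1.right (Ctx.ent_ep.2 hU)).1)
      have eta : ∀ G : Ctx K, G = .consSess (G.ep 0) (G.unshift 1) := by
        intro G
        refine Ctx.ent_injective fun c => ?_
        rcases c.succ_cases with ⟨p, rfl⟩ | ⟨c, rfl⟩
        · rfl
        · rw [Ctx.ent_consSess_succ, Ctx.ent_unshift]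
      refine ⟨Θ', G₁.unshift 1, G₂.unshift 1, ?_, k2, ?_, ?_⟩
      · have := k1.unshift 1
        exact this
      -- The restricted session only has terminated entries. Those that went to the process in the
      -- hole can be dropped, so that its context becomes a shift of an outer context.
      · rw [← Ctx.shift_consSess]
        refine k3.agree (Ctx.Agree.shift ?_ k)
        have := Ctx.agree_consSess (Γ := G₁.unshift 1) hG₁ (A' := fun _ => none) (by simp)
        rwa [← eta] at this
      · intro Γ' Γ₁' L' hs hL
        rw [← Ctx.shift_consSess] at hL
        -- The terminated entries that were dropped are put back, which restores the annotation `A`.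
        refine .res R hsafe (Typed.agree (k4 (.consSess (G₂.ep 0) Γ') _ L' ?_ hL)
          (Ctx.agree_consSess hG₂ hA))
        refine Ctx.split_iff.2 fun c => ?_
        rcases c.succ_cases with ⟨p, rfl⟩ | ⟨c, rfl⟩
        · exact .inl ⟨rfl, rfl⟩
        · rw [Ctx.ent_consSess_succ, Ctx.ent_consSess_succ]
          have := Ctx.split_iff.1 hs c
          rwa [Ctx.ent_unshift] at this
  | @defn k d F Ss D _ ih =>
    intro Θ Γ L h hR
    cases h with
    | defn h1 h2 =>
      obtain ⟨Θ', Γ₁, Γ₂, k1, k2, k3, k4⟩ := ih h2 hR.2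
      refine ⟨Θ', Γ₁, Γ₂, k1, fun X => ?_, k3, fun Γ' Γ₁' L' hs hL => .defn h1 (k4 _ _ _ hs hL)⟩
      have := k2 (X + 1)
      rwa [show X + 1 + d = X + (d + 1) by omega] at this

/-! ### Process calls -/

/-- The number of process calls outside selections, branchings and declarations. -/
def Proc.ncalls : Proc K → ℕ
  | .par P Q => P.ncalls + Q.ncalls
  | .res _ P => P.ncalls
  | .defn _ _ P => P.ncalls
  | .call _ _ => 1
  | _ => 0

/-- The conditions on declarations and restrictions in processes that only play one role. -/
def Proc.Tame (P : Proc K) : Prop := P.GuardedDefs ∧ P.ResEnded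

theorem Hole.ncalls {k d : ℕ} {F : Proc K → Proc K} (hF : Hole k d F) (L : Proc K) :
    (F L).ncalls = (F .nil).ncalls + L.ncalls := by
  induction hF with
  | top => simp [Proc.ncalls]
  | parL Q _ ih => simp only [Proc.ncalls, ih]; omega
  | parR Q _ ih => simp only [Proc.ncalls, ih]; omega
  | res A _ ih => simp only [Proc.ncalls, ih]
  | defn Ss D _ ih => simp only [Proc.ncalls, ih]

theorem Hole.tame {k d : ℕ} {F : Proc K → Proc K} (hF : Hole k d F) {L : Proc K}
    (h : (F L).Tame) : L.Tame ∧ ∀ L' : Proc K, L'.Tame → (F L').Tame := by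
  induction hF with
  | top => exact ⟨h, fun _ h => h⟩
  | parL Q _ ih =>
    obtain ⟨⟨h1, h2⟩, h3, h4⟩ := h
    obtain ⟨k1, k2⟩ := ih ⟨h1, h3⟩
    exact ⟨k1, fun L' hL => ⟨⟨(k2 L' hL).1, h2⟩, (k2 L' hL).2, h4⟩⟩
  | parR Q _ ih =>
    obtain ⟨⟨h1, h2⟩, h3, h4⟩ := h
    obtain ⟨k1, k2⟩ := ih ⟨h2, h4⟩
    exact ⟨k1, fun L' hL => ⟨⟨h1, (k2 L' hL).1⟩, h3, (k2 L' hL).2⟩⟩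
  | res A _ ih =>
    obtain ⟨h1, h2, h3⟩ := h
    obtain ⟨k1, k2⟩ := ih ⟨h1, h3⟩
    exact ⟨k1, fun L' hL => ⟨(k2 L' hL).1, h2, (k2 L' hL).2⟩⟩
  | defn Ss D _ ih =>
    obtain ⟨⟨h1, h2, h3, h4⟩, h5, h6⟩ := h
    obtain ⟨k1, k2⟩ := ih ⟨h4, h6⟩
    exact ⟨k1, fun L' hL => ⟨⟨h1, h2, h3, (k2 L' hL).1⟩, h5, (k2 L' hL).2⟩⟩

/-- Substitution neither creates calls nor removes prefixes from well-guarded calls in a way that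
would expose them. So an instance of a declared body contributes nothing to the count of pending
calls. -/
theorem Proc.CallsGuarded.ncalls_subst : ∀ {P : Proc K}, P.CallsGuarded → ∀ σ,
    (P.subst σ).ncalls = 0
  | .nil, _, _ => rfl
  | .par P Q, h, σ => by
      simp only [subst, Proc.ncalls, ncalls_subst h.1, ncalls_subst h.2]
  | .res A P, h, σ => by
      simp only [subst, Proc.ncalls]
      exact ncalls_subst (P := P) h _
  | .sel c q l d P, _, σ => by
      simp only [subst]; split <;> rfl
  | .branch c q n lab P, _, σ => by
      simp only [subst]; split <;> rfl
  | .defn Ss D P, h, σ => by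
      simp only [subst, Proc.ncalls, ncalls_subst h.2]
  | .call X ds, h, _ => by simp [CallsGuarded] at h
  | .err, _, _ => rfl
  | .crashed .., _, _ => rfl

theorem Proc.ResEnded.subst : ∀ {P : Proc K}, P.ResEnded → ∀ σ, (P.subst σ).ResEnded
  | .nil, _, _ => trivial
  | .par P Q, h, σ => ⟨ResEnded.subst h.1 σ, ResEnded.subst h.2 σ⟩
  | .res A P, h, σ => ⟨h.1, ResEnded.subst h.2 _⟩
  | .sel c q l d P, h, σ => by
      simp only [Proc.subst]
      split
      · exact ResEnded.subst (P := P) h σ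
      · trivial
  | .branch c q n lab P, h, σ => by
      simp only [Proc.subst]
      split
      · exact fun i => ResEnded.subst (P := P i) (h i) _
      · trivial
  | .defn Ss D P, h, σ => ⟨ResEnded.subst h.1 _, ResEnded.subst h.2 σ⟩
  | .call X ds, h, _ => trivial
  | .err, _, _ => trivial
  | .crashed .., _, _ => trivial

theorem Typed.subst_params {Θ : DefEnv K} {Ss : List (Payload K)} {D : Proc K}
    (h : Typed Θ (.ofList Ss) D) (σ : ℕ → Datum K) : D.subst (liftSub Ss.length σ) = D := by
  refine Proc.subst_eq_self fun x hx => liftSub_var _ _ _ fun hn => ?_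
  have := h.fv x hx
  simp [Ctx.ent, Ctx.ofList, hn] at this

/-- Typing enters through the declarations: their bodies mention no variables but the parameters, so
the guardedness conditions on them are not disturbed. -/
theorem Typed.guardedDefs_subst {Θ : DefEnv K} {Γ : Ctx K} {P : Proc K} (h : Typed Θ Γ P) :
    P.GuardedDefs → ∀ σ, (P.subst σ).GuardedDefs := by
  induction h with
  | nil => exact fun h _ => h
  | par _ _ _ ih1 ih2 => exact fun h σ => ⟨ih1 h.1 σ, ih2 h.2 σ⟩
  | call => exact fun h _ => h
  | defn hD _ _ ih =>
    intro h σ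
    simp only [Proc.subst, hD.subst_params]
    exact ⟨h.1, h.2.1, h.2.2.1, ih h.2.2.2 σ⟩
  | branch _ _ _ _ _ ih =>
    intro h σ
    simp only [Proc.subst]
    split
    · exact fun i => ih i (h i) _
    · trivial
  | sel _ _ _ _ _ _ _ ih =>
    intro h σ
    simp only [Proc.subst]
    split
    · exact ih h σ
    · trivial
  | crashed => exact fun h _ => h
  | res _ _ _ ih => exact fun h σ => ih h _

theorem Typed.tame_subst {Θ : DefEnv K} {Γ : Ctx K} {P : Proc K} (h : Typed Θ Γ P)
    (hP : P.Tame) (σ : ℕ → Datum K) : (P.subst σ).Tame :=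
  ⟨h.guardedDefs_subst hP.1 σ, hP.2.subst σ⟩

/-- On the way to the call, its declaration is either met or not. A call index `X + d` below `d`
declarations refers to the free process variable `X`; an index `d₂` refers to the declaration just
outside `F₂`. -/
theorem Proc.exists_call : ∀ {P : Proc K}, 0 < P.ncalls →
    (∃ k d F X ds, Hole k d F ∧ P = F (.call (X + d) ds)) ∨
      ∃ k₁ d₁ F₁ Ss D k₂ d₂ F₂ ds, Hole k₁ d₁ F₁ ∧ Hole k₂ d₂ F₂ ∧
        P = F₁ (.defn Ss D (F₂ (.call d₂ ds)))
  | .nil, h => by simp [ncalls] at h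
  | .par P Q, h => by
      by_cases hP : 0 < P.ncalls
      · rcases exists_call hP with ⟨k, d, F, X, ds, hF, e⟩ |
          ⟨k₁, d₁, F₁, Ss, D, k₂, d₂, F₂, ds, hF₁, hF₂, e⟩
        · exact .inl ⟨k, d, _, X, ds, hF.parL Q, by simp only [← e]⟩
        · exact .inr ⟨k₁, d₁, _, Ss, D, k₂, d₂, F₂, ds, hF₁.parL Q, hF₂, by simp only [← e]⟩
      · have hQ : 0 < Q.ncalls := by simp only [ncalls] at h; omega
        rcases exists_call hQ with ⟨k, d, F, X, ds, hF, e⟩ |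
          ⟨k₁, d₁, F₁, Ss, D, k₂, d₂, F₂, ds, hF₁, hF₂, e⟩
        · exact .inl ⟨k, d, _, X, ds, hF.parR P, by simp only [← e]⟩
        · exact .inr ⟨k₁, d₁, _, Ss, D, k₂, d₂, F₂, ds, hF₁.parR P, hF₂, by simp only [← e]⟩
  | .res A P, h => by
      rcases exists_call (P := P) h with ⟨k, d, F, X, ds, hF, e⟩ |
        ⟨k₁, d₁, F₁, Ss, D, k₂, d₂, F₂, ds, hF₁, hF₂, e⟩
      · exact .inl ⟨_, d, _, X, ds, hF.res A, by simp only [← e]⟩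
      · exact .inr ⟨_, d₁, _, Ss, D, k₂, d₂, F₂, ds, hF₁.res A, hF₂, by simp only [← e]⟩
  | .defn Ss D P, h => by
      rcases exists_call (P := P) h with ⟨k, d, F, X, ds, hF, e⟩ |
        ⟨k₁, d₁, F₁, Ss', D', k₂, d₂, F₂, ds, hF₁, hF₂, e⟩
      · cases X with
        -- Index `0`, relative to the scope of this declaration, is bound by it.
        | zero => exact .inr ⟨_, _, _, Ss, D, k, d, F, ds, .top, hF, by simp only [e, Nat.zero_add]⟩
        | succ X =>
          refine .inl ⟨k, _, _, X, ds, hF.defn Ss D, ?_⟩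
          rw [e]; simp only [show X + 1 + d = X + (d + 1) by omega]
      · exact .inr ⟨_, _, _, Ss', D', k₂, d₂, F₂, ds, hF₁.defn Ss D, hF₂, by simp only [← e]⟩
  | .sel .., h => by simp [ncalls] at h
  | .branch .., h => by simp [ncalls] at h
  | .call X ds, _ => .inl ⟨0, 0, _, X, ds, .top, rfl⟩
  | .err, h => by simp [ncalls] at h
  | .crashed .., h => by simp [ncalls] at h

/-- Prefixes, errors and crashed endpoints. -/
def Proc.IsLeaf : Proc K → Prop
  | .sel .. => True
  | .branch .. => True
  | .err => True
  | .crashed .. => True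
  | _ => False

/-- Without leaves and unguarded calls, only parallel compositions, restrictions and declarations
around the inactive process remain, and congruence erases these. -/
theorem Proc.exists_leaf : ∀ {P : Proc K}, P.ncalls = 0 →
    Cong P .nil ∨ ∃ k d F L, Hole k d F ∧ P = F L ∧ L.IsLeaf
  | .nil, _ => .inl (.refl _)
  | .par P Q, h => by
      simp only [ncalls, Nat.add_eq_zero_iff] at h
      rcases exists_leaf h.1 with hP | ⟨k, d, F, L, hF, e, hL⟩
      · rcases exists_leaf h.2 with hQ | ⟨k, d, F, L, hF, e, hL⟩
        · exact .inl ((Cong.par hP hQ).trans (.parNil _))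
        · exact .inr ⟨k, d, _, L, hF.parR P, by simp only [← e], hL⟩
      · exact .inr ⟨k, d, _, L, hF.parL Q, by simp only [← e], hL⟩
  | .res A P, h => by
      rcases exists_leaf (P := P) h with hP | ⟨k, d, F, L, hF, e, hL⟩
      · exact .inl ((Cong.res hP).trans (.resElim A))
      · exact .inr ⟨_, d, _, L, hF.res A, by simp only [← e], hL⟩
  | .defn Ss D P, h => by
      rcases exists_leaf (P := P) h with hP | ⟨k, d, F, L, hF, e, hL⟩
      · exact .inl ((Cong.defn (.refl _) hP).trans (.defElim Ss D))
      · exact .inr ⟨k, _, _, L, hF.defn Ss D, by simp only [← e], hL⟩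
  | .sel .., _ => .inr ⟨_, _, _, _, .top, rfl, trivial⟩
  | .branch .., _ => .inr ⟨_, _, _, _, .top, rfl, trivial⟩
  | .call X ds, h => by simp [ncalls] at h
  | .err, _ => .inr ⟨_, _, _, _, .top, rfl, trivial⟩
  | .crashed .., _ => .inr ⟨_, _, _, _, .top, rfl, trivial⟩

-- Typing of the arguments of process calls

/-- Every channel among the arguments has an entry in `Γ`; so there are no variables and none of the
`k` innermost sessions, and the arguments are run-time values that can be moved out of `k`
restrictions. -/
theorem ArgsTyped.values {Γ : Ctx K} {ds : List (Datum K)} {Ss : List (Payload K)} (h : ArgsTyped Γ ds Ss) {k : ℕ}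
    (hv : ∀ x, Γ.var x = none) (hk : ∀ s p, s < k → Γ.ep s p = none) :
    ∃ ws : List (Value K), ds = ws.map (fun w => w.toDatum.renS (· + k)) ∧
      ArgsTyped (Γ.unshift k) (ws.map Value.toDatum) Ss := by
  induction h with
  | nil h => exact ⟨[], rfl, .nil (h.unshift k)⟩
  | @cons Γ Γ₁ Γ₂ d S ds Ss hs h1 h2 _ ih =>
    have hs' := hs
    obtain ⟨hs1, rfl⟩ := hs'
    have v1 : ∀ x, Γ₁.var x = none := fun x => by
      have := hv x; simp only [Ctx.union, Option.or_eq_none_iff] at this; exact this.1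
    have v2 : ∀ x, Γ₂.var x = none := fun x => by
      have := hv x; simp only [Ctx.union, Option.or_eq_none_iff] at this; exact this.2
    have e1 : ∀ s p, s < k → Γ₁.ep s p = none := fun s p h => by
      have := hk s p h; simp only [Ctx.union, Option.or_eq_none_iff] at this; exact this.1
    have e2 : ∀ s p, s < k → Γ₂.ep s p = none := fun s p h => by
      have := hk s p h; simp only [Ctx.union, Option.or_eq_none_iff] at this; exact this.2
    obtain ⟨ws, rfl, k2⟩ := ih v2 e2
    cases h1 with
    | @val v b h1 => exact ⟨.val v :: ws, rfl, .cons (hs.unshift k) (.val h1) h2 k2⟩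
    | @var x S' _ h1 =>
      have := v1 x
      simp [Ctx.singleVar] at this
    | @ep s p T S' h1 =>
      have hks : k ≤ s := by
        by_contra hlt
        have := e1 s p (by omega)
        simp [Ctx.singleEp] at this
      refine ⟨.ep (s - k) p :: ws, ?_, .cons (hs.unshift k) ?_ h2 k2⟩
      · simp [Value.toDatum, Datum.renS, Chan.renS, Nat.sub_add_cancel hks]
      · refine .of_isOne (S' := .sess T) ⟨?_, fun c hc => ?_⟩ h1
        · simp [Ctx.ent, Ctx.unshift, Ctx.singleEp, Nat.sub_add_cancel hks, UType.toEnt]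
        · rw [Ctx.ent_unshift]
          refine (Ctx.isOne_singleEp s p (.sess T)).2 _ fun e => hc ?_
          cases c with
          | var => cases e
          | ep s' p' =>
            simp only [Chan.renS, Chan.ep.injEq] at e
            obtain ⟨rfl, rfl⟩ := e
            simp

theorem ArgsTyped.image {Γ : Ctx K} {ds : List (Datum K)} {Ss : List (Payload K)} (h : ArgsTyped Γ ds Ss) :
    ∀ (i : ℕ) (S : Payload K), Ss[i]? = some S → ∃ d : Datum K, ds[i]? = some d ∧
      ((∃ v b, d = .val v ∧ S = .base b ∧ K.HasTy v b) ∨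
        ∃ c e, d = .chan c ∧ Γ.ent c = some e ∧ e.Le (some S)) := by
  induction h with
  | nil => simp
  | @cons Γ Γ₁ Γ₂ d S ds Ss hs h1 h2 _ ih =>
    intro i S' hS'
    cases i with
    | zero =>
      simp only [List.getElem?_cons_zero, Option.some.injEq] at hS'
      subst hS'
      refine ⟨d, rfl, ?_⟩
      cases d with
      | val v => cases h1 with | val h1 => exact .inl ⟨v, _, rfl, rfl, h1⟩
      | chan c =>
        obtain ⟨S', g1, g2⟩ := h1.isOne
        exact .inr ⟨c, _, rfl, (hs.left g1.1).1, .inr g2⟩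
    | succ i =>
      obtain ⟨d', g1, g2 | ⟨c, e, g2, g3, g4⟩⟩ := ih i S' (by simpa using hS')
      · exact ⟨d', by simpa using g1, .inl g2⟩
      · exact ⟨d', by simpa using g1, .inr ⟨c, e, g2, (hs.right g3).1, g4⟩⟩

theorem ArgsTyped.length_eq {Γ : Ctx K} {ds : List (Datum K)} {Ss : List (Payload K)} (h : ArgsTyped Γ ds Ss) :
    ds.length = Ss.length := by
  induction h with
  | nil => rfl
  | cons _ _ _ _ ih => simp [ih]

theorem ArgsTyped.ent_of_mem {Γ : Ctx K} {ds : List (Datum K)} {Ss : List (Payload K)} (h : ArgsTyped Γ ds Ss) {i : ℕ} {c : Chan K}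
    (hi : ds[i]? = some (.chan c)) : Γ.ent c ≠ none := by
  have hlt : i < Ss.length := by
    rw [← h.length_eq]
    exact (List.getElem?_eq_some_iff.1 hi).1
  obtain ⟨d, h1, ⟨v, b, rfl, -⟩ | ⟨c', e, rfl, h2, -⟩⟩ :=
    h.image i _ (List.getElem?_eq_getElem hlt)
  · rw [hi] at h1; cases h1
  · rw [hi] at h1; cases h1; simp [h2]

theorem ArgsTyped.inj {Γ : Ctx K} {ds : List (Datum K)} {Ss : List (Payload K)} (h : ArgsTyped Γ ds Ss) :
    ∀ (i j : ℕ) (c : Chan K), ds[i]? = some (.chan c) → ds[j]? = some (.chan c) → i = j := by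
  induction h with
  | nil => simp
  | @cons Γ Γ₁ Γ₂ d S ds Ss hs h1 h2 h3 ih =>
    have aux : ∀ (j : ℕ) (c : Chan K), d = .chan c → ds[j]? ≠ some (.chan c) := by
      rintro j c rfl hj
      obtain ⟨e, he⟩ := Option.ne_none_iff_exists'.1 (h3.ent_of_mem hj)
      obtain ⟨S', g1, -⟩ := h1.isOne
      have g2 := g1.1
      rw [(hs.right he).2] at g2
      cases g2
    intro i j c hi hj
    cases i with
    | zero =>
      cases j with
      | zero => rfl
      | succ j =>
        simp only [List.getElem?_cons_zero, List.getElem?_cons_succ, Option.some.injEq] at hi hj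
        exact absurd hj (aux j c hi)
    | succ i =>
      cases j with
      | zero =>
        simp only [List.getElem?_cons_zero, List.getElem?_cons_succ, Option.some.injEq] at hi hj
        exact absurd hi (aux i c hj)
      | succ j =>
        simp only [List.getElem?_cons_succ] at hi hj
        rw [ih i j c hi hj]

theorem ArgsTyped.cover {Γ : Ctx K} {ds : List (Datum K)} {Ss : List (Payload K)} (h : ArgsTyped Γ ds Ss) :
    ∀ c e, Γ.ent c = some e → ¬ e.Ended →
      ∃ (i : ℕ) (S : Payload K), Ss[i]? = some S ∧ ds[i]? = some (.chan c) ∧ ¬ S.Ended := by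
  induction h with
  | nil h => exact fun c e h1 h2 => absurd (Ctx.ended_iff.1 h c e h1) h2
  | @cons Γ Γ₁ Γ₂ d S ds Ss hs h1 h2 h3 ih =>
    intro c e he hn
    rcases hs.cases he with he | he
    · cases d with
      | val => cases h1 with | val => simp at he
      | chan c' =>
        obtain ⟨S', g1, g2⟩ := h1.isOne
        by_cases hc : c = c'
        · subst hc
          rw [g1.1] at he; cases he
          exact ⟨0, S, rfl, rfl, fun h => hn (Payload.Le.ended_left (.inr g2) h)⟩
        · rw [g1.2 _ hc] at he; cases he
    · obtain ⟨i, S', g1, g2, g3⟩ := ih c e he hn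
      exact ⟨i + 1, S', by simpa using g1, by simpa using g2, g3⟩

/-- Links calls to the substitution lemma: arguments have the types of the parameters (`image`), are
distinct channels (`inj`) and exhaust the entries that have to be used (`cover`). -/
theorem ArgsTyped.compat {Γ : Ctx K} {ws : List (Value K)} {Ss}
    (h : ArgsTyped Γ (ws.map Value.toDatum) Ss) :
    Compat (inst ws) {x | x < Ss.length} (.ofList Ss) Γ := by
  have hinst : ∀ x S, Ss[x]? = some S →
      (ws.map Value.toDatum)[x]? = some (inst ws x) := by
    intro x S hx
    obtain ⟨d, hd, -⟩ := h.image x S hx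
    rw [hd]
    simp only [List.getElem?_map, Option.map_eq_some_iff] at hd
    obtain ⟨w, hw, rfl⟩ := hd
    simp [inst, hw]
  have hent : ∀ c e, (Ctx.ofList Ss).ent c = some e → ∃ x S, c = .var x ∧ e = some S ∧
      Ss[x]? = some S := by
    intro c e he
    cases c with
    | ep => cases he
    | var x =>
      obtain ⟨S, hS, rfl⟩ := Ctx.ent_var.1 he
      exact ⟨x, S, rfl, rfl, hS⟩
  refine ⟨?_, ?_, ?_, ?_⟩
  · intro c e he hc
    obtain ⟨x, S, rfl, rfl, hS⟩ := hent c e he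
    refine absurd ?_ hc
    simpa [Chan.fv] using (List.getElem?_eq_some_iff.1 hS).1
  · intro c e he _ _
    obtain ⟨x, S, rfl, rfl, hS⟩ := hent c e he
    obtain ⟨d, h1, h2⟩ := h.image x S hS
    rw [hinst x S hS] at h1
    simp only [Option.some.injEq] at h1
    subst h1
    simpa [Chan.subst] using h2
  · intro c₁ e₁ c₂ e₂ c' h1 _ _ h2 _ _ h3 h4
    obtain ⟨x, S, rfl, rfl, hS⟩ := hent c₁ e₁ h1
    obtain ⟨y, S', rfl, rfl, hS'⟩ := hent c₂ e₂ h2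
    simp only [Chan.subst] at h3 h4
    rw [h.inj x y c' ((hinst x S hS).trans (by rw [h3])) ((hinst y S' hS').trans (by rw [h4]))]
  · intro c' e' h1 h2
    obtain ⟨i, S, h3, h4, h5⟩ := h.cover c' e' h1 h2
    refine ⟨.var i, some S, Ctx.ent_var.2 ⟨S, h3, rfl⟩, h5, ?_, ?_⟩
    · simpa [Chan.fv] using (List.getElem?_eq_some_iff.1 h3).1
    · rw [hinst i S h3] at h4
      simpa [Chan.subst] using h4

/-- The call cannot refer to a free process variable, as the environment is empty. It is extruded
from `F₂` to a position directly below its declaration, where the reduction rule applies. -/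
theorem Typed.exists_call_step {Γ : Ctx K} {P : Proc K} (h : Typed .empty Γ P)
    (hΓ : ∀ x, Γ.var x = none) (hP : P.Tame) (hn : 0 < P.ncalls) :
    ∃ P', Red P P' ∧ Typed .empty Γ P' ∧ P'.Tame ∧ P'.ncalls < P.ncalls := by
  rcases Proc.exists_call hn with ⟨k, d, F, X, ds, hF, rfl⟩ |
    ⟨k₁, d₁, F₁, Ss, D, k₂, d₂, F₂, ds, hF₁, hF₂, rfl⟩
  · obtain ⟨Θ', Γ₁, Γ₂, -, h2, h3, -⟩ := hF.typed h hP.2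
    cases h3 with
    | call h3 => rw [h2] at h3; cases h3
  · obtain ⟨Θ₁, Γ₁, Γ₂, h1, h2, h3, h4⟩ := hF₁.typed h hP.2
    obtain ⟨t1, t2⟩ := hF₁.tame hP
    have t3 : (F₂ (.call d₂ ds)).Tame := ⟨t1.1.2.2.2, t1.2.2⟩
    obtain ⟨t4, t5⟩ := hF₂.tame t3
    cases h3 with
    | defn hD h3 =>
      obtain ⟨Θ₂, G₁, G₂, g1, g2, g3, g4⟩ := hF₂.typed h3 t3.2
      cases g3 with
      | @call _ _ _ _ Ss' g5 g6 =>
        have := g2 0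
        rw [Nat.zero_add, g5] at this
        simp only [DefEnv.cons, Option.some.injEq] at this
        subst this
        -- Evaluation contexts bind no variables, so a variable among the entries used by the call
        -- would already be an entry of `Γ`.
        have hv : ∀ x, G₁.var x = none := by
          intro x
          by_contra hx
          obtain ⟨S, hS⟩ := Option.ne_none_iff_exists'.1 hx
          have e1 := (g1.left (Ctx.ent_var.2 ⟨S, hS, rfl⟩)).1
          rw [Ctx.ent_shift_var] at e1
          have := (h1.left e1).1
          obtain ⟨S', hS', -⟩ := Ctx.ent_var.1 this
          rw [hΓ] at hS'; cases hS'
        obtain ⟨ws, rfl, g7⟩ := g6.values (k := k₂) hv (fun s p hs => by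
          simp [Ctx.shift, Nat.not_le.2 hs])
        rw [Ctx.unshift_shift] at g7
        have hlen : ws.length = Ss'.length := by simpa using g7.length_eq
        have hsub := hD.subst g7.compat fun x hx => by
          by_contra hlt
          have := hD.fv x hx
          simp only [Set.mem_ofPred_eq, not_lt] at hlt
          simp [Ctx.ent, Ctx.ofList, hlt] at this
        -- What is left behind by the extruded call is typed by the rest of the context.
        have hnil : Typed (Θ₁.cons _) G₂ (F₂ .nil) := g4 G₂ .empty .nil
          (Ctx.Split.empty_right G₂).symm (.nil (Ctx.ended_iff.2 fun c e he => by
            cases c with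
            | var x => cases he
            | ep s p => simp [Ctx.ent, Ctx.shift, Ctx.empty] at he))
        refine ⟨F₁ (.defn _ D (.par (D.subst (inst ws)) (F₂ .nil))), hF₁.red ?_,
          h4 _ _ _ h1 (.defn hD (.par g1 hsub hnil)), t2 _ ?_, ?_⟩
        · have := hF₂.extrude (.call 0 (ws.map Value.toDatum))
          simp only [Proc.ren, Proc.renS, Proc.renX, List.map_map, Nat.zero_add] at this
          exact .cong (.defn (.refl _) this) (.call ws hlen) (.refl _)
        · have tD : (D.subst (inst ws)).Tame := hD.tame_subst ⟨t1.1.2.2.1, t1.2.1⟩ _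
          have tF := t5 .nil ⟨trivial, trivial⟩
          exact ⟨⟨t1.1.1, t1.1.2.1, t1.1.2.2.1, tD.1, tF.1⟩, t1.2.1, tD.2, tF.2⟩
        -- The instance of the body has no unguarded calls, so the count drops by one, for the
        -- resolved call.
        · rw [hF₁.ncalls, hF₁.ncalls (.defn _ _ _)]
          simp only [Proc.ncalls, Proc.CallsGuarded.ncalls_subst t1.1.1]
          rw [hF₂.ncalls (.call _ _)]
          simp only [Proc.ncalls]
          omega

/-! ### Occurrences of endpoints and structural congruence -/

namespace Proc

/-- The endpoint `s[p]` occurs free in the process, outside declared bodies. -/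
def Occ : Proc K → ℕ → K.Role → Prop
  | .nil, _, _ => False
  | .par P Q, s, p => P.Occ s p ∨ Q.Occ s p
  | .res _ P, s, p => P.Occ (s + 1) p
  | .sel c _ _ d P, s, p => (s, p) ∈ c.fc ∨ (s, p) ∈ d.fc ∨ P.Occ s p
  | .branch c _ _ _ P, s, p => (s, p) ∈ c.fc ∨ ∃ i, (P i).Occ s p
  | .defn _ _ P, s, p => P.Occ s p
  | .call _ ds, s, p => ∃ d ∈ ds, (s, p) ∈ d.fc
  | .err, _, _ => False
  | .crashed s' p', s, p => s = s' ∧ p = p'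

/-- The endpoint `s[p]` occurs outside selections and branchings as a crashed endpoint (if `b`) or
in a selection, branching or process call (if not `b`). -/
def Has (b : Bool) : Proc K → ℕ → K.Role → Prop
  | .nil, _, _ => False
  | .par P Q, s, p => P.Has b s p ∨ Q.Has b s p
  | .res _ P, s, p => P.Has b (s + 1) p
  | .sel c q l d P, s, p => b = false ∧ (sel c q l d P).Occ s p
  | .branch c q n lab P, s, p => b = false ∧ (branch c q n lab P).Occ s p
  | .defn _ _ P, s, p => P.Has b s p
  | .call X ds, s, p => b = false ∧ (call X ds).Occ s p
  | .err, _, _ => False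
  | .crashed s' p', s, p => b = true ∧ s = s' ∧ p = p'

/-- The endpoints of restricted sessions only occur as crashed endpoints, outside selections and
branchings. -/
def ResCrashed : Proc K → Prop
  | .par P Q => P.ResCrashed ∧ Q.ResCrashed
  | .res _ P => P.ResCrashed ∧ ∀ p, ¬ P.Has false 0 p
  | .defn _ _ P => P.ResCrashed
  | _ => True

/-- Nothing but crashed endpoints occurs outside declared bodies. -/
def Idle : Proc K → Prop
  | .nil => True
  | .par P Q => P.Idle ∧ Q.Idle
  | .res _ P => P.Idle
  | .defn _ _ P => P.Idle
  | .crashed _ _ => True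
  | _ => False

end Proc

theorem Chan.mem_fc_renS {c : Chan K} {ρ : ℕ → ℕ} {s p} :
    (s, p) ∈ (c.renS ρ).fc ↔ ∃ t, ρ t = s ∧ (t, p) ∈ c.fc := by
  cases c <;> simp [Chan.renS, Chan.fc]
  tauto

theorem Datum.mem_fc_renS {d : Datum K} {ρ : ℕ → ℕ} {s p} :
    (s, p) ∈ (d.renS ρ).fc ↔ ∃ t, ρ t = s ∧ (t, p) ∈ d.fc := by
  cases d
  · simp [Datum.renS, Datum.fc]
  · exact Chan.mem_fc_renS

theorem exists_liftRen_succ {ρ : ℕ → ℕ} {s : ℕ} {f : ℕ → Prop} :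
    (∃ t, liftRen ρ t = s + 1 ∧ f t) ↔ ∃ t, ρ t = s ∧ f (t + 1) := by
  constructor
  · rintro ⟨_ | t, h, hf⟩
    · simp [liftRen] at h
    · exact ⟨t, by simpa [liftRen] using h, hf⟩
  · rintro ⟨t, h, hf⟩
    exact ⟨t + 1, by simp [liftRen, h], hf⟩

theorem exists_liftRen_zero {ρ : ℕ → ℕ} {f : ℕ → Prop} :
    (∃ t, liftRen ρ t = 0 ∧ f t) ↔ f 0 := by
  constructor
  · rintro ⟨_ | t, h, hf⟩
    · exact hf
    · simp [liftRen] at h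
  · exact fun h => ⟨0, rfl, h⟩

namespace Proc

theorem occ_renS : ∀ (P : Proc K) (ρ : ℕ → ℕ) (s : ℕ) (p : K.Role),
    (P.renS ρ).Occ s p ↔ ∃ t, ρ t = s ∧ P.Occ t p
  | .nil, _, _, _ => by simp [renS, Occ]
  | .par P Q, ρ, s, p => by
      simp only [renS, Occ, occ_renS P, occ_renS Q, ← exists_or, ← and_or_left]
  | .res A P, ρ, s, p => by
      simp only [renS, Occ, occ_renS P]
      exact exists_liftRen_succ (f := fun t => P.Occ t p)
  | .sel c q l d P, ρ, s, p => by
      simp only [renS, Occ, occ_renS P, Chan.mem_fc_renS, Datum.mem_fc_renS, ← exists_or,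
        ← and_or_left]
  | .branch c q n lab P, ρ, s, p => by
      simp only [renS, Occ, fun i => occ_renS (P i), Chan.mem_fc_renS]
      constructor
      · rintro (⟨t, h, h'⟩ | ⟨i, t, h, h'⟩)
        exacts [⟨t, h, .inl h'⟩, ⟨t, h, .inr ⟨i, h'⟩⟩]
      · rintro ⟨t, h, h' | ⟨i, h'⟩⟩
        exacts [.inl ⟨t, h, h'⟩, .inr ⟨i, t, h, h'⟩]
  | .defn Ss D P, ρ, s, p => by simp only [renS, Occ, occ_renS P]
  | .call X ds, ρ, s, p => by
      simp only [renS, Occ, List.mem_map]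
      constructor
      · rintro ⟨_, ⟨d, hd, rfl⟩, h⟩
        obtain ⟨t, h1, h2⟩ := Datum.mem_fc_renS.1 h
        exact ⟨t, h1, d, hd, h2⟩
      · rintro ⟨t, h1, d, hd, h2⟩
        exact ⟨_, ⟨d, hd, rfl⟩, Datum.mem_fc_renS.2 ⟨t, h1, h2⟩⟩
  | .err, _, _, _ => by simp [renS, Occ]
  | .crashed s' p', ρ, s, p => by
      simp only [renS, Occ]
      constructor
      · rintro ⟨rfl, rfl⟩; exact ⟨s', rfl, rfl, rfl⟩
      · rintro ⟨t, rfl, rfl, rfl⟩; exact ⟨rfl, rfl⟩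

theorem occ_renX : ∀ (P : Proc K) (χ : ℕ → ℕ) (s : ℕ) (p : K.Role),
    (P.renX χ).Occ s p ↔ P.Occ s p
  | .nil, _, _, _ => Iff.rfl
  | .par P Q, χ, s, p => by simp only [renX, Occ, occ_renX P, occ_renX Q]
  | .res A P, χ, s, p => by simp only [renX, Occ, occ_renX P]
  | .sel c q l d P, χ, s, p => by simp only [renX, Occ, occ_renX P]
  | .branch c q n lab P, χ, s, p => by simp only [renX, Occ, fun i => occ_renX (P i)]
  | .defn Ss D P, χ, s, p => by simp only [renX, Occ, occ_renX P]
  | .call X ds, χ, s, p => Iff.rfl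
  | .err, _, _, _ => Iff.rfl
  | .crashed .., _, _, _ => Iff.rfl

theorem has_renS (b : Bool) : ∀ (P : Proc K) (ρ : ℕ → ℕ) (s : ℕ) (p : K.Role),
    (P.renS ρ).Has b s p ↔ ∃ t, ρ t = s ∧ P.Has b t p
  | .nil, _, _, _ => by simp [renS, Has]
  | .par P Q, ρ, s, p => by
      simp only [renS, Has, has_renS b P, has_renS b Q, ← exists_or, ← and_or_left]
  | .res A P, ρ, s, p => by
      simp only [renS, Has, has_renS b P]
      exact exists_liftRen_succ (f := fun t => P.Has b t p)
  | .sel c q l d P, ρ, s, p => by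
      have := occ_renS (.sel c q l d P) ρ s p
      simp only [renS] at this
      simp only [renS, Has, this, and_left_comm, exists_and_left]
  | .branch c q n lab P, ρ, s, p => by
      have := occ_renS (.branch c q n lab P) ρ s p
      simp only [renS] at this
      simp only [renS, Has, this, and_left_comm, exists_and_left]
  | .defn Ss D P, ρ, s, p => by simp only [renS, Has, has_renS b P]
  | .call X ds, ρ, s, p => by
      have := occ_renS (.call X ds) ρ s p
      simp only [renS] at this
      simp only [renS, Has, this, and_left_comm, exists_and_left]
  | .err, _, _, _ => by simp [renS, Has]
  | .crashed s' p', ρ, s, p => by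
      have := occ_renS (.crashed s' p') ρ s p
      simp only [renS, Occ] at this
      simp only [renS, Has, this, and_left_comm, exists_and_left]

theorem has_renX (b : Bool) : ∀ (P : Proc K) (χ : ℕ → ℕ) (s : ℕ) (p : K.Role),
    (P.renX χ).Has b s p ↔ P.Has b s p
  | .nil, _, _, _ => Iff.rfl
  | .par P Q, χ, s, p => by simp only [renX, Has, has_renX b P, has_renX b Q]
  | .res A P, χ, s, p => by simp only [renX, Has, has_renX b P]
  | .sel c q l d P, χ, s, p => by simp only [renX, Has, Occ, occ_renX P]
  | .branch c q n lab P, χ, s, p => by simp only [renX, Has, Occ, fun i => occ_renX (P i)]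
  | .defn Ss D P, χ, s, p => by simp only [renX, Has, has_renX b P]
  | .call X ds, χ, s, p => Iff.rfl
  | .err, _, _, _ => Iff.rfl
  | .crashed .., _, _, _ => Iff.rfl

theorem resCrashed_renS : ∀ (P : Proc K) (ρ : ℕ → ℕ), (P.renS ρ).ResCrashed ↔ P.ResCrashed
  | .par P Q, ρ => by simp only [renS, ResCrashed, resCrashed_renS P, resCrashed_renS Q]
  | .res A P, ρ => by
      simp only [renS, ResCrashed, resCrashed_renS P, has_renS]
      refine and_congr_right fun _ => forall_congr' fun p => not_congr ?_
      exact exists_liftRen_zero (f := fun t => P.Has false t p)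
  | .defn Ss D P, ρ => by simp only [renS, ResCrashed, resCrashed_renS P]
  | .nil, _ | .sel .., _ | .branch .., _ | .call .., _ | .err, _ | .crashed .., _ => Iff.rfl

theorem resCrashed_renX : ∀ (P : Proc K) (χ : ℕ → ℕ), (P.renX χ).ResCrashed ↔ P.ResCrashed
  | .par P Q, χ => by simp only [renX, ResCrashed, resCrashed_renX P, resCrashed_renX Q]
  | .res A P, χ => by simp only [renX, ResCrashed, resCrashed_renX P, has_renX]
  | .defn Ss D P, χ => by simp only [renX, ResCrashed, resCrashed_renX P]
  | .nil, _ | .sel .., _ | .branch .., _ | .call .., _ | .err, _ | .crashed .., _ => Iff.rfl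

theorem idle_renS : ∀ (P : Proc K) (ρ : ℕ → ℕ), (P.renS ρ).Idle ↔ P.Idle
  | .par P Q, ρ => by simp only [renS, Idle, idle_renS P, idle_renS Q]
  | .res A P, ρ => by simp only [renS, Idle, idle_renS P]
  | .defn Ss D P, ρ => by simp only [renS, Idle, idle_renS P]
  | .nil, _ | .sel .., _ | .branch .., _ | .call .., _ | .err, _ | .crashed .., _ => Iff.rfl

theorem idle_renX : ∀ (P : Proc K) (χ : ℕ → ℕ), (P.renX χ).Idle ↔ P.Idle
  | .par P Q, χ => by simp only [renX, Idle, idle_renX P, idle_renX Q]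
  | .res A P, χ => by simp only [renX, Idle, idle_renX P]
  | .defn Ss D P, χ => by simp only [renX, Idle, idle_renX P]
  | .nil, _ | .sel .., _ | .branch .., _ | .call .., _ | .err, _ | .crashed .., _ => Iff.rfl

end Proc

theorem occ_bigPar_crashed (ps : List K.Role) (s : ℕ) (p : K.Role) :
    ¬ (bigPar (ps.map (Proc.crashed 0))).Occ (s + 1) p := by
  induction ps with
  | nil => exact fun h => h
  | cons q ps ih =>
    rintro (⟨h, -⟩ | h)
    · cases h
    · exact ih h

theorem has_bigPar_crashed (b : Bool) (ps : List K.Role) (s : ℕ) (p : K.Role) :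
    ¬ (bigPar (ps.map (Proc.crashed 0))).Has b (s + 1) p := by
  induction ps with
  | nil => exact fun h => h
  | cons q ps ih =>
    rintro (⟨-, h, -⟩ | h)
    · cases h
    · exact ih h

theorem resCrashed_bigPar_crashed (ps : List K.Role) :
    (bigPar (ps.map (Proc.crashed 0))).ResCrashed ∧
      ∀ p, ¬ (bigPar (ps.map (Proc.crashed 0))).Has false 0 p := by
  induction ps with
  | nil => exact ⟨trivial, fun p h => h⟩
  | cons q ps ih =>
    refine ⟨⟨trivial, ih.1⟩, fun p => ?_⟩
    rintro (⟨h, -⟩ | h)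
    · cases h
    · exact ih.2 p h

theorem idle_bigPar_crashed (ps : List K.Role) :
    (bigPar (ps.map (Proc.crashed 0))).Idle := by
  induction ps with
  | nil => trivial
  | cons q ps ih => exact ⟨trivial, ih⟩

theorem exists_succ_eq {s : ℕ} {f : ℕ → Prop} : (∃ t, Nat.succ t = s + 1 ∧ f t) ↔ f s :=
  ⟨fun ⟨_, h, hf⟩ => Nat.succ.inj h ▸ hf, fun h => ⟨s, rfl, h⟩⟩

theorem exists_swapRen_eq {s : ℕ} {f : ℕ → Prop} : (∃ t, swapRen t = s ∧ f t) ↔ f (swapRen s) := by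
  have inv : ∀ t, swapRen (swapRen t) = t := fun t => by
    rcases t with _ | _ | t <;> rfl
  exact ⟨fun ⟨t, h, hf⟩ => h ▸ (inv t).symm ▸ hf, fun h => ⟨swapRen s, inv s, h⟩⟩

/-- Declared bodies have to be ignored for this invariance, since `defElim` erases them together
with the endpoints that they contain. -/
theorem Cong.occ {P Q : Proc K} (h : Cong P Q) : ∀ s p, P.Occ s p ↔ Q.Occ s p := by
  induction h with
  | refl => exact fun _ _ => Iff.rfl
  | symm _ ih => exact fun s p => (ih s p).symm
  | trans _ _ ih1 ih2 => exact fun s p => (ih1 s p).trans (ih2 s p)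
  | par _ _ ih1 ih2 => exact fun s p => or_congr (ih1 s p) (ih2 s p)
  | res _ ih => exact fun s p => ih (s + 1) p
  | sel _ ih => exact fun s p => or_congr_right (or_congr_right (ih s p))
  | branch _ ih => exact fun s p => or_congr_right (exists_congr fun i => ih i s p)
  | defn _ _ _ ih => exact ih
  | parComm => exact fun _ _ => or_comm
  | parAssoc => exact fun _ _ => or_assoc
  | parNil => exact fun _ _ => iff_of_eq (or_false _)
  | resElim => exact fun _ _ => Iff.rfl
  | resSwap A A' P =>
    intro s p
    simp only [Proc.Occ, Proc.occ_renS]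
    exact (exists_swapRen_eq (s := s + 1 + 1) (f := fun t => P.Occ t p)).symm
  | resLift A P Q =>
    intro s p
    simp only [Proc.Occ, Proc.occ_renS]
    exact or_congr_left (exists_succ_eq (f := fun t => P.Occ t p))
  | crashElim A ps => exact fun s p => iff_false_intro (occ_bigPar_crashed ps s p)
  | defElim => exact fun _ _ => Iff.rfl
  | defLift => exact fun _ _ => Iff.rfl
  | defParLift => exact fun s p => or_congr_right (Proc.occ_renX _ _ s p)
  | defOrd Ss D Ss' D' P => exact fun s p => (Proc.occ_renX P _ s p).symm

/-- Congruence never moves a name across a prefix, so it preserves both the endpoints that occur and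
whether they occur as crashed outside prefixes; below prefixes `Cong.occ` is used. -/
theorem Cong.has (b : Bool) {P Q : Proc K} (h : Cong P Q) :
    ∀ s p, P.Has b s p ↔ Q.Has b s p := by
  induction h with
  | refl => exact fun _ _ => Iff.rfl
  | symm _ ih => exact fun s p => (ih s p).symm
  | trans _ _ ih1 ih2 => exact fun s p => (ih1 s p).trans (ih2 s p)
  | par _ _ ih1 ih2 => exact fun s p => or_congr (ih1 s p) (ih2 s p)
  | res _ ih => exact fun s p => ih (s + 1) p
  | sel h _ => exact fun s p => and_congr_right fun _ => (Cong.sel h).occ s p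
  | branch h _ => exact fun s p => and_congr_right fun _ => (Cong.branch h).occ s p
  | defn _ _ _ ih => exact ih
  | parComm => exact fun _ _ => or_comm
  | parAssoc => exact fun _ _ => or_assoc
  | parNil => exact fun _ _ => iff_of_eq (or_false _)
  | resElim => exact fun _ _ => Iff.rfl
  | resSwap A A' P =>
    intro s p
    simp only [Proc.Has, Proc.has_renS]
    exact (exists_swapRen_eq (s := s + 1 + 1) (f := fun t => P.Has b t p)).symm
  | resLift A P Q =>
    intro s p
    simp only [Proc.Has, Proc.has_renS]
    exact or_congr_left (exists_succ_eq (f := fun t => P.Has b t p))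
  | crashElim A ps => exact fun s p => iff_false_intro (has_bigPar_crashed b ps s p)
  | defElim => exact fun _ _ => Iff.rfl
  | defLift => exact fun _ _ => Iff.rfl
  | defParLift => exact fun s p => or_congr_right (Proc.has_renX b _ _ s p)
  | defOrd Ss D Ss' D' P => exact fun s p => (Proc.has_renX b P _ s p).symm

/-- This replaces `ResEnded`, which congruence does not preserve: annotations play no role in it,
and `crashElim` introduces crashed endpoints of restricted sessions. -/
theorem Cong.resCrashed {P Q : Proc K} (h : Cong P Q) : P.ResCrashed ↔ Q.ResCrashed := by
  induction h with
  | refl => exact Iff.rfl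
  | symm _ ih => exact ih.symm
  | trans _ _ ih1 ih2 => exact ih1.trans ih2
  | par _ _ ih1 ih2 => exact and_congr ih1 ih2
  | res h ih => exact and_congr ih (forall_congr' fun p => not_congr (h.has false 0 p))
  | sel => exact Iff.rfl
  | branch => exact Iff.rfl
  | defn _ _ _ ih => exact ih
  | parComm => exact and_comm
  | parAssoc => exact and_assoc
  | parNil => exact iff_of_eq (and_true _)
  | resElim => exact iff_true_intro ⟨trivial, fun _ h => h⟩
  | resSwap A A' P =>
    simp only [Proc.ResCrashed, Proc.resCrashed_renS, Proc.Has, Proc.has_renS]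
    have : ∀ s p, (∃ t, swapRen t = s ∧ P.Has false t p) ↔ P.Has false (swapRen s) p :=
      fun s p => exists_swapRen_eq (f := fun t => P.Has false t p)
    have e0 : swapRen 0 = 0 + 1 := rfl
    have e1 : swapRen (0 + 1) = 0 := rfl
    simp only [this, e0, e1]
    tauto
  | resLift A P Q =>
    simp only [Proc.ResCrashed, Proc.resCrashed_renS, Proc.Has, Proc.has_renS]
    have : ∀ p, ¬ ∃ t, Nat.succ t = 0 ∧ P.Has false t p := by
      rintro p ⟨t, h, -⟩; cases h
    simp only [this, false_or]
    exact and_assoc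
  | crashElim A ps => exact iff_true_intro (resCrashed_bigPar_crashed ps)
  | defElim => exact Iff.rfl
  | defLift => exact Iff.rfl
  | defParLift => exact and_congr_right fun _ => Proc.resCrashed_renX _ _
  | defOrd Ss D Ss' D' P => exact (Proc.resCrashed_renX P _).symm

/-- Shows that a process congruent to the inactive one contains no prefix, call or error outside
declared bodies. -/
theorem Cong.idle {P Q : Proc K} (h : Cong P Q) : P.Idle ↔ Q.Idle := by
  induction h with
  | refl => exact Iff.rfl
  | symm _ ih => exact ih.symm
  | trans _ _ ih1 ih2 => exact ih1.trans ih2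
  | par _ _ ih1 ih2 => exact and_congr ih1 ih2
  | res h ih => exact ih
  | sel => exact Iff.rfl
  | branch => exact Iff.rfl
  | defn _ _ _ ih => exact ih
  | parComm => exact and_comm
  | parAssoc => exact and_assoc
  | parNil => exact iff_of_eq (and_true _)
  | resElim => exact Iff.rfl
  | resSwap A A' P => exact (Proc.idle_renS P _).symm
  | resLift A P Q => exact and_congr_left fun _ => Proc.idle_renS _ _
  | crashElim A ps => exact iff_true_intro (idle_bigPar_crashed ps)
  | defElim => exact Iff.rfl
  | defLift => exact Iff.rfl
  | defParLift => exact and_congr_right fun _ => Proc.idle_renX _ _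
  | defOrd Ss D Ss' D' P => exact (Proc.idle_renX P _).symm

/-! ### Occurrences of endpoints in typed processes -/

theorem Proc.Occ.mem_fc : ∀ {P : Proc K} {s p}, P.Occ s p → (s, p) ∈ P.fc
  | .nil, _, _, h => h
  | .par _ _, _, _, h => h.imp Occ.mem_fc Occ.mem_fc
  | .res _ P, _, _, h => Occ.mem_fc (P := P) h
  | .sel c q l d P, _, _, h => by
      rcases h with h | h | h
      exacts [.inl (.inl h), .inl (.inr h), .inr (Occ.mem_fc h)]
  | .branch c q n lab P, _, _, h => by
      rcases h with h | ⟨i, h⟩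
      exacts [.inl h, .inr (Set.mem_iUnion.2 ⟨i, Occ.mem_fc h⟩)]
  | .defn Ss D P, _, _, h => .inr (Occ.mem_fc (P := P) h)
  | .call X ds, _, _, h => h
  | .err, _, _, h => h
  | .crashed s' p', s, p, h => by
      obtain ⟨rfl, rfl⟩ := h
      exact rfl

theorem Proc.Has.occ {b : Bool} : ∀ {P : Proc K} {s p}, P.Has b s p → P.Occ s p
  | .nil, _, _, h => h
  | .par _ _, _, _, h => h.imp Has.occ Has.occ
  | .res _ P, _, _, h => Has.occ (P := P) h
  | .sel .., _, _, h => h.2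
  | .branch .., _, _, h => h.2
  | .defn _ _ P, _, _, h => Has.occ (P := P) h
  | .call .., _, _, h => h.2
  | .err, _, _, h => h
  | .crashed .., _, _, h => h.2

theorem DTyped.mem_fc {Γ : Ctx K} {d S s p e} (h : DTyped Γ d S)
    (he : Γ.ent (.ep s p) = some e) : (s, p) ∈ d.fc := by
  cases d with
  | val => cases h with | val => cases he
  | chan c =>
    obtain ⟨S', h1, -⟩ := h.isOne
    by_cases hc : .ep s p = c
    · subst hc; exact rfl
    · rw [h1.2 _ hc] at he; cases he

/-- Linearity: the typing rules discard an entry only if it is basic or terminated. -/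
theorem Typed.occ {Θ : DefEnv K} {Γ : Ctx K} {P : Proc K} (h : Typed Θ Γ P) :
    ∀ s p e, Γ.ent (.ep s p) = some e → ¬ e.Ended → P.Occ s p := by
  induction h with
  | nil h => exact fun s p e he hn => absurd (Ctx.ended_iff.1 h _ _ he) hn
  | par hs _ _ ih1 ih2 =>
    intro s p e he hn
    exact (hs.cases he).imp (ih1 s p e · hn) (ih2 s p e · hn)
  | call _ h =>
    intro s p e he hn
    obtain ⟨i, S, -, h2, -⟩ := h.cover _ e he hn
    exact ⟨_, List.mem_of_getElem? h2, rfl⟩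
  | defn _ _ _ ih => exact ih
  | branch Γc hs hc hΓc _ ih =>
    intro s p e he hn
    rcases hs.cases he with he | he
    -- The index set of a branching is non-empty, so branch `0` serves as a witness.
    · exact .inr ⟨0, ih 0 s p e ((hΓc 0).left he).1 hn⟩
    · exact .inl (hc.mem_fc he)
  | sel hs hs' hc hd _ hΓc _ ih =>
    intro s p e he hn
    rcases hs.cases he with he | he
    · rcases hs'.cases he with he | he
      · exact .inr (.inr (ih s p e (hΓc.left he).1 hn))
      · exact .inl (hc.mem_fc he)
    · exact .inr (.inl (hd.mem_fc he))
  | @crashed Θ Γ Γ₀ s' p' hs h0 =>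
    intro s p e he hn
    by_cases hc : (.ep s p : Chan K) = .ep s' p'
    · cases hc; exact ⟨rfl, rfl⟩
    · rw [((Ctx.isOne_singleEp s' p' .crashed).split hs).2.2 _ hc] at he
      exact absurd (Ctx.ended_iff.1 h0 _ _ he) hn
  | res _ _ _ ih => exact fun s p e he hn => ih (s + 1) p e he hn

/-- The entries that have to be used occur outside selections and branchings, unless the process
is crashed. -/
theorem Typed.has : ∀ {P : Proc K} {Θ : DefEnv K} {Γ : Ctx K}, Typed Θ Γ P →
    ∀ {s p e}, Γ.ent (.ep s p) = some e → ¬ e.Ended →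
      P.Has false s p ∨ (P.Has true s p ∧ e = none)
  | .nil, _, _, h, _, _, _, he, hn => absurd (h.occ _ _ _ he hn) id
  | .par P Q, _, _, h, _, _, _, he, hn => by
      cases h with
      | par hs h1 h2 =>
        rcases hs.cases he with he | he
        · exact (Typed.has h1 he hn).imp .inl fun h => ⟨.inl h.1, h.2⟩
        · exact (Typed.has h2 he hn).imp .inr fun h => ⟨.inr h.1, h.2⟩
  | .res A P, _, _, h, s, p, e, he, hn => by
      cases h with
      | res R hs h1 => exact Typed.has (P := P) h1 (s := s + 1) he hn
  | .sel .., _, _, h, _, _, _, he, hn => .inl ⟨rfl, h.occ _ _ _ he hn⟩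
  | .branch .., _, _, h, _, _, _, he, hn => .inl ⟨rfl, h.occ _ _ _ he hn⟩
  | .defn Ss D P, _, _, h, _, _, _, he, hn => by
      cases h with
      | defn _ h1 => exact Typed.has (P := P) h1 he hn
  | .call .., _, _, h, _, _, _, he, hn => .inl ⟨rfl, h.occ _ _ _ he hn⟩
  | .err, _, _, h, _, _, _, he, hn => absurd (h.occ _ _ _ he hn) id
  | .crashed s' p', _, _, h, s, p, e, he, hn => by
      obtain ⟨rfl, rfl⟩ := h.occ _ _ _ he hn
      cases h with
      | crashed hs h0 =>
        rw [((Ctx.isOne_singleEp s p .crashed).split hs).1] at he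
        exact .inr ⟨⟨rfl, rfl, rfl⟩, (Option.some.inj he).symm⟩

/-- Read backwards: as long as `s[p]` is not crashed in the context, no process congruent to `P`
exhibits it as a crashed endpoint. This is how reliability of reducts is shown. -/
theorem Typed.ent_of_has : ∀ {P : Proc K} {Θ : DefEnv K} {Γ : Ctx K}, Typed Θ Γ P →
    ∀ {s p}, P.Has true s p → Γ.ent (.ep s p) = some none
  | .nil, _, _, _, _, _, hh => absurd hh id
  | .par P Q, _, _, h, _, _, hh => by
      cases h with
      | par hs h1 h2 =>
        rcases hh with hh | hh
        · exact (hs.left (Typed.ent_of_has h1 hh)).1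
        · exact (hs.right (Typed.ent_of_has h2 hh)).1
  | .res A P, _, _, h, s, p, hh => by
      cases h with
      | res R hs h1 => exact Typed.ent_of_has (P := P) h1 hh
  | .sel .., _, _, _, _, _, hh => by cases hh.1
  | .branch .., _, _, _, _, _, hh => by cases hh.1
  | .defn Ss D P, _, _, h, _, _, hh => by
      cases h with
      | defn _ h1 => exact Typed.ent_of_has (P := P) h1 hh
  | .call .., _, _, _, _, _, hh => by cases hh.1
  | .err, _, _, _, _, _, hh => absurd hh id
  | .crashed s' p', _, _, h, s, p, hh => by
      obtain ⟨-, rfl, rfl⟩ := hh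
      cases h with
      | crashed hs h0 => exact ((Ctx.isOne_singleEp s p .crashed).split hs).1

theorem Typed.var_ended_of_idle : ∀ {P : Proc K} {Θ : DefEnv K} {Γ : Ctx K}, Typed Θ Γ P →
    P.Idle → ∀ {x e}, Γ.ent (.var x) = some e → e.Ended
  | .nil, _, _, h, _, _, _, he => by
      cases h with
      | nil h => exact Ctx.ended_iff.1 h _ _ he
  | .par P Q, _, _, h, hI, _, _, he => by
      cases h with
      | par hs h1 h2 =>
        rcases hs.cases he with he | he
        · exact Typed.var_ended_of_idle h1 hI.1 he
        · exact Typed.var_ended_of_idle h2 hI.2 he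
  | .res A P, _, _, h, hI, x, e, he => by
      cases h with
      | res R hs h1 => exact Typed.var_ended_of_idle (P := P) h1 hI (x := x) he
  | .sel .., _, _, _, hI, _, _, _ => absurd hI id
  | .branch .., _, _, _, hI, _, _, _ => absurd hI id
  | .defn Ss D P, _, _, h, hI, _, _, he => by
      cases h with
      | defn _ h1 => exact Typed.var_ended_of_idle (P := P) h1 hI he
  | .call .., _, _, _, hI, _, _, _ => absurd hI id
  | .err, _, _, _, hI, _, _, _ => absurd hI id
  | .crashed s' p', _, _, h, _, x, e, he => by
      cases h with
      | crashed hs h0 =>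
        rw [((Ctx.isOne_singleEp s' p' .crashed).split hs).2.2 _ (by simp)] at he
        exact Ctx.ended_iff.1 h0 _ _ he

theorem Proc.Idle.not_has : ∀ {P : Proc K} {s p}, P.Idle → ¬ P.Has false s p
  | .nil, _, _, _ => id
  | .par P Q, _, _, hI => fun h => h.elim (Idle.not_has hI.1) (Idle.not_has hI.2)
  | .res A P, _, _, hI => Idle.not_has (P := P) hI
  | .sel .., _, _, hI => absurd hI id
  | .branch .., _, _, hI => absurd hI id
  | .defn Ss D P, _, _, hI => Idle.not_has (P := P) hI
  | .call .., _, _, hI => absurd hI id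
  | .err, _, _, hI => absurd hI id
  | .crashed s' p', _, _, _ => fun h => by cases h.1

/-- Inactive processes are typed by terminated contexts. -/
theorem Typed.ended_of_cong_nil {Θ : DefEnv K} {Γ : Ctx K} {P : Proc K} (h : Typed Θ Γ P)
    (hP : Cong P .nil) : Γ.Ended := by
  have hI : P.Idle := hP.idle.2 trivial
  refine Ctx.ended_iff.2 fun c e he => ?_
  cases c with
  | var x => exact h.var_ended_of_idle hI he
  | ep s p =>
    by_contra hn
    -- A live use of `s[p]` contradicts idleness; a crashed one would, by congruence, also be
    -- present in the inactive process.
    rcases h.has he hn with h' | ⟨h', -⟩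
    · exact hI.not_has h'
    · exact (hP.has true s p).1 h'

/-- Endpoints that occur have entries that are not terminated (`Typed.fc`), whereas all entries of
restricted sessions are terminated here. -/
theorem Typed.resCrashed : ∀ {P : Proc K} {Θ : DefEnv K} {Γ : Ctx K}, Typed Θ Γ P →
    P.ResEnded → P.ResCrashed
  | .par P Q, _, _, h, hR => by
      cases h with
      | par _ h1 h2 => exact ⟨Typed.resCrashed h1 hR.1, Typed.resCrashed h2 hR.2⟩
  | .res A P, _, _, h, hR => by
      cases h with
      | res R _ h1 =>
        refine ⟨Typed.resCrashed h1 hR.2, fun p hp => ?_⟩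
        obtain ⟨e, he, hn⟩ := h1.fc 0 p hp.occ.mem_fc
        exact hn (Ctx.ended_iff.1 hR.1 (.ep 0 p) e he)
  | .defn Ss D P, _, _, h, hR => by
      cases h with
      | defn _ h1 => exact Typed.resCrashed (P := P) h1 hR.2
  | .nil, _, _, _, _ | .sel .., _, _, _, _ | .branch .., _, _, _, _ | .call .., _, _, _, _
  | .err, _, _, _, _ | .crashed .., _, _, _, _ => trivial

/-! ### Transitions of typing contexts -/

namespace Ctx

/-- The endpoint `s[p]` has a session type that unfolds to `H`. -/
def HasHead (Γ : Ctx K) (s : ℕ) (p : K.Role) (H : SType K) : Prop :=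
  ∃ T, Γ.ep s p = some (.sess T) ∧ T.Head H

def CanOut (Γ : Ctx K) (s : ℕ) (p q : K.Role) (l : K.Lab) (S : Payload K) : Prop :=
  ∃ n lab pay cont, ∃ k : Fin (n + 1), Γ.HasHead s p (.int q n lab pay cont) ∧ lab k = l ∧
    pay k = S

def CanInp (Γ : Ctx K) (s : ℕ) (p q : K.Role) (l : Label K) (S : Payload K) : Prop :=
  ∃ n lab pay cont, ∃ k : Fin (n + 1), Γ.HasHead s p (.ext q n lab pay cont) ∧ lab k = l ∧
    pay k = S

/-- The conditions on the entries of a context under which it has a transition. -/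
def CanAct (Γ : Ctx K) : Act K → Prop
  | .out s p q l S => Γ.CanOut s p q l S
  | .inp s p q l S => Γ.CanInp s p q l S
  | .comm s p q l => ∃ S, Γ.CanOut s p q l S ∧
      ((∃ S', Γ.CanInp s q p (.msg l) S' ∧ S.Sub S') ∨ Γ.ep s q = some .crashed)
  | .crash s p => ∃ T, Γ.ep s p = some (.sess T) ∧ ¬ (Payload.sess T).Sub (.sess .done)
  | .detect s q p => Γ.CanInp s q p .crash (.base K.unitTy) ∧ Γ.ep s p = some .crashed
  | .stopped s p => Γ.ep s p = some .crashed

theorem HasHead.mono {Γ Δ : Ctx K} (h : ∀ s p U, Γ.ep s p = some U → Δ.ep s p = some U)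
    {s p H} (hΓ : Γ.HasHead s p H) : Δ.HasHead s p H :=
  let ⟨T, h1, h2⟩ := hΓ
  ⟨T, h _ _ _ h1, h2⟩

theorem CanOut.mono {Γ Δ : Ctx K} (h : ∀ s p H, Γ.HasHead s p H → Δ.HasHead s p H)
    {s p q l S} (hΓ : Γ.CanOut s p q l S) : Δ.CanOut s p q l S :=
  let ⟨n, lab, pay, cont, k, h1, h2⟩ := hΓ
  ⟨n, lab, pay, cont, k, h _ _ _ h1, h2⟩

theorem CanInp.mono {Γ Δ : Ctx K} (h : ∀ s p H, Γ.HasHead s p H → Δ.HasHead s p H)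
    {s p q l S} (hΓ : Γ.CanInp s p q l S) : Δ.CanInp s p q l S :=
  let ⟨n, lab, pay, cont, k, h1, h2⟩ := hΓ
  ⟨n, lab, pay, cont, k, h _ _ _ h1, h2⟩

theorem CanAct.mono {Γ Δ : Ctx K} (h : ∀ s p H, Γ.HasHead s p H → Δ.HasHead s p H)
    (hc : ∀ s p, Γ.ep s p = some .crashed → Δ.ep s p = some .crashed)
    (hd : ∀ s p T, Γ.ep s p = some (.sess T) → ¬ (Payload.sess T).Sub (.sess .done) →
      ∃ T', Δ.ep s p = some (.sess T') ∧ ¬ (Payload.sess T').Sub (.sess .done))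
    {a} (hΓ : Γ.CanAct a) : Δ.CanAct a := by
  cases a with
  | out => exact CanOut.mono h hΓ
  | inp => exact CanInp.mono h hΓ
  | comm =>
    obtain ⟨S, h1, h2⟩ := hΓ
    exact ⟨S, h1.mono h, h2.imp (fun ⟨S', h3, h4⟩ => ⟨S', h3.mono h, h4⟩) (hc _ _)⟩
  | crash =>
    obtain ⟨T, h1, h2⟩ := hΓ
    exact hd _ _ T h1 h2
  | detect => exact ⟨hΓ.1.mono h, hc _ _ hΓ.2⟩
  | stopped => exact hc _ _ hΓ

theorem CanAct.mono_ep {Γ Δ : Ctx K} (h : ∀ s p U, Γ.ep s p = some U → Δ.ep s p = some U)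
    {a} (hΓ : Γ.CanAct a) : Δ.CanAct a :=
  hΓ.mono (fun _ _ _ => HasHead.mono h) (fun _ _ => h _ _ _) fun _ _ T h1 h2 => ⟨T, h _ _ _ h1, h2⟩

theorem Split.ep_left {Γ Γ₁ Γ₂ : Ctx K} (h : Split Γ Γ₁ Γ₂) (s : ℕ) (p : K.Role) (U : UType K)
    (hU : Γ₁.ep s p = some U) : Γ.ep s p = some U :=
  ent_ep.1 (h.left (ent_ep.2 hU)).1

theorem Split.ep_right {Γ Γ₁ Γ₂ : Ctx K} (h : Split Γ Γ₁ Γ₂) (s : ℕ) (p : K.Role) (U : UType K)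
    (hU : Γ₂.ep s p = some U) : Γ.ep s p = some U :=
  ent_ep.1 (h.right (ent_ep.2 hU)).1

theorem singleEp_ep {s : ℕ} {p : K.Role} {U : UType K} {s' p' U'} :
    (singleEp s p U).ep s' p' = some U' ↔ s' = s ∧ p' = p ∧ U = U' := by
  simp only [singleEp]
  split_ifs with h
  · simp [h.1, h.2]
  · simp only [false_iff]
    exact fun h' => h ⟨h'.1, h'.2.1⟩

end Ctx

/-- Inversion of transitions. Frames and unfoldings may be interleaved arbitrarily in a derivation,
so the relevant entries are collected by induction. -/
theorem Trans.canAct {Γ Γ' : Ctx K} {a : Act K} (h : Trans Γ a Γ') : Γ.CanAct a := by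
  induction h with
  | @out s p q n lab pay cont k =>
    exact ⟨n, lab, pay, cont, k, ⟨_, Ctx.singleEp_ep.2 ⟨rfl, rfl, rfl⟩, .int⟩, rfl, rfl⟩
  | @inp s p q n lab pay cont k =>
    exact ⟨n, lab, pay, cont, k, ⟨_, Ctx.singleEp_ep.2 ⟨rfl, rfl, rfl⟩, .ext⟩, rfl, rfl⟩
  | com _ _ hS hs _ ih1 ih2 =>
    exact ⟨_, Ctx.CanOut.mono (fun _ _ _ => .mono hs.ep_left) ih1,
      .inl ⟨_, Ctx.CanInp.mono (fun _ _ _ => .mono hs.ep_right) ih2, hS⟩⟩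
  | @unfold s p T a Γ' _ ih =>
    refine ih.mono ?_ ?_ ?_
    · rintro s' p' H ⟨T', h1, h2⟩
      obtain ⟨rfl, rfl, h3⟩ := Ctx.singleEp_ep.1 h1
      cases h3
      exact ⟨_, Ctx.singleEp_ep.2 ⟨rfl, rfl, rfl⟩, .mu h2⟩
    · intro s' p' h1
      cases (Ctx.singleEp_ep.1 h1).2.2
    · intro s' p' T' h1 h2
      obtain ⟨rfl, rfl, h3⟩ := Ctx.singleEp_ep.1 h1
      cases h3
      exact ⟨_, Ctx.singleEp_ep.2 ⟨rfl, rfl, rfl⟩, fun h => h2 h.unfold_left⟩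
  | frame _ hs _ ih => exact ih.mono_ep hs.ep_left
  | @crash s p T h => exact ⟨T, Ctx.singleEp_ep.2 ⟨rfl, rfl, rfl⟩, h⟩
  | stopped => exact Ctx.singleEp_ep.2 ⟨rfl, rfl, rfl⟩
  | detect _ _ hs _ ih1 ih2 =>
    exact ⟨Ctx.CanInp.mono (fun _ _ _ => .mono hs.ep_left) ih1, hs.ep_right _ _ _ ih2⟩
  | lost _ _ hs _ ih1 ih2 =>
    exact ⟨_, Ctx.CanOut.mono (fun _ _ _ => .mono hs.ep_left) ih1, .inr (hs.ep_right _ _ _ ih2)⟩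

namespace Ctx

open Classical in
/-- Replacement of the type of an endpoint. -/
noncomputable def setEp (Γ : Ctx K) (s : ℕ) (p : K.Role) (U : UType K) : Ctx K :=
  ⟨Γ.var, fun s' p' => if s' = s ∧ p' = p then some U else Γ.ep s' p'⟩

theorem setEp_self (Γ : Ctx K) (s : ℕ) (p : K.Role) (U : UType K) :
    (Γ.setEp s p U).ep s p = some U := by simp [setEp]

theorem setEp_of_ne {Γ : Ctx K} {s : ℕ} {p : K.Role} {U : UType K} {s' p'}
    (h : ¬ (s' = s ∧ p' = p)) : (Γ.setEp s p U).ep s' p' = Γ.ep s' p' := by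
  simp only [setEp, if_neg h]

theorem ent_setEp_self (Γ : Ctx K) (s : ℕ) (p : K.Role) (U : UType K) :
    (Γ.setEp s p U).ent (.ep s p) = some U.toEnt := ent_ep.2 (setEp_self ..)

theorem ent_setEp_of_ne {Γ : Ctx K} {s : ℕ} {p : K.Role} {U : UType K} {c : Chan K}
    (h : c ≠ .ep s p) : (Γ.setEp s p U).ent c = Γ.ent c := by
  cases c with
  | var => rfl
  | ep s' p' =>
    simp only [ent]
    rw [setEp_of_ne]
    rintro ⟨rfl, rfl⟩
    exact h rfl

theorem split_setEp (Γ : Ctx K) (s : ℕ) (p : K.Role) (U : UType K) :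
    Split (Γ.setEp s p U) (singleEp s p U) (Γ.filter {.ep s p}ᶜ) := by
  refine Split.symm ((isOne_singleEp s p U).split_of (ent_setEp_self ..) ?_ fun c hc => ?_)
  · simp [ent_filter]
  · rw [ent_setEp_of_ne hc]; simp [ent_filter, hc]

theorem setEp_eq_self {Γ : Ctx K} {s : ℕ} {p : K.Role} {U : UType K} (h : Γ.ep s p = some U) :
    Γ.setEp s p U = Γ := by
  ext1
  · rfl
  · funext s' p'
    by_cases h' : s' = s ∧ p' = p
    · obtain ⟨rfl, rfl⟩ := h'; rw [setEp_self, h]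
    · exact setEp_of_ne h'

theorem split_singleEp {s : ℕ} {p q : K.Role} (hpq : p ≠ q) (U V : UType K) :
    Split ((singleEp s p U).union (singleEp s q V)) (singleEp s p U) (singleEp s q V) := by
  refine ⟨⟨fun x => .inl rfl, fun s' p' => ?_⟩, rfl⟩
  by_cases h : s' = s ∧ p' = p
  · right
    simp only [singleEp]
    rw [if_neg]
    rintro ⟨-, rfl⟩
    exact hpq h.2.symm
  · left
    simp only [singleEp, if_neg h]

theorem split_setEp_setEp (Γ : Ctx K) {s : ℕ} {p q : K.Role} (hpq : p ≠ q) (U V : UType K) :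
    Split ((Γ.setEp s p U).setEp s q V) ((singleEp s p U).union (singleEp s q V))
      (Γ.filter {.ep s p, .ep s q}ᶜ) := by
  have h := split_singleEp (s := s) hpq U V
  have hp := (isOne_singleEp s q V).split h
  have hq := (isOne_singleEp s p U).split h.symm
  refine split_iff.2 fun c => ?_
  have hne : (.ep s p : Chan K) ≠ .ep s q := fun h => hpq (by cases h; rfl)
  by_cases h1 : c = .ep s q
  · subst h1
    refine .inr ⟨by simp [ent_filter], ?_⟩
    rw [ent_setEp_self, hp.1]
  · by_cases h2 : c = .ep s p
    · subst h2
      refine .inr ⟨by simp [ent_filter], ?_⟩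
      rw [ent_setEp_of_ne h1, ent_setEp_self, hq.1]
    · refine .inl ⟨?_, ?_⟩
      · rw [hp.2.2 _ h1, (isOne_singleEp s p U).2 _ h2]
      · rw [ent_setEp_of_ne h1, ent_setEp_of_ne h2]
        simp [ent_filter, h1, h2]

end Ctx

/-- With `Trans.frame_two`, a counterpart of `Trans.canAct`: transitions of the entries involved
extend to the whole context, with an explicit target. -/
theorem Trans.frame_one {Γ : Ctx K} {s : ℕ} {p : K.Role} {U U' : UType K} {a : Act K}
    (hp : Γ.ep s p = some U) (h : Trans (.singleEp s p U) a (.singleEp s p U')) :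
    Trans Γ a (Γ.setEp s p U') := by
  have := Ctx.split_setEp Γ s p U
  rw [Ctx.setEp_eq_self hp] at this
  exact .frame h this (Ctx.split_setEp Γ s p U')

theorem Trans.frame_two {Γ : Ctx K} {s : ℕ} {p q : K.Role} {U U' V V' : UType K} {a : Act K}
    (hpq : p ≠ q) (hp : Γ.ep s p = some U) (hq : Γ.ep s q = some V)
    (h : Trans ((Ctx.singleEp s p U).union (.singleEp s q V)) a
      ((Ctx.singleEp s p U').union (.singleEp s q V'))) :
    Trans Γ a ((Γ.setEp s p U').setEp s q V') := by
  have := Ctx.split_setEp_setEp Γ (s := s) hpq U V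
  rw [Ctx.setEp_eq_self hp, Ctx.setEp_eq_self hq] at this
  exact .frame h this (Ctx.split_setEp_setEp Γ hpq U' V')

theorem Trans.out_of_head {T : SType K} {s p q n lab pay cont}
    (h : T.Head (.int q n lab pay cont)) (k : Fin (n + 1)) :
    Trans (.singleEp s p (.sess T)) (.out s p q (lab k) (pay k))
      (.singleEp s p (.sess (cont k))) := by
  generalize hH : SType.int q n lab pay cont = H at h
  induction h with
  | int => cases hH; exact .out k
  | mu _ ih => exact .unfold (ih hH)
  | _ => cases hH

theorem Trans.inp_of_head {T : SType K} {s p q n lab pay cont}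
    (h : T.Head (.ext q n lab pay cont)) (k : Fin (n + 1)) :
    Trans (.singleEp s p (.sess T)) (.inp s p q (lab k) (pay k))
      (.singleEp s p (.sess (cont k))) := by
  generalize hH : SType.ext q n lab pay cont = H at h
  induction h with
  | ext => cases hH; exact .inp k
  | mu _ ih => exact .unfold (ih hH)
  | _ => cases hH

theorem Trans.exists_out {Γ : Ctx K} {s p q n lab pay cont}
    (h : Γ.HasHead s p (.int q n lab pay cont)) (k : Fin (n + 1)) :
    ∃ Γ', Trans Γ (.out s p q (lab k) (pay k)) Γ' :=
  let ⟨_, h1, h2⟩ := h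
  ⟨_, .frame_one h1 (.out_of_head h2 k)⟩

theorem Trans.exists_inp {Γ : Ctx K} {s p q n lab pay cont}
    (h : Γ.HasHead s p (.ext q n lab pay cont)) (k : Fin (n + 1)) :
    ∃ Γ', Trans Γ (.inp s p q (lab k) (pay k)) Γ' :=
  let ⟨_, h1, h2⟩ := h
  ⟨_, .frame_one h1 (.inp_of_head h2 k)⟩

/-- A session without live endpoints is safe. -/
theorem safe_of_not_live {s : ℕ} {R : Set K.Role} {Γ : Ctx K}
    (h : ∀ p U, Γ.ep s p = some U → U.Ended ∨ U = .crashed) : Safe s R Γ := by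
  have nohead : ∀ (Γ : Ctx K) (s : ℕ), (∀ p U, Γ.ep s p = some U → U.Ended ∨ U = .crashed) →
      ∀ p H, Γ.HasHead s p H → H = .done := by
    rintro Γ s h p H ⟨T, h1, h2⟩
    rcases h p _ h1 with h3 | h3
    · exact h2.unique (UType.ended_sess.1 h3).head_done
    · cases h3
  have noout : ∀ (Γ : Ctx K) (s : ℕ), (∀ p U, Γ.ep s p = some U → U.Ended ∨ U = .crashed) →
      ∀ p q l S, ¬ Γ.CanOut s p q l S := by
    rintro Γ s h p q l S ⟨n, lab, pay, cont, k, h1, -⟩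
    cases nohead Γ s h p _ h1
  have noinp : ∀ (Γ : Ctx K) (s : ℕ), (∀ p U, Γ.ep s p = some U → U.Ended ∨ U = .crashed) →
      ∀ p q l S, ¬ Γ.CanInp s p q l S := by
    rintro Γ s h p q l S ⟨n, lab, pay, cont, k, h1, -⟩
    cases nohead Γ s h p _ h1
  -- The property itself serves as the safety property. Such contexts have no inputs, outputs or
  -- crashes in `s`, so all three conditions are vacuous.
  refine ⟨fun Γ => ∀ p U, Γ.ep s p = some U → U.Ended ∨ U = .crashed, ⟨?_, ?_, ?_⟩, h⟩
  · rintro Γ p q l S l' S' h ⟨Γ', h1⟩ -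
    exact absurd h1.canAct (noout Γ s h p q l S)
  · rintro Γ p q l S h - ⟨Γ', h1⟩
    exact absurd h1.canAct (noinp Γ s h q p l S)
  · rintro Γ Γ' h (⟨q, r, l, h1⟩ | ⟨q, r, h1⟩ | ⟨p, -, h1⟩)
    · obtain ⟨S, h2, -⟩ := h1.canAct
      exact absurd h2 (noout Γ s h q r l S)
    · exact absurd h1.canAct.1 (noinp Γ s h q r _ _)
    · obtain ⟨T, h2, h3⟩ := h1.canAct
      rcases h p _ h2 with h4 | h4
      · exact absurd (UType.ended_sess.1 h4) h3
      · cases h4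

/-! ### Processes that use one endpoint -/

open Classical in
/-- The context whose only possible entry is the type `u` of `s[p]`. -/
noncomputable def Ctx.atMostEp (s : ℕ) (p : K.Role) (u : Option (UType K)) : Ctx K :=
  ⟨fun _ => none, fun s' p' => if s' = s ∧ p' = p then u else none⟩

namespace Ctx

theorem ent_atMostEp {s : ℕ} {p : K.Role} {u : Option (UType K)} {c : Chan K} {e : Ent K}
    (h : (atMostEp s p u).ent c = some e) : c = .ep s p ∧ ∃ U, u = some U ∧ e = U.toEnt := by
  cases c with
  | var => cases h
  | ep s' p' =>
    obtain ⟨U, h1, rfl⟩ := ent_ep'.1 h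
    simp only [atMostEp] at h1
    split_ifs at h1 with h2
    exact ⟨by rw [h2.1, h2.2], U, h1, rfl⟩

theorem ent_atMostEp_self (s : ℕ) (p : K.Role) (U : UType K) :
    (atMostEp s p (some U)).ent (.ep s p) = some U.toEnt := by
  simp [atMostEp, ent]

theorem isOne_atMostEp (s : ℕ) (p : K.Role) (U : UType K) :
    IsOne (atMostEp s p (some U)) (.ep s p) U.toEnt := by
  refine ⟨ent_atMostEp_self s p U, fun c hc => ?_⟩
  by_contra h
  obtain ⟨e, he⟩ := Option.ne_none_iff_exists'.1 h
  exact hc (ent_atMostEp he).1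

theorem shift_atMostEp (k s : ℕ) (p : K.Role) (u : Option (UType K)) :
    (atMostEp s p u).shift k = atMostEp (s + k) p u := by
  ext1
  · rfl
  · funext s' p'
    by_cases h : k ≤ s'
    · simp only [shift, atMostEp, if_pos h]
      congr 1
      simp only [eq_iff_iff, and_congr_left_iff]
      intro _; omega
    · have : ¬ (s' = s + k ∧ p' = p) := by omega
      simp only [shift, atMostEp, if_neg h, if_neg this]

end Ctx

/-- The subject of a prefix has a choice type, a crashed endpoint has the crashed type, and `err` is
not typable. -/
theorem Typed.exists_ent_of_leaf {Θ : DefEnv K} {Γ : Ctx K} {L : Proc K} (h : Typed Θ Γ L)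
    (hL : L.IsLeaf) : ∃ c e, Γ.ent c = some e ∧ ¬ e.Ended := by
  cases h with
  | branch Γc hs hc =>
    obtain ⟨S', h1, h2⟩ := hc.isOne
    exact ⟨_, _, (hs.right h1.1).1, fun h => Payload.ext_not_done
      (Payload.ended_sess.1 (Payload.Le.ended (.inr h2) h))⟩
  | sel hs hs' hc =>
    obtain ⟨S', h1, h2⟩ := hc.isOne
    exact ⟨_, _, (hs.left (hs'.right h1.1).1).1, fun h => Payload.int_not_done
      (Payload.ended_sess.1 (Payload.Le.ended (.inr h2) h))⟩
  | crashed hs =>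
    exact ⟨_, _, (hs.right (Ctx.isOne_singleEp _ _ .crashed).1).1, by
      simp [UType.toEnt, Ent.Ended]⟩
  | _ => exact absurd hL id

/-- `Q` is typed by the entry of `s[p]` alone, and satisfies the conditions on declarations and
restrictions of processes that only play one role. -/
def Comp (s : ℕ) (p : K.Role) (u : Option (UType K)) (Q : Proc K) : Prop :=
  Typed .empty (.atMostEp s p u) Q ∧ Q.Tame

/-- `Q` consists of the prefix or crashed endpoint `L`, typed by `s[p] : U`, in the evaluation
context `F`. -/
def Focus (s : ℕ) (p : K.Role) (U : UType K) (Q : Proc K) (k : ℕ) (F : Proc K → Proc K)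
    (L : Proc K) : Prop :=
  ∃ d Θ, Hole k d F ∧ Q = F L ∧ L.IsLeaf ∧ L.Tame ∧
    Typed Θ (.atMostEp (s + k) p (some U)) L ∧
    ∀ U' L', Typed Θ (.atMostEp (s + k) p (some U')) L' → L'.Tame → Comp s p (some U') (F L')

/-- A leaf needs an entry that is not terminated, and the context offers only `s[p]`. So the leaf
takes it, and the surrounding evaluation context is typed by nothing. -/
theorem Comp.cong_nil_or_focus {s : ℕ} {p : K.Role} {u : Option (UType K)} {Q : Proc K}
    (h : Comp s p u Q) (hn : Q.ncalls = 0) :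
    Cong Q .nil ∨ ∃ U, u = some U ∧ ¬ U.Ended ∧ ∃ k F L, Focus s p U Q k F L := by
  rcases Proc.exists_leaf hn with h1 | ⟨k, d, F, L, hF, rfl, hL⟩
  · exact .inl h1
  · right
    obtain ⟨Θ, Γ₁, Γ₂, h1, -, h3, h4⟩ := hF.typed h.1 h.2.2
    obtain ⟨t1, t2⟩ := hF.tame h.2
    obtain ⟨c, e, h5, h6⟩ := h3.exists_ent_of_leaf hL
    cases c with
    | var x =>
      rw [Ctx.ent_shift_var] at h5
      cases (Ctx.ent_atMostEp (h1.left h5).1).1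
    | ep s' p' =>
      obtain ⟨h7, h8⟩ := Ctx.ent_shift_ep h5
      obtain ⟨h9, U, rfl, rfl⟩ := Ctx.ent_atMostEp (h1.left h8).1
      rw [h9] at h8
      have e1 : Γ₁ = .atMostEp s p (some U) := by
        refine Ctx.IsOne.unique ⟨h8, fun c' hc' => ?_⟩ (Ctx.isOne_atMostEp s p U)
        by_contra hne
        obtain ⟨e, he⟩ := Option.ne_none_iff_exists'.1 hne
        exact hc' (Ctx.ent_atMostEp (h1.left he).1).1
      -- The only possible entry belongs to `Γ₁` already.
      have e2 : Γ₂ = .empty := by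
        refine Ctx.ent_injective fun c' => ?_
        rw [Ctx.ent_empty]
        by_contra hne
        obtain ⟨e, he⟩ := Option.ne_none_iff_exists'.1 hne
        have := (Ctx.ent_atMostEp (h1.right he).1).1
        subst this
        rw [(h1.right he).2] at h8
        cases h8
      subst e1 e2
      rw [Ctx.shift_atMostEp] at h3
      refine ⟨U, rfl, fun hU => h6 (UType.ended_toEnt.2 hU), k, F, L, d, Θ, hF, rfl, hL, t1, h3,
        fun U' L' hL' ht => ⟨h4 _ (.atMostEp s p (some U')) L' (Ctx.Split.empty_right _) ?_,
          t2 L' ht⟩⟩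
      rwa [Ctx.shift_atMostEp]

/-- The other alternative is excluded by `Typed.ended_of_cong_nil`, since `s[p]` is not terminated.
-/
theorem Comp.focus {s : ℕ} {p : K.Role} {U : UType K} {Q : Proc K}
    (h : Comp s p (some U) Q) (hn : Q.ncalls = 0) (hU : ¬ U.Ended) :
    ∃ k F L, Focus s p U Q k F L := by
  rcases h.cong_nil_or_focus hn with h1 | ⟨U', h1, -, h2⟩
  · have := h.1.ended_of_cong_nil h1
    exact absurd (UType.ended_toEnt.1
      (Ctx.ended_iff.1 this _ _ (Ctx.ent_atMostEp_self s p U))) hU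
  · cases h1; exact h2

theorem Comp.cong_nil {s : ℕ} {p : K.Role} {u : Option (UType K)} {Q : Proc K}
    (h : Comp s p u Q) (hn : Q.ncalls = 0) (hu : ∀ U, u = some U → U.Ended) : Cong Q .nil := by
  rcases h.cong_nil_or_focus hn with h1 | ⟨U', h1, h2, -⟩
  · exact h1
  · exact absurd (hu U' h1) h2

theorem Typed.atMostEp_mono {Θ : DefEnv K} {s : ℕ} {p : K.Role} {T T' : SType K} {P : Proc K}
    (h : Typed Θ (.atMostEp s p (some (.sess T))) P) (hT : (Payload.sess T').Le (.sess T)) :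
    Typed Θ (.atMostEp s p (some (.sess T'))) P := by
  refine h.congr (Set.subset_univ _) (fun _ _ _ h => absurd trivial h) ?_ ?_
  · intro c e he _ _
    obtain ⟨rfl, U, h1, rfl⟩ := Ctx.ent_atMostEp he
    cases h1
    exact ⟨_, Ctx.ent_atMostEp_self s p _, hT⟩
  · intro c e he _
    obtain ⟨rfl, U, h1, rfl⟩ := Ctx.ent_atMostEp he
    cases h1
    exact ⟨Set.subset_univ _, _, Ctx.ent_atMostEp_self s p _, hT⟩

theorem Ctx.split_atMostEp {s : ℕ} {p : K.Role} {Γ Γ₀ : Ctx K} {T : SType K}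
    (hs : Split Γ Γ₀ (.singleChan T (.ep s p))) (h0 : ∀ c, Γ₀.ent c = none) :
    Γ = .atMostEp s p (some (.sess T)) := by
  obtain ⟨h1, -, h3⟩ := (isOne_singleChan T (.ep s p)).split hs
  exact IsOne.unique ⟨h1, fun c hc => (h3 c hc).trans (h0 c)⟩ (isOne_atMostEp s p (.sess T))

/-- The subject takes the only entry, so no channel is left for the payload, which must be a basic
value. -/
theorem Typed.leaf_sel {Θ : DefEnv K} {s : ℕ} {p : K.Role} {U : UType K} {c q l d} {P : Proc K}
    (h : Typed Θ (.atMostEp s p (some U)) (.sel c q l d P)) :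
    c = .ep s p ∧ ∃ v b T T', d = .val v ∧ K.HasTy v b ∧ U = .sess T ∧
      (Payload.sess T).Sub (.sess (.int q 0 (fun _ => l) (fun _ => .base b) (fun _ => T'))) ∧
      Typed Θ (.atMostEp s p (some (.sess T'))) P := by
  cases h with
  | @sel _ _ Γ' Γ₀ Γ₁ Γ₂ Γc _ _ _ _ S T' _ hs hs' hc hd hS hΓc hP =>
    obtain ⟨S₁, h1, h2⟩ := hc.isOne
    have k1 := hs'.right h1.1
    have k2 := hs.left k1.1
    obtain ⟨rfl, U', e1, e2⟩ := Ctx.ent_atMostEp k2.1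
    cases e1
    have n2 : ∀ c, Γ₂.ent c = none := by
      intro c
      by_contra hne
      obtain ⟨e, he⟩ := Option.ne_none_iff_exists'.1 hne
      obtain ⟨rfl, -⟩ := Ctx.ent_atMostEp (hs.right he).1
      exact hne k2.2
    have n0 : ∀ c, Γ₀.ent c = none := by
      intro c
      by_contra hne
      obtain ⟨e, he⟩ := Option.ne_none_iff_exists'.1 hne
      obtain ⟨rfl, -⟩ := Ctx.ent_atMostEp (hs.left (hs'.left he).1).1
      exact hne k1.2
    cases d with
    | chan c =>
      obtain ⟨S₂, h3, -⟩ := hd.isOne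
      have := h3.1
      rw [n2] at this; cases this
    | val v =>
      cases hd with
      | @val _ b hv =>
        cases U with
        | crashed => cases e2
        | sess T =>
          cases e2
          refine ⟨rfl, v, b, T, T', rfl, hv, rfl, h2, ?_⟩
          rw [← Ctx.split_atMostEp hΓc n0]
          exact hP

/-- The last part is the substitution lemma for a received basic value. The type `T'` of the
continuation may be smaller than that of the branch, since the context moves by its own, smaller,
type. -/
theorem Typed.leaf_branch {Θ : DefEnv K} {s : ℕ} {p : K.Role} {U : UType K} {c q n lab}
    {P : Fin (n + 1) → Proc K} (h : Typed Θ (.atMostEp s p (some U)) (.branch c q n lab P)) :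
    c = .ep s p ∧ ∃ T pay cont, U = .sess T ∧
      (Payload.sess T).Sub (.sess (.ext q n lab pay cont)) ∧
      ∀ i b v T', pay i = .base b → K.HasTy v b → (Payload.sess T').Le (.sess (cont i)) →
        Typed Θ (.atMostEp s p (some (.sess T'))) ((P i).subst (inst [.val v])) := by
  cases h with
  | @branch _ _ Γ₀ Γ₁ _ _ _ _ pay cont _ Γc hs hc hΓc hP =>
    obtain ⟨S₁, h1, h2⟩ := hc.isOne
    have k1 := hs.right h1.1
    obtain ⟨rfl, U', e1, e2⟩ := Ctx.ent_atMostEp k1.1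
    cases e1
    have n0 : ∀ c, Γ₀.ent c = none := by
      intro c
      by_contra hne
      obtain ⟨e, he⟩ := Option.ne_none_iff_exists'.1 hne
      obtain ⟨rfl, -⟩ := Ctx.ent_atMostEp (hs.left he).1
      exact hne k1.2
    cases U with
    | crashed => cases e2
    | sess T =>
      cases e2
      refine ⟨rfl, T, pay, cont, rfl, h2, fun i b v T' hb hv hT' => ?_⟩
      have hPi := hP i
      rw [Ctx.split_atMostEp (hΓc i) n0, hb] at hPi
      have hent : ∀ c e, (Ctx.consVar (.base b) (.atMostEp s p (some (.sess (cont i))))).ent c =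
          some e → (c = .var 0 ∧ e = some (.base b)) ∨
            (c = .ep s p ∧ e = some (.sess (cont i))) := by
        intro c e he
        rcases c.up_cases with rfl | ⟨c, rfl⟩
        · exact .inl ⟨rfl, (Option.some.inj he).symm⟩
        · rw [Ctx.ent_consVar_up] at he
          obtain ⟨rfl, U, e1, rfl⟩ := Ctx.ent_atMostEp he
          cases e1
          exact .inr ⟨rfl, rfl⟩
      refine hPi.subst (V := Set.univ) ⟨?_, ?_, ?_, ?_⟩ (Set.subset_univ _)
      · exact fun _ _ _ h => absurd (Set.subset_univ _) h
      · intro c e he _ _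
        rcases hent c e he with ⟨rfl, rfl⟩ | ⟨rfl, rfl⟩
        · exact .inl ⟨v, b, rfl, rfl, hv⟩
        · exact .inr ⟨_, _, rfl, Ctx.ent_atMostEp_self s p _, hT'⟩
      · intro c₁ e₁ c₂ e₂ c' g1 _ _ g2 _ _ g3 g4
        rcases hent _ _ g1 with ⟨rfl, -⟩ | ⟨rfl, -⟩
        · cases g3
        · rcases hent _ _ g2 with ⟨rfl, -⟩ | ⟨rfl, -⟩
          · cases g4
          · rfl
      · intro c' e' g1 g2
        obtain ⟨rfl, U, e1, rfl⟩ := Ctx.ent_atMostEp g1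
        cases e1
        exact ⟨.ep s p, some (.sess (cont i)), Ctx.ent_atMostEp_self s p (.sess (cont i)),
          fun h => g2 (Payload.Le.ended_left hT' h), Set.subset_univ _, rfl⟩

theorem Typed.leaf_crashed {Θ : DefEnv K} {s : ℕ} {p : K.Role} {U : UType K} {s' p'}
    (h : Typed Θ (.atMostEp s p (some U)) (.crashed s' p')) :
    (s' = s ∧ p' = p) ∧ U = .crashed := by
  cases h with
  | crashed hs =>
    obtain ⟨h1, -⟩ := (Ctx.isOne_singleEp s' p' (.crashed : UType K)).split hs
    obtain ⟨h2, U', h3, h4⟩ := Ctx.ent_atMostEp h1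
    cases h2; cases h3
    exact ⟨⟨rfl, rfl⟩, (UType.toEnt_inj h4).symm⟩

/-- `Typed.occ` and `Typed.fc` together determine the free endpoints, so the crash of such a process
leaves a single crashed endpoint. -/
theorem Typed.fc_eq {Θ : DefEnv K} {s : ℕ} {p : K.Role} {U : UType K} {P : Proc K}
    (h : Typed Θ (.atMostEp s p (some U)) P) (hU : ¬ U.Ended) (x : ℕ × K.Role) :
    x ∈ [(s, p)] ↔ x ∈ P.fc := by
  rw [List.mem_singleton]
  constructor
  · rintro rfl
    exact (h.occ s p _ (Ctx.ent_atMostEp_self s p U)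
      fun h => hU (UType.ended_toEnt.1 h)).mem_fc
  · intro hx
    obtain ⟨e, he, -⟩ := h.fc x.1 x.2 hx
    have := (Ctx.ent_atMostEp he).1
    cases x; cases this; rfl

theorem Typed.crashed_atMostEp (Θ : DefEnv K) (s : ℕ) (p : K.Role) :
    Typed Θ (.atMostEp s p (some .crashed)) (.crashed s p) := by
  refine .crashed (Γ₀ := .empty) ?_ (Ctx.ended_iff.2 fun c e he => by simp at he)
  rw [(Ctx.isOne_atMostEp s p .crashed).unique (Ctx.isOne_singleEp s p .crashed)]
  exact (Ctx.Split.empty_right _).symm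

/-- The crash of a process that uses one live endpoint. -/
theorem Comp.exists_crash {s : ℕ} {p : K.Role} {T : SType K} {Q : Proc K}
    (h : Comp s p (some (.sess T)) Q) (hn : Q.ncalls = 0) (hT : ¬ (UType.sess T).Ended) :
    ∃ Q', Red Q Q' ∧ Comp s p (some .crashed) Q' := by
  obtain ⟨k, F, L, d, Θ, hF, rfl, hL, ht, h1, h2⟩ := h.focus hn hT
  have key : Red L (.crashed (s + k) p) := by
    have hfc := h1.fc_eq hT
    have e : Cong (bigPar ([(s + k, p)].map fun j => Proc.crashed j.1 j.2)) (.crashed (s + k) p) :=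
      .parNil _
    cases L with
    | sel c q l d' P =>
      obtain ⟨rfl, v, b, T₁, T', rfl, -⟩ := h1.leaf_sel
      exact .cong (.refl _) (.crashSel (w := .val v) [(s + k, p)] (by simp) hfc) e
    | branch c q n lab P =>
      obtain ⟨rfl, -⟩ := h1.leaf_branch
      exact .cong (.refl _) (.crashBranch [(s + k, p)] (by simp) hfc) e
    | crashed s' p' => cases h1.leaf_crashed.2
    | err => cases h1
    | _ => exact absurd hL id
  exact ⟨_, hF.red key, h2 _ _ (.crashed_atMostEp _ _ _) ⟨trivial, trivial⟩⟩

/-- The one-branch internal choice of the selection is a supertype of the type of `s[p]`, so its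
label is found among the labels there. The index `i` is dictated by the process. -/
theorem Focus.sel_of_head {s : ℕ} {p : K.Role} {T : SType K} {Q : Proc K} {k F L}
    (h : Focus s p (.sess T) Q k F L) {q n lab pay cont}
    (hT : T.Head (.int q n lab pay cont)) :
    Function.Injective lab ∧
    ∃ v b P, ∃ i : Fin (n + 1), L = .sel (.ep (s + k) p) q (lab i) (.val v) P ∧
      (Payload.base b).Sub (pay i) ∧ K.HasTy v b ∧ Comp s p (some (.sess (cont i))) (F P) := by
  obtain ⟨d, Θ, hF, rfl, hL, ht, h1, h2⟩ := h
  cases L with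
  | sel c q' l d' P =>
    obtain ⟨rfl, v, b, T₁, T', rfl, hv, e, hsub, hP⟩ := h1.leaf_sel
    cases e
    obtain ⟨n', lab', pay', cont', hT', h3⟩ := hsub.int_inv
    cases hT.unique hT'
    obtain ⟨i, h4, h5, h6⟩ := h3 0
    refine ⟨(hT.wf hsub.1).1, v, b, P, i, by rw [h4], h5, hv,
      h2 _ _ (hP.atMostEp_mono (.inr h6)) ⟨ht.1, ht.2⟩⟩
  | branch c q n lab P =>
    obtain ⟨rfl, T₁, pay, cont, e, hsub, -⟩ := h1.leaf_branch
    cases e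
    obtain ⟨n', lab', pay', cont', hT', -⟩ := hsub.ext_inv
    cases hT.unique hT'
  | crashed s' p' => cases h1.leaf_crashed.2
  | err => cases h1
  | _ => exact absurd hL id

/-- The external choice of the process is a supertype and covers every branch of the type of `s[p]`.
So, unlike for selections, the index `i` may be prescribed. -/
theorem Focus.branch_of_head {s : ℕ} {p : K.Role} {T : SType K} {Q : Proc K} {k F L}
    (h : Focus s p (.sess T) Q k F L) {q n lab pay cont}
    (hT : T.Head (.ext q n lab pay cont)) (i : Fin (n + 1)) {b : K.BTy} {v : K.Val}
    (hb : (Payload.base b).Sub (pay i)) (hv : K.HasTy v b) :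
    ∃ m lab' P, ∃ j : Fin (m + 1), L = .branch (.ep (s + k) p) q m lab' P ∧ lab' j = lab i ∧
      Comp s p (some (.sess (cont i))) (F ((P j).subst (inst [.val v]))) := by
  obtain ⟨d, Θ, hF, rfl, hL, ht, h1, h2⟩ := h
  cases L with
  | sel c q' l d' P =>
    obtain ⟨rfl, v, b, T₁, T', rfl, hv, e, hsub, hP⟩ := h1.leaf_sel
    cases e
    obtain ⟨n', lab', pay', cont', hT', h3⟩ := hsub.int_inv
    cases hT.unique hT'
  | branch c q m lab' P =>
    obtain ⟨rfl, T₁, pay', cont', e, hsub, hP⟩ := h1.leaf_branch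
    cases e
    obtain ⟨n'', lab'', pay'', cont'', hT', h3⟩ := hsub.ext_inv
    cases hT.unique hT'
    obtain ⟨j, h4, h5, h6⟩ := h3 i
    -- A supertype of a basic type is basic, so the value also belongs to the payload type of this
    -- branch.
    obtain ⟨b', hb', hbb⟩ := (hb.trans h5).base_inv
    have := hP j b' v (cont i) hb' (K.hasTy_of_bsub _ _ _ hv hbb) (.inr h6)
    refine ⟨m, lab', P, j, rfl, h4.symm, h2 _ _ this ?_⟩
    cases h1 with
    | branch Γc hs hc hΓc hP' =>
      exact (hP' j).tame_subst ⟨ht.1 j, ht.2 j⟩ _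
  | crashed s' p' => cases h1.leaf_crashed.2
  | err => cases h1
  | _ => exact absurd hL id

theorem Focus.crashed {s : ℕ} {p : K.Role} {Q : Proc K} {k F L}
    (h : Focus s p .crashed Q k F L) : L = .crashed (s + k) p := by
  obtain ⟨d, Θ, hF, rfl, hL, ht, h1, h2⟩ := h
  cases L with
  | sel c q' l d' P => obtain ⟨-, v, b, T₁, T', -, -, e, -⟩ := h1.leaf_sel; cases e
  | branch c q m lab' P => obtain ⟨-, T₁, pay', cont', e, -⟩ := h1.leaf_branch; cases e
  | crashed s' p' =>
    obtain ⟨⟨rfl, rfl⟩, -⟩ := h1.leaf_crashed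
    rfl
  | err => cases h1
  | _ => exact absurd hL id

theorem Comp.exists_call_step {s : ℕ} {p : K.Role} {u : Option (UType K)} {Q : Proc K}
    (h : Comp s p u Q) (hn : 0 < Q.ncalls) :
    ∃ Q', Red Q Q' ∧ Comp s p u Q' ∧ Q'.ncalls < Q.ncalls :=
  let ⟨Q', h1, h2, h3, h4⟩ := h.1.exists_call_step (fun _ => rfl) h.2 hn
  ⟨Q', h1, ⟨h2, h3⟩, h4⟩

/-! ### Parallel compositions of roles -/

theorem Cong.bigPar_perm {l l' : List (Proc K)} (h : l.Perm l') : Cong (bigPar l) (bigPar l') := by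
  induction h with
  | nil => exact .refl _
  | cons P _ ih => exact .par (.refl _) ih
  | swap P Q l =>
    exact (Cong.parAssoc _ _ _).symm.trans <| (Cong.par (.parComm _ _) (.refl _)).trans
      (Cong.parAssoc _ _ _)
  | trans _ _ ih1 ih2 => exact ih1.trans ih2

theorem exists_perm_cons {α : Type*} {l : List α} (hl : l.Nodup) {a : α} (ha : a ∈ l) :
    ∃ l', l.Perm (a :: l') ∧ a ∉ l' ∧ l'.Nodup := by
  obtain ⟨l₁, l₂, rfl⟩ := List.append_of_mem ha
  have h : (l₁ ++ a :: l₂).Perm (a :: (l₁ ++ l₂)) := List.perm_middle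
  have := List.nodup_cons.1 (h.nodup_iff.1 hl)
  exact ⟨_, h, this.1, this.2⟩

theorem map_update_of_notMem {α β : Type*} [DecidableEq α] {l : List α} {a : α} (h : a ∉ l)
    (f : α → β) (b : β) : l.map (Function.update f a b) = l.map f :=
  List.map_congr_left fun _ hx => Function.update_of_ne (ne_of_mem_of_not_mem hx h) _ _

open Classical in
theorem Red.bigPar_one {l : List K.Role} (hl : l.Nodup) {p : K.Role} (hp : p ∈ l)
    {Ps : K.Role → Proc K} {Q : Proc K} (h : Red (Ps p) Q) :
    Red (bigPar (l.map Ps)) (bigPar (l.map (Function.update Ps p Q))) := by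
  obtain ⟨l', h1, h2, -⟩ := exists_perm_cons hl hp
  refine .cong (.bigPar_perm (h1.map _)) ?_ (.bigPar_perm (h1.map _).symm)
  rw [List.map_cons, List.map_cons, map_update_of_notMem h2, Function.update_self]
  exact .ctxPar h

open Classical in
theorem Red.bigPar_two {l : List K.Role} (hl : l.Nodup) {p q : K.Role} (hp : p ∈ l) (hq : q ∈ l)
    (hpq : p ≠ q) {Ps : K.Role → Proc K} {P Q : Proc K}
    (h : Red (.par (Ps q) (Ps p)) (.par Q P)) :
    Red (bigPar (l.map Ps))
      (bigPar (l.map (Function.update (Function.update Ps p P) q Q))) := by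
  obtain ⟨l', h1, h2, h3⟩ := exists_perm_cons hl hq
  have hp' : p ∈ l' := by
    rcases List.mem_cons.1 (h1.mem_iff.1 hp) with h | h
    exacts [absurd h hpq, h]
  obtain ⟨l'', k1, k2, -⟩ := exists_perm_cons h3 hp'
  have h4 : q ∉ l'' := fun h => h2 (k1.mem_iff.2 (List.mem_cons_of_mem _ h))
  have h5 := h1.trans (k1.cons q)
  refine .cong ((Cong.bigPar_perm (h5.map _)).trans (Cong.parAssoc _ _ _).symm) (.ctxPar h)
    (((Cong.parAssoc _ _ _).trans ?_).trans (.bigPar_perm (h5.map _).symm))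
  rw [List.map_cons, List.map_cons, map_update_of_notMem h4, map_update_of_notMem k2,
    Function.update_self, Function.update_of_ne hpq, Function.update_self]
  exact .refl _

/-! ### Contexts and processes with one role per process -/

theorem Comp.typed {s : ℕ} {p : K.Role} {Q : Proc K} {Γ : Ctx K} (h : Comp s p (Γ.ep s p) Q)
    (hΓ : ∀ c e, Γ.ent c = some e → c ≠ .ep s p → e.Ended) : Typed .empty Γ Q := by
  refine h.1.congr (V := ∅) (fun x hx => h.1.fv x hx rfl) (fun x S hS => by cases hS) ?_ ?_
  · intro c e he _ _
    obtain ⟨rfl, U, h1, rfl⟩ := Ctx.ent_atMostEp he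
    exact ⟨_, Ctx.ent_ep.2 h1, .refl _⟩
  · intro c e he hn
    by_cases hc : c = .ep s p
    · subst hc
      obtain ⟨U, h1, rfl⟩ := Ctx.ent_ep'.1 he
      rw [h1]
      exact ⟨Set.empty_subset _, _, Ctx.ent_atMostEp_self s p U, .refl _⟩
    · exact absurd (hΓ c e he hc) hn

theorem Ctx.ended_dead {Γ : Ctx K} {s : ℕ} {p : K.Role} {e : Ent K}
    (he : Γ.ent (.ep s p) = some e) (h : e.Ended) : e.Dead := by
  obtain ⟨U, -, rfl⟩ := Ctx.ent_ep'.1 he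
  exact UType.dead_toEnt.2 (UType.ended_toEnt.1 h)

/-- Since `Q` is closed, `congr` applies with no variables in use; this also drops variables of
basic type, which are not `Dead`. Other endpoints have terminated types and drop out as well. -/
theorem Comp.of_typed {s : ℕ} {p : K.Role} {Q : Proc K} {Γ : Ctx K} (h : Typed .empty Γ Q)
    (hΓ : ∀ c e, Γ.ent c = some e → c ≠ .ep s p → e.Ended) (hv : Q.fv = ∅) (ht : Q.Tame) :
    Comp s p (Γ.ep s p) Q := by
  refine ⟨h.congr (V := ∅) hv.le ?_ ?_ ?_, ht⟩
  · intro x S hS _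
    exact hΓ (.var x) (some S) (Ctx.ent_var.2 ⟨S, hS, rfl⟩) (by simp)
  · intro c e he hd hc
    by_cases hcp : c = .ep s p
    · subst hcp
      obtain ⟨U, h1, rfl⟩ := Ctx.ent_ep'.1 he
      rw [h1]
      exact ⟨_, Ctx.ent_atMostEp_self s p U, .refl _⟩
    · cases c with
      | var x => exact absurd (hc rfl) id
      | ep s' p' => exact absurd (Ctx.ended_dead he (hΓ _ e he hcp)) hd
  · intro c e he _
    obtain ⟨rfl, U, h1, rfl⟩ := Ctx.ent_atMostEp he
    exact ⟨Set.empty_subset _, _, Ctx.ent_ep.2 h1, .refl _⟩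

/-- Each process `Ps p`, for `p ∈ I`, is typed by the entry of `s[p]` in `Γ`, and the other entries
of `Γ` are terminated. -/
structure State (s : ℕ) (I : Finset K.Role) (Γ : Ctx K) (Ps : K.Role → Proc K) : Prop where
  rest : ∀ c e, Γ.ent c = some e → (∀ p ∈ I, c ≠ .ep s p) → e.Ended
  comp : ∀ p ∈ I, Comp s p (Γ.ep s p) (Ps p)

theorem State.typed {s : ℕ} {I : Finset K.Role} {Γ : Ctx K} {Ps : K.Role → Proc K}
    (h : State s I Γ Ps) : Typed .empty Γ (bigPar (I.toList.map Ps)) := by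
  -- The context for a sublist `l` omits only the endpoints of the roles of `I` outside `l`. The
  -- remaining entries of `Γ` are terminated and go to the inactive process at the end.
  have key : ∀ l : List K.Role, l.Nodup → (∀ p ∈ l, p ∈ I) →
      Typed .empty (Γ.filter {c | ∀ p ∈ I, c = .ep s p → p ∈ l}) (bigPar (l.map Ps)) := by
    intro l
    induction l with
    | nil =>
      refine fun _ _ => .nil (Ctx.ended_iff.2 fun c e he => ?_)
      rw [Ctx.ent_filter] at he
      split_ifs at he with hc
      exact h.rest c e he fun p hp e => by simpa using hc p hp e
    | cons p l ih =>
      intro hl hI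
      have hl' := List.nodup_cons.1 hl
      have hp := hI p (by simp)
      refine .par (Γ₁ := .atMostEp s p (Γ.ep s p)) ?_ (h.comp p hp).1
        (ih hl'.2 fun q hq => hI q (List.mem_cons_of_mem _ hq))
      refine Ctx.split_iff.2 fun c => ?_
      by_cases hc : c = .ep s p
      · subst hc
        right
        rw [Ctx.ent_filter, Ctx.ent_filter, if_neg, if_pos]
        · simp [Ctx.atMostEp, Ctx.ent]
        · intro q _ e
          cases e
          exact List.mem_cons_self
        · exact fun hc => hl'.1 (hc p hp rfl)
      · left
        constructor
        · by_contra hne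
          obtain ⟨e, he⟩ := Option.ne_none_iff_exists'.1 hne
          exact hc (Ctx.ent_atMostEp he).1
        · rw [Ctx.ent_filter, Ctx.ent_filter]
          have hiff : (∀ q ∈ I, c = .ep s q → q ∈ p :: l) ↔ ∀ q ∈ I, c = .ep s q → q ∈ l := by
            refine forall₂_congr fun q _ => forall_congr' fun e => ?_
            rw [List.mem_cons, or_iff_right]
            rintro rfl
            exact hc e
          by_cases hm : ∀ q ∈ I, c = .ep s q → q ∈ l
          · exact (if_pos (hiff.2 hm)).trans (if_pos hm).symm
          · exact (if_neg (mt hiff.1 hm)).trans (if_neg hm).symm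
  have := key I.toList I.nodup_toList (fun p hp => Finset.mem_toList.1 hp)
  convert this using 1
  refine Ctx.ent_injective fun c => ?_
  rw [Ctx.ent_filter, if_pos]
  exact fun p hp _ => Finset.mem_toList.2 hp

theorem State.resCrashed {s : ℕ} {I : Finset K.Role} {Γ : Ctx K} {Ps : K.Role → Proc K}
    (h : State s I Γ Ps) : (bigPar (I.toList.map Ps)).ResCrashed := by
  have key : ∀ l : List K.Role, (∀ p ∈ l, p ∈ I) → (bigPar (l.map Ps)).ResCrashed := by
    intro l
    induction l with
    | nil => exact fun _ => trivial
    | cons p l ih =>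
      intro hI
      have := h.comp p (hI p (by simp))
      exact ⟨this.1.resCrashed this.2.2, ih fun q hq => hI q (List.mem_cons_of_mem _ hq)⟩
  exact key _ fun p hp => Finset.mem_toList.1 hp

theorem State.mem {s : ℕ} {I : Finset K.Role} {Γ : Ctx K} {Ps : K.Role → Proc K}
    (h : State s I Γ Ps) {p : K.Role} {U : UType K} (hU : Γ.ep s p = some U) (hn : ¬ U.Ended) :
    p ∈ I := by
  by_contra hp
  refine hn (UType.ended_toEnt.1 (h.rest _ _ (Ctx.ent_ep.2 hU) ?_))
  rintro q hq e
  cases e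
  exact hp hq

open Classical in
theorem State.set {s : ℕ} {I : Finset K.Role} {Γ : Ctx K} {Ps : K.Role → Proc K}
    (h : State s I Γ Ps) {p : K.Role} (hp : p ∈ I) {U : UType K} {Q : Proc K}
    (hQ : Comp s p (some U) Q) : State s I (Γ.setEp s p U) (Function.update Ps p Q) := by
  constructor
  · intro c e he hc
    rw [Ctx.ent_setEp_of_ne (hc p hp)] at he
    exact h.rest c e he hc
  · intro q hq
    by_cases e : q = p
    · subst e
      rw [Ctx.setEp_self, Function.update_self]
      exact hQ
    · rw [Ctx.setEp_of_ne (by tauto), Function.update_of_ne e]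
      exact h.comp q hq

open Classical in
theorem State.update {s : ℕ} {I : Finset K.Role} {Γ : Ctx K} {Ps : K.Role → Proc K}
    (h : State s I Γ Ps) {p : K.Role} {Q : Proc K} (hQ : Comp s p (Γ.ep s p) Q) :
    State s I Γ (Function.update Ps p Q) := by
  refine ⟨h.rest, fun q hq => ?_⟩
  by_cases e : q = p
  · subst e
    rw [Function.update_self]
    exact hQ
  · rw [Function.update_of_ne e]
    exact h.comp q hq

open Classical in
theorem State.set_two {s : ℕ} {I : Finset K.Role} {Γ : Ctx K} {Ps : K.Role → Proc K}
    (h : State s I Γ Ps) {p q : K.Role} (hp : p ∈ I) (hq : q ∈ I) (hpq : p ≠ q) {U V : UType K}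
    {P Q : Proc K} (hP : Comp s p (some U) P) (hQ : Comp s q (some V) Q)
    (hr : Red (.par (Ps q) (Ps p)) (.par Q P)) :
    ∃ Ps', Red (bigPar (I.toList.map Ps)) (bigPar (I.toList.map Ps')) ∧
      State s I ((Γ.setEp s p U).setEp s q V) Ps' :=
  ⟨_, Red.bigPar_two I.nodup_toList (Finset.mem_toList.2 hp) (Finset.mem_toList.2 hq) hpq hr,
    (h.set hp hP).set hq hQ⟩

/-! ### Progress -/

theorem SType.Head.int_not_ended {T : SType K} {q n lab pay cont}
    (h : T.Head (.int q n lab pay cont)) : ¬ (UType.sess T).Ended := fun hT => by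
  cases h.unique (UType.ended_sess.1 hT).head_done

theorem SType.Head.ext_not_ended {T : SType K} {q n lab pay cont}
    (h : T.Head (.ext q n lab pay cont)) : ¬ (UType.sess T).Ended := fun hT => by
  cases h.unique (UType.ended_sess.1 hT).head_done

theorem State.focus {s : ℕ} {I : Finset K.Role} {Γ : Ctx K} {Ps : K.Role → Proc K}
    (h : State s I Γ Ps) (hn : ∀ p ∈ I, (Ps p).ncalls = 0) {p : K.Role} {U : UType K}
    (hU : Γ.ep s p = some U) (hne : ¬ U.Ended) : p ∈ I ∧ ∃ k F L, Focus s p U (Ps p) k F L := by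
  have hp := h.mem hU hne
  have := h.comp p hp
  rw [hU] at this
  exact ⟨hp, this.focus (hn p hp) hne⟩

theorem Ctx.setEp_alive {Γ : Ctx K} {s : ℕ} {R : Set K.Role} {p : K.Role} {U : UType K}
    (h : ∀ r ∈ R, Γ.ep s r ≠ some .crashed) (hp : p ∈ R → U ≠ .crashed) :
    ∀ r ∈ R, (Γ.setEp s p U).ep s r ≠ some .crashed := by
  intro r hr
  by_cases e : r = p
  · subst e
    rw [Ctx.setEp_self]
    exact fun h => hp hr (Option.some.inj h)
  · rw [Ctx.setEp_of_ne (by tauto)]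
    exact h r hr

open Classical in
/-- If the context has a move then the processes follow some move of the context. -/
theorem State.progress {s : ℕ} {I : Finset K.Role} {R : Set K.Role} {Γ Γ'' : Ctx K}
    {Ps : K.Role → Proc K} (h : State s I Γ Ps) (hn : ∀ p ∈ I, (Ps p).ncalls = 0)
    (hsafe : Safe s R Γ) (halive : ∀ p ∈ R, Γ.ep s p ≠ some .crashed) (hm : Move s R Γ Γ'') :
    ∃ Γ' Ps', Move s R Γ Γ' ∧ Red (bigPar (I.toList.map Ps)) (bigPar (I.toList.map Ps')) ∧
      State s I Γ' Ps' ∧ ∀ p ∈ R, Γ'.ep s p ≠ some .crashed := by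
  rcases hm with ⟨p, q, l, ht⟩ | ⟨q, p, ht⟩ | ⟨p, hp, ht⟩
  -- The label of the given move is forgotten: the process of `p` decides which label is sent.
  · obtain ⟨_, ⟨n, lab, pay, cont, _, ⟨T, hT, hT'⟩, -, -⟩, hr⟩ := ht.canAct
    obtain ⟨hpI, k₂, F₂, L₂, f₂⟩ := h.focus hn hT hT'.int_not_ended
    obtain ⟨hinj, v, b, P, i, rfl, hb, hv, hP⟩ := f₂.sel_of_head hT'
    rcases hr with ⟨S', ⟨m, lab', pay', cont', j₀, ⟨T₁, hT₁, hT₁'⟩, -, -⟩, -⟩ | hq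
    · obtain ⟨hqI, k₁, F₁, L₁, f₁⟩ := h.focus hn hT₁ hT₁'.ext_not_ended
      have hpq : p ≠ q := by
        rintro rfl
        rw [hT] at hT₁
        cases hT₁
        cases hT'.unique hT₁'
      obtain ⟨φ, hφ, hΓ⟩ := hsafe
      -- Safety is used here: `p` can output the label of the process and `q` can input something
      -- from `p`, so this label can be transmitted.
      obtain ⟨Γ₁, ht₁⟩ := hφ.comm Γ p q _ _ _ _ hΓ (Trans.exists_out ⟨T, hT, hT'⟩ i)
        (Trans.exists_inp ⟨T₁, hT₁, hT₁'⟩ j₀)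
      obtain ⟨S, ⟨n₀, lab₀, pay₀, cont₀, i₀, ⟨T₀, hT₀, hT₀'⟩, hl₀, hS₀⟩, hr⟩ := ht₁.canAct
      rw [hT] at hT₀
      cases hT₀
      cases hT'.unique hT₀'
      -- Heads are unique and labels distinct, so the transmission is that of branch `i`; below, `q`
      -- is not crashed, which leaves a proper communication.
      cases hinj hl₀
      rcases hr with ⟨S', ⟨n₁, lab₁, pay₁, cont₁, j, ⟨T₃, hT₃, hT₃'⟩, hl, rfl⟩, hSS⟩ | hr
      · rw [hT₁] at hT₃
        cases hT₃
        cases hT₁'.unique hT₃'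
        subst hS₀
        obtain ⟨m', lab'', P', j', rfl, hl', hP'⟩ := f₁.branch_of_head hT₁' j (hb.trans hSS) hv
        obtain ⟨d₁, -, hF₁, e₁, -⟩ := f₁
        obtain ⟨d₂, -, hF₂, e₂, -⟩ := f₂
        -- The contexts of sender and receiver stay in place while their prefixes react.
        obtain ⟨Ps', hr, hst⟩ := h.set_two hpI hqI hpq hP hP' (by
          rw [e₁, e₂]
          exact (RedPair.comm j' (hl'.trans hl)).plug hF₁ hF₂)
        refine ⟨_, Ps', .inl ⟨p, q, lab i, Trans.frame_two hpq hT hT₁ ?_⟩, hr, hst, ?_⟩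
        · have := Trans.inp_of_head (s := s) (p := q) hT₁' j
          rw [hl] at this
          exact .com (.out_of_head hT' i) this hSS (Ctx.split_singleEp hpq _ _)
            (Ctx.split_singleEp hpq _ _)
        · exact Ctx.setEp_alive (Ctx.setEp_alive halive fun _ => by simp) fun _ => by simp
      · rw [hT₁] at hr
        cases hr
    · obtain ⟨hqI, k₁, F₁, L₁, f₁⟩ := h.focus hn hq UType.not_ended_crashed
      have hpq : p ≠ q := by
        rintro rfl
        rw [hT] at hq
        cases hq
      cases f₁.crashed
      have hQ := h.comp q hqI
      rw [hq] at hQ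
      obtain ⟨d₁, -, hF₁, e₁, -⟩ := f₁
      obtain ⟨d₂, -, hF₂, e₂, -⟩ := f₂
      obtain ⟨Ps', hr, hst⟩ := h.set_two hpI hqI hpq hP hQ (by
        rw [e₁, e₂]
        exact RedPair.lost.plug hF₁ hF₂)
      refine ⟨_, Ps', .inl ⟨p, q, lab i, Trans.frame_two hpq hT hq ?_⟩, hr, hst, ?_⟩
      · exact .lost (.out_of_head hT' i) .stopped (Ctx.split_singleEp hpq _ _)
          (Ctx.split_singleEp hpq _ _)
      · exact Ctx.setEp_alive (Ctx.setEp_alive halive fun _ => by simp)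
          fun hqR => absurd hq (halive q hqR)
  · obtain ⟨⟨m, lab', pay', cont', j, ⟨T, hT, hT'⟩, hl, hS⟩, hp⟩ := ht.canAct
    obtain ⟨hqI, k₁, F₁, L₁, f₁⟩ := h.focus hn hT hT'.ext_not_ended
    obtain ⟨hpI, k₂, F₂, L₂, f₂⟩ := h.focus hn hp UType.not_ended_crashed
    have hpq : p ≠ q := by
      rintro rfl
      rw [hT] at hp
      cases hp
    cases f₂.crashed
    have hP := h.comp p hpI
    rw [hp] at hP
    -- The payload of the label `crash` is the unit, so the crash handling branch is instantiated
    -- with the unit value.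
    have hb : (Payload.base K.unitTy).Sub (pay' j) := by
      rw [hS]
      exact .of_step trivial trivial (.base (K.bsub_refl _))
    obtain ⟨m', lab'', P', j', rfl, hl', hP'⟩ := f₁.branch_of_head hT' j hb K.unit_hasTy
    obtain ⟨d₁, -, hF₁, e₁, -⟩ := f₁
    obtain ⟨d₂, -, hF₂, e₂, -⟩ := f₂
    obtain ⟨Ps', hr, hst⟩ := h.set_two hpI hqI hpq hP hP' (by
      rw [e₁, e₂]
      exact (RedPair.detect j' (hl'.trans hl)).plug hF₁ hF₂)
    refine ⟨_, Ps', .inr (.inl ⟨q, p, Trans.frame_two hpq hp hT ?_⟩), hr, hst, ?_⟩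
    · have := Trans.inp_of_head (s := s) (p := q) hT' j
      rw [hl, hS] at this
      exact .detect this .stopped (Ctx.split_singleEp hpq _ _).symm
        (Ctx.split_singleEp hpq _ _).symm
    · exact Ctx.setEp_alive (Ctx.setEp_alive halive fun hpR => absurd hp (halive p hpR))
        fun _ => by simp
  · obtain ⟨T, hT, hT'⟩ := ht.canAct
    have hne : ¬ (UType.sess T).Ended := fun h => hT' (UType.ended_sess.1 h)
    have hpI := h.mem hT hne
    have hP := h.comp p hpI
    rw [hT] at hP
    obtain ⟨Q, hr, hQ⟩ := hP.exists_crash (hn p hpI) hne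
    exact ⟨_, _, .inr (.inr ⟨p, hp, Trans.frame_one hT (.crash hT')⟩),
      Red.bigPar_one I.nodup_toList (Finset.mem_toList.2 hpI) hr, h.set hpI hQ,
      Ctx.setEp_alive halive fun hpR => absurd hpR hp⟩

/-! ### Assumption-abiding reductions -/

theorem Move.any {s : ℕ} {R : Set K.Role} {Γ Γ' : Ctx K} (h : Move s R Γ Γ') : MoveAny Γ Γ' :=
  ⟨s, h.imp_right (Or.imp_right fun ⟨p, _, h⟩ => ⟨p, id, h⟩)⟩

/-- The steps of `AbidingPlus`. -/
def AbidingStep (R : ℕ → Set K.Role) (c c' : Ctx K × Proc K) : Prop :=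
  AbidingRed R .empty c.1 c.2 c'.2 ∧ Relation.ReflTransGen MoveAny c.1 c'.1 ∧
    Typed .empty c'.1 c'.2

/-- `P` is typed by the safe context `Γ` and congruent to the composition of the processes `Ps p`,
each of which plays its role. -/
structure Config (s : ℕ) (R : ℕ → Set K.Role) (I : Finset K.Role) (Γ : Ctx K) (P : Proc K)
    (Ps : K.Role → Proc K) : Prop where
  typed : Typed .empty Γ P
  cong : Cong P (bigPar (I.toList.map Ps))
  state : State s I Γ Ps
  safe : Safe s (R s) Γ
  alive : ∀ p ∈ R s, Γ.ep s p ≠ some .crashed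

theorem State.ended_of_ne {s : ℕ} {I : Finset K.Role} {Γ : Ctx K} {Ps : K.Role → Proc K}
    (h : State s I Γ Ps) {s' : ℕ} (hs : s' ≠ s) {p : K.Role} {U : UType K}
    (hU : Γ.ep s' p = some U) : U.Ended := by
  refine UType.ended_toEnt.1 (h.rest _ _ (Ctx.ent_ep.2 hU) ?_)
  rintro q - e
  cases e
  exact hs rfl

/-- An entry of `A` that is neither terminated nor crashed would have to be used in `Q` other than
as a crashed endpoint. Without such entries the session cannot move. -/
theorem safe_of_resCrashed {Θ : DefEnv K} {Γ : Ctx K} {A : K.Role → Option (UType K)} {Q : Proc K}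
    {R : Set K.Role} (h : Typed Θ Γ (.res A Q)) (hQ : (Proc.res A Q).ResCrashed) :
    Safe 0 R (Ctx.consSess A .empty) := by
  refine safe_of_not_live fun p U hU => ?_
  by_contra! hn
  cases h with
  | res _ _ h =>
    have he : (Ctx.consSess A Γ).ent (.ep 0 p) = some U.toEnt := Ctx.ent_ep.2 hU
    rcases h.has he fun h => hn.1 (UType.ended_toEnt.1 h) with h1 | ⟨-, h1⟩
    · exact hQ.2 p h1
    · exact hn.2 (UType.toEnt_inj h1)

/-- Sessions other than `s` have only terminated entries, hence are safe and without crashed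
endpoints. For `s`, reliability follows from the entries of `Γ'`. -/
theorem Config.step {s : ℕ} {R : ℕ → Set K.Role} {I : Finset K.Role} {Γ Γ' : Ctx K} {P : Proc K}
    {Ps Ps' : K.Role → Proc K} (h : Config s R I Γ P Ps) (hs : State s I Γ' Ps')
    (hr : Red (bigPar (I.toList.map Ps)) (bigPar (I.toList.map Ps')))
    (hm : Relation.ReflTransGen MoveAny Γ Γ') (hsafe : Safe s (R s) Γ')
    (halive : ∀ p ∈ R s, Γ'.ep s p ≠ some .crashed) :
    AbidingStep R (Γ, P) (Γ', bigPar (I.toList.map Ps')) ∧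
      Config s R I Γ' (bigPar (I.toList.map Ps')) Ps' := by
  have hred : Red P (bigPar (I.toList.map Ps')) := .cong h.cong hr (.refl _)
  refine ⟨⟨⟨h.typed, ?_, hred, ?_, ?_⟩, hm, hs.typed⟩, hs.typed, .refl _, hs, hsafe, halive⟩
  · intro s' _
    by_cases e : s' = s
    · subst e
      exact h.safe
    · exact safe_of_not_live fun p U hU => .inl (h.state.ended_of_ne e hU)
  · rintro s' -
    refine ⟨hred, ?_⟩
    rintro p hp ⟨Q, hQ⟩
    have he := hs.typed.ent_of_has ((hQ.has true s' p).2 (.inr ⟨rfl, rfl, rfl⟩))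
    have hU : Γ'.ep s' p = some .crashed := Ctx.ent_ep.1 he
    by_cases e : s' = s
    · subst e
      exact halive p hp hU
    · exact UType.not_ended_crashed (hs.ended_of_ne e hU)
  · intro A Q A' Q' h1 h2 _ h3
    -- With no reliable roles assumed in the restricted session, only its safety remains to be
    -- checked.
    refine ⟨∅, safe_of_resCrashed h2 ?_, h3, fun p hp => absurd hp id⟩
    exact h1.resCrashed.1 (h.cong.resCrashed.2 h.state.resCrashed)

open Classical in
/-- All pending process calls can be resolved, without a move of the context. -/
theorem Config.normalise {s : ℕ} {R : ℕ → Set K.Role} {I : Finset K.Role} {Γ : Ctx K} {P : Proc K}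
    {Ps : K.Role → Proc K} (h : Config s R I Γ P Ps) :
    ∃ P' Ps', Relation.ReflTransGen (AbidingStep R) (Γ, P) (Γ, P') ∧ Config s R I Γ P' Ps' ∧
      ∀ p ∈ I, (Ps' p).ncalls = 0 := by
  -- The measure is the total number of unguarded calls; each step resolves one in a single
  -- component.
  induction hn : ∑ p ∈ I, (Ps p).ncalls using Nat.strong_induction_on generalizing P Ps with
  | _ n ih =>
    by_cases h0 : ∀ p ∈ I, (Ps p).ncalls = 0
    · exact ⟨P, Ps, .refl, h, h0⟩
    · push Not at h0
      obtain ⟨p, hp, hp'⟩ := h0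
      obtain ⟨Q, h1, h2, h3⟩ := (h.state.comp p hp).exists_call_step (Nat.pos_of_ne_zero hp')
      obtain ⟨k1, k2⟩ := h.step (h.state.update h2)
        (.bigPar_one I.nodup_toList (Finset.mem_toList.2 hp) h1) .refl h.safe h.alive
      have hlt : ∑ q ∈ I, (Function.update Ps p Q q).ncalls < n := by
        rw [← hn]
        refine Finset.sum_lt_sum (fun q _ => ?_) ⟨p, hp, by rwa [Function.update_self]⟩
        by_cases e : q = p
        · subst e
          rw [Function.update_self]
          exact h3.le
        · rw [Function.update_of_ne e]
      obtain ⟨P', Ps', k3, k4⟩ := ih _ hlt k2 rfl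
      exact ⟨P', Ps', .head k1 k3, k4⟩

-- Passage between decompositions into roles and configurations

open Classical in
theorem RolePerProcess.exists_config {s : ℕ} {R : ℕ → Set K.Role} {I : Finset K.Role} {Γ : Ctx K}
    {P : Proc K} (h : RolePerProcess s I Γ P) (htyped : Typed .empty Γ P)
    (hsafe : Safe s (R s) Γ) (halive : ∀ p ∈ R s, Γ.ep s p ≠ some .crashed) :
    ∃ Ps, Config s R I Γ P Ps := by
  obtain ⟨Ps, Γs, hcong, ⟨hvar, hep⟩, hPs⟩ := h
  have hent : ∀ c e, Γ.ent c = some e → ∃ q ∈ I, (Γs q).ent c = some e := by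
    intro c e he
    cases c with
    | var x =>
      obtain ⟨S, h1, rfl⟩ := Ctx.ent_var.1 he
      obtain ⟨q, hq, h2⟩ := (hvar x S).1 h1
      exact ⟨q, hq, Ctx.ent_var.2 ⟨S, h2, rfl⟩⟩
    | ep s' p' =>
      obtain ⟨U, h1, rfl⟩ := Ctx.ent_ep'.1 he
      obtain ⟨q, hq, h2⟩ := (hep s' p' U).1 h1
      exact ⟨q, hq, Ctx.ent_ep.2 h2⟩
  have hnil : ∀ q ∈ I, Cong (Ps q) .nil → ∀ c e, (Γs q).ent c = some e → e.Ended :=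
    fun q hq h => Ctx.ended_iff.1 ((hPs q hq).1.ended_of_cong_nil h)
  have hend : ∀ q ∈ I, ∀ c e, (Γs q).ent c = some e → c ≠ .ep s q → e.Ended := by
    intro q hq c e he hc
    rcases (hPs q hq).2 with h | h
    · exact hnil q hq h c e he
    · obtain ⟨Γ₀, U, h1, -, h2⟩ := h.ctx
      rw [((Ctx.isOne_singleEp s q U).split h1).2.2 _ hc] at he
      exact Ctx.ended_iff.1 h2 c e he
  -- Components congruent to the inactive process need not satisfy the conditions of `Comp`, so they
  -- are replaced by the inactive process itself.
  refine ⟨fun p => if Cong (Ps p) .nil then .nil else Ps p, htyped, hcong.trans ?_, ⟨?_, ?_⟩,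
    hsafe, halive⟩
  · generalize I.toList = l
    induction l with
    | nil => exact .refl _
    | cons p l ih =>
      refine .par ?_ ih
      dsimp only
      split_ifs with hp
      exacts [hp, .refl _]
  · intro c e he hc
    obtain ⟨q, hq, h⟩ := hent c e he
    exact hend q hq c e h (hc q hq)
  · intro p hp
    split_ifs with hn
    · refine ⟨.nil (Ctx.ended_iff.2 fun c e he => ?_), trivial, trivial⟩
      obtain ⟨rfl, U, h1, rfl⟩ := Ctx.ent_atMostEp he
      -- The entry of `s[p]` may stem from the context of another role, where it is terminated too.
      obtain ⟨q, hq, h2⟩ := hent _ _ (Ctx.ent_ep.2 h1)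
      by_cases e : q = p
      · subst e
        exact hnil q hq hn _ _ h2
      · exact hend q hq _ _ h2 fun h => e (by cases h; rfl)
    · have hO := (hPs p hp).2.resolve_left hn
      obtain ⟨Γ₀, U, h1, -⟩ := hO.ctx
      have hU := Ctx.ent_ep.1 ((Ctx.isOne_singleEp s p U).split h1).1
      have := Comp.of_typed hO.typed (hend p hp) hO.closed ⟨hO.guarded, hO.restricted⟩
      rw [hU] at this
      rwa [(hep s p U).2 ⟨p, hp, hU⟩]

-- Each role receives all of `Γ` except the endpoints of the other roles in `s`. The contexts
-- overlap in terminated or basic entries, as a union permits; a role has to exist so that these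
-- entries are covered.
open Classical in
theorem Config.exists_roles {s : ℕ} {R : ℕ → Set K.Role} {I : Finset K.Role} {Γ : Ctx K}
    {P : Proc K} {Ps : K.Role → Proc K} (h : Config s R I Γ P Ps)
    (hn : ∀ p ∈ I, (Ps p).ncalls = 0) (hI : I.Nonempty) : RolePerProcess s I Γ P := by
  obtain ⟨p₀, hp₀⟩ := hI
  have hself : ∀ p : K.Role, ¬ (s = s ∧ p ∈ I ∧ p ≠ p) := fun p h => h.2.2 rfl
  refine ⟨Ps, fun p => ⟨Γ.var, fun s' r => if s' = s ∧ r ∈ I ∧ r ≠ p then none else Γ.ep s' r⟩,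
    h.cong, ⟨fun x S => ⟨fun h => ⟨p₀, hp₀, h⟩, fun ⟨_, _, h⟩ => h⟩, fun s' r U => ?_⟩,
    fun p hp => ?_⟩
  · constructor
    · intro hU
      by_cases hr : r ∈ I
      · exact ⟨r, hr, (if_neg fun h => h.2.2 rfl).trans hU⟩
      · exact ⟨p₀, hp₀, (if_neg fun h => hr h.2.1).trans hU⟩
    · rintro ⟨q, -, hU⟩
      dsimp only at hU
      split_ifs at hU
      exact hU
  · set Δ : Ctx K := ⟨Γ.var, fun s' r => if s' = s ∧ r ∈ I ∧ r ≠ p then none else Γ.ep s' r⟩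
      with hΔ
    have hcomp := h.state.comp p hp
    have hep : Δ.ep s p = Γ.ep s p := if_neg (hself p)
    have hend : ∀ c e, Δ.ent c = some e → c ≠ .ep s p → e.Ended := by
      intro c e he hc
      cases c with
      | var x => exact h.state.rest (.var x) e he fun _ _ => by simp
      | ep s' r =>
        obtain ⟨U, hU, rfl⟩ := Ctx.ent_ep'.1 he
        simp only [hΔ] at hU
        split_ifs at hU with h1
        refine h.state.rest (.ep s' r) _ (Ctx.ent_ep.2 hU) fun q hq e => ?_
        cases e
        exact h1 ⟨rfl, hq, fun e => hc (by rw [e])⟩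
    rw [← hep] at hcomp
    refine ⟨hcomp.typed hend, ?_⟩
    -- If the entry is absent or terminated, the component is congruent to the inactive process, as
    -- it has no pending calls.
    by_cases hu : ∀ U, Δ.ep s p = some U → U.Ended
    · exact .inl (hcomp.cong_nil (hn p hp) hu)
    · push Not at hu
      obtain ⟨U, hU, hne⟩ := hu
      refine .inr ⟨hcomp.typed hend, hcomp.2.1, ?_, ⟨Δ.filter {.ep s p}ᶜ, U, ?_, hne, ?_⟩,
        hcomp.2.2⟩
      · exact Set.eq_empty_of_forall_notMem fun x hx => hcomp.1.fv x hx rfl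
      · refine (Ctx.isOne_singleEp s p U).split_of (Ctx.ent_ep.2 hU) ?_ fun c hc => ?_
        · simp [Ctx.ent_filter]
        · exact ((Ctx.ent_filter ..).trans (if_pos hc)).symm
      · refine Ctx.ended_iff.2 fun c e he => ?_
        rw [Ctx.ent_filter] at he
        split_ifs at he with hc
        exact hend c e he hc

theorem State.nonempty {s : ℕ} {I : Finset K.Role} {R : Set K.Role} {Γ Γ' : Ctx K}
    {Ps : K.Role → Proc K} (h : State s I Γ Ps) (hm : Move s R Γ Γ') : I.Nonempty := by
  rcases hm with ⟨p, q, l, ht⟩ | ⟨q, p, ht⟩ | ⟨p, -, ht⟩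
  · obtain ⟨_, ⟨_, _, _, _, _, ⟨T, hT, hT'⟩, -, -⟩, -⟩ := ht.canAct
    exact ⟨p, h.mem hT hT'.int_not_ended⟩
  · exact ⟨p, h.mem ht.canAct.2 UType.not_ended_crashed⟩
  · obtain ⟨T, hT, hT'⟩ := ht.canAct
    exact ⟨p, h.mem hT fun h => hT' (UType.ended_sess.1 h)⟩

theorem Safe.move {s : ℕ} {R : Set K.Role} {Γ Γ' : Ctx K} (h : Safe s R Γ) (hm : Move s R Γ Γ') :
    Safe s R Γ' :=
  let ⟨φ, h1, h2⟩ := h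
  ⟨φ, h1, h1.move _ _ h2 hm⟩

end MPST

-- Session fidelity

theorem mainTheorem3 (K : MPST.Signature) (s : ℕ) (R : ℕ → Set K.Role) (I : Finset K.Role)
    (Γ : MPST.Ctx K) (P : MPST.Proc K)
    (htyped : MPST.Typed .empty Γ P)
    (hsafe : MPST.Safe s (R s) Γ)
    (halive : ∀ p ∈ R s, Γ.ep s p ≠ some .crashed)
    (hroles : MPST.RolePerProcess s I Γ P)
    (hmove : ∃ Γ', MPST.Move s (R s) Γ Γ') :
    ∃ (Γ' : MPST.Ctx K) (P' : MPST.Proc K),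
      MPST.Move s (R s) Γ Γ' ∧
      MPST.AbidingPlus R .empty Γ P Γ' P' ∧
      MPST.Typed .empty Γ' P' ∧
      MPST.Safe s (R s) Γ' ∧
      MPST.RolePerProcess s I Γ' P' := by
  obtain ⟨Γ'', hm⟩ := hmove
  obtain ⟨Ps, h₀⟩ := hroles.exists_config htyped hsafe halive
  -- Resolving calls exposes the prefixes and leaves `Γ` unchanged, so the given move is still
  -- available.
  obtain ⟨P₁, Ps₁, r₁, h₁, n₁⟩ := h₀.normalise
  obtain ⟨Γ', Ps₂, hm', hr, hs, ha⟩ := h₁.state.progress n₁ hsafe halive hm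
  obtain ⟨r₂, h₂⟩ := h₁.step hs hr (.single hm'.any) (hsafe.move hm') ha
  -- The continuations may have pending calls again; only without them are terminated components
  -- known to be congruent to the inactive process.
  obtain ⟨P₃, Ps₃, r₃, h₃, n₃⟩ := h₂.normalise
  exact ⟨Γ', P₃, hm', (Relation.TransGen.tail' r₁ r₂).trans_left r₃, h₃.typed, h₃.safe,
    h₃.exists_roles n₃ (h₁.state.nonempty hm)⟩
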